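/- Let $\ell\ge 1$ and $0<q<1$. Write $\mathcal H_\ell=\ell^2(\mathbb N^\ell\times\mathbb Z)$ and $\mathcal H_\Sigma=\mathcal H_\ell\otimes\ell^2(\mathbb N^\ell)=\ell^2(\mathbb N^\ell\times\mathbb Z\times\mathbb N^\ell)$, with standard bases $(e_\gamma)$; $S$ is the left shift on $\ell^2(\mathbb N)$ and $p_0$ the projection onto $\mathbb Ce_0$. Tensor products of Fréchet spaces are projective and are identified with their images in the bounded operators. **Torus algebra.** $\mathcal A_0^\infty=C^\infty(\mathbb T)$ acts on $\ell^2(\mathbb Z)$ as $\{\sum_n a_n\mathbf z^n:(a_n)\text{ rapidly decreasing}\}$, where $\mathbf z$ is the right shift, with seminorms $\|(a_n)\|_m=\sum_n(1+|n|)^m|a_n|$. For $\ell\ge1$ and $\alpha_1=S\otimes 1$, $\mathcal A_\ell^\infty$ consists of the operators $$a=\sum_{j,k\ge0}\alpha_1^{*j}(p_0\otimes a_{jk})\alpha_1^k+\sum_{k\ge0}\lambda_k\alpha_1^k+\sum_{k>0}\lambda_{-k}\alpha_1^{*k}$$ with $a_{jk}\in\mathcal A_{\ell-1}^\infty$, $\sum_{j,k}(1+j+k)^r\|a_{jk}\|_s<\infty$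 for all $r,s$, and $(\lambda_k)$ rapidly decreasing; its seminorms are $\|a\|_m=\max_{r,s\le m}\sum_{j,k}(1+j+k)^r\|a_{jk}\|_s+\sum_k(1+|k|)^m|\lambda_k|$. **Ideal.** $|D_\ell|e_\gamma=(\gamma_1+\dots+\gamma_\ell+|\gamma_{\ell+1}|)e_\gamma$ on $\mathcal H_\ell$, and $OP^{-\infty}_{D_\ell}$ is the space of operators $T$ for which all $|D_\ell|^mT|D_\ell|^n$ $(m,n\ge0)$ are bounded, with the seminorms $\||D_\ell|^mT|D_\ell|^n\|$. $\mathscr T^\infty$ is the space of operators $\sum_{j,k\ge0}\lambda_{jk}S^{*j}p_0S^k+\sum_{k\ge0}\lambda_kS^k+\sum_{k>0}\lambda_{-k}S^{*k}$ with $(\lambda_{jk}),(\lambda_k)$ rapidly decreasing, with seminorms $\sum(1+j+k)^m|\lambda_{jk}|+\sum(1+|k|)^m|\lambda_k|$; $\mathscr T^\infty_\ell$ is its $\ell$-fold tensor power, and $\mathscr J=OP^{-\infty}_{D_\ell}\otimes\mathscr T_\ell^\infty$. **The algebra $\mathscr B$.** Let $P_\ell$ be the projection of $\mathcal H_\ell$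 onto the closed span of the $e_\gamma$ with $\gamma_{\ell+1}\ge0$, and $P$ the projection of $\ell^2(\mathbb N^\ell)$ onto $\mathbb Ce_0$. $\mathscr B$ is the set of operators on $\mathcal H_\Sigma$ $$x=a_1P_\ell\otimes P+a_2P_\ell\otimes(1-P)+a_3(1-P_\ell)\otimes P+a_4(1-P_\ell)\otimes(1-P)+R,\qquad a_i\in\mathcal A_\ell^\infty,\ R\in\mathscr J .$$ The $a_i$ and $R$ are unique; $\mathscr B$ has the Fréchet topology of $(\mathcal A_\ell^\infty)^{\oplus4}\oplus\mathscr J$, and $\theta(x)=(a_1,a_2,a_3,a_4)$. Let $\iota(a)=(a,a,a,a)$. **The sphere.** Let $C(S_q^{2\ell+1})$ be the universal $C^*$-algebra with generators $z_1,\dots,z_{\ell+1}$ of the quantum sphere, represented by $\pi$ on $L_2(S_q^{2\ell+1})\subset L_2(SU_q(\ell+1))$ through left multiplication, $\pi(z_j)=q^{-j+1}\pi(u_{1j})^*$, where the $u_{1j}$ are the first row generators of $C(SU_q(\ell+1))$ and $\pi(u_{1j})$ is given on the orthonormal basis of Gelfand–Tsetlin tableaux by the Clebsch–Gordan coefficients.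 For $\gamma\in\mathbb N^\ell\times\mathbb Z\times\mathbb N^\ell$ put $k=\sum_{i\le\ell}\gamma_i+(\gamma_{\ell+1})_+$ and $n=\sum_{i\le 2\ell+1}|\gamma_i|-k$. Let $\mathbf r^{n,k}$ be the tableau with corner $n+k$, top right entry $0$ and all other entries $k$. Let $\mathbf s(\gamma)$ be the tableau whose row $i\le\ell$ has first entry $\sum_{m\le 2\ell+2-i}|\gamma_m|$, last entry $\sum_{m<i}\gamma_m$ and all entries between equal to $k$, and whose row $\ell+1$ is $\sum_{m\le\ell}\gamma_m+(\gamma_{\ell+1})_-$. The vectors $\xi_\gamma=e_{\mathbf r^{n,k},\mathbf s(\gamma)}$ form the orthonormal basis of $L_2(S_q^{2\ell+1})$, and $L_2(S_q^{2\ell+1})$ is identified with $\mathcal H_\Sigma$ by $(-1)^{\eta(\gamma)}\xi_\gamma\mapsto e_\gamma$, $\eta(\gamma)=\sum_{i\le\ell}(i-1)\gamma_i+\ell(\gamma_{\ell+1})_+$. Put $C_\ell=\pi(C(S_q^{2\ell+1}))$, the unital $C^*$-algebra generated by the $\pi(z_j)$, acting on $\mathcal H_\Sigma$. **Statement.** Define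 $$C^\infty(S_q^{2\ell+1})=\{a\in\mathscr B\cap C_\ell:\theta(a)\in\iota(\mathcal A_\ell^\infty)\}.$$ Then $C^\infty(S_q^{2\ell+1})$ is a unital $*$-algebra of operators; it is closed in the Fréchet algebra $\mathscr B$; and it is closed under holomorphic functional calculus in $C_\ell$: for $a\in C^\infty(S_q^{2\ell+1})$ and $f$ holomorphic on a neighbourhood of the spectrum of $a$ in $C_\ell$, the element $f(a)=\frac1{2\pi i}\int_\Gamma f(z)(z-a)^{-1}\,dz$, with $\Gamma$ a cycle around the spectrum in that neighbourhood, lies in $C^\infty(S_q^{2\ell+1})$. -/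

import Mathlib

open scoped ENNReal InnerProduct
open MeasureTheory

noncomputable section

namespace QSphere

/-! ### Operators on `ℓ²(X)` -/

/-- The Hilbert space `ℓ²(X)`. -/
abbrev L2 (X : Type) : Type := lp (fun _ : X => ℂ) 2

/-- The bounded operators on `ℓ²(X)`. -/
abbrev Op (X : Type) : Type := L2 X →L[ℂ] L2 X

open scoped Classical in
/-- The standard basis vector `e_x`. -/
def e {X : Type} (x : X) : L2 X := lp.single 2 x (1 : ℂ)

open scoped Classical in
theorem e_apply {X : Type} (x y : X) : (e x : L2 X) y = if y = x then 1 else 0 := by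
  unfold e
  by_cases h : y = x
  · subst h; simp
  · simp [h]

theorem inner_e_left {X : Type} (x : X) (v : L2 X) : inner ℂ (e x) v = v x := by
  classical
  have h := lp.inner_single_left (𝕜 := ℂ) (G := fun _ : X => ℂ) x (1 : ℂ) v
  have h2 : (e x : L2 X) = lp.single 2 x (1 : ℂ) := by
    unfold e; congr
  rw [h2, h]; simp

theorem orthonormal_e (X : Type) : Orthonormal ℂ (e : X → L2 X) := by
  classical
  rw [orthonormal_iff_ite]
  intro i j
  rw [inner_e_left, e_apply]

/-- The isometry `ℓ²(X) → ℓ²(Y)` that sends `e_x` to the member `v x` of an orthonormal family. -/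
def isom {X Y : Type} (v : X → L2 Y) (hv : Orthonormal ℂ v) : L2 X →L[ℂ] L2 Y :=
  hv.orthogonalFamily.linearIsometry.toContinuousLinearMap

theorem isom_e {X Y : Type} (v : X → L2 Y) (hv : Orthonormal ℂ v) (x : X) :
    isom v hv (e x) = v x := by
  classical
  have h2 : (e x : L2 X) = lp.single 2 x (1 : ℂ) := by
    unfold e; congr
  rw [h2]
  simp [isom]

/-- The isometry `e_x ↦ e_{f x}` for an injective map `f`. -/
def push {X Y : Type} (f : X → Y) (hf : Function.Injective f) : L2 X →L[ℂ] L2 Y :=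
  isom (fun x => e (f x)) ((orthonormal_e Y).comp f hf)

theorem push_e {X Y : Type} (f : X → Y) (hf : Function.Injective f) (x : X) :
    push f hf (e x) = e (f x) := isom_e _ _ x

/-! ### Tensor products of operators, under `ℓ²(X) ⊗ ℓ²(Y) = ℓ²(X × Y)` -/

theorem memℓp_two_iff {X : Type} (f : X → ℂ) :
    Memℓp f 2 ↔ Summable fun x => ‖f x‖ ^ 2 := by
  rw [memℓp_gen_iff (by norm_num)]
  simp

theorem norm_sq_eq {X : Type} (v : L2 X) : ‖v‖ ^ 2 = ∑' x, ‖v x‖ ^ 2 := by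
  have h := lp.norm_rpow_eq_tsum (p := 2) (by norm_num) v
  simpa using h

theorem summable_sq {X : Type} (v : L2 X) : Summable fun x => ‖v x‖ ^ 2 :=
  (memℓp_two_iff _).1 (lp.memℓp v)

/-- The slice `v(·, y)` of `v ∈ ℓ²(X × Y)`. -/
def slice {X Y : Type} (v : L2 (X × Y)) (y : Y) : L2 X :=
  ⟨fun x => v (x, y), (memℓp_two_iff _).2
    ((summable_sq v).comp_injective (i := fun x : X => (x, y))
      (fun _ _ h => (Prod.mk.inj h).1))⟩

theorem slice_apply {X Y : Type} (v : L2 (X × Y)) (y : Y) (x : X) :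
    slice v y x = v (x, y) := rfl

theorem slice_sum {X Y : Type} (v : L2 (X × Y)) :
    HasSum (fun y => ‖slice v y‖ ^ 2) (‖v‖ ^ 2) := by
  have h1 : HasSum (fun p : X × Y => ‖v p‖ ^ 2) (‖v‖ ^ 2) := by
    rw [norm_sq_eq]; exact (summable_sq v).hasSum
  have h2 : HasSum (fun p : Y × X => ‖v p.swap‖ ^ 2) (‖v‖ ^ 2) :=
    (Equiv.prodComm Y X).hasSum_iff.2 h1
  refine h2.prod_fiberwise fun y => ?_
  rw [norm_sq_eq]
  exact (summable_sq (slice v y)).hasSum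

theorem amp_aux {X Y : Type} (T : Op X) (v : L2 (X × Y)) :
    Summable (fun p : Y × X => ‖T (slice v p.1) p.2‖ ^ 2) ∧
      ∑' p : Y × X, ‖T (slice v p.1) p.2‖ ^ 2 ≤ (‖T‖ * ‖v‖) ^ 2 := by
  have hle : ∀ y, ‖T (slice v y)‖ ^ 2 ≤ ‖T‖ ^ 2 * ‖slice v y‖ ^ 2 := fun y => by
    rw [← mul_pow]
    exact pow_le_pow_left₀ (norm_nonneg _) (T.le_opNorm _) 2
  have hs : Summable fun y => ‖T‖ ^ 2 * ‖slice v y‖ ^ 2 := (slice_sum v).summable.mul_left _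
  have hs' : Summable fun y => ‖T (slice v y)‖ ^ 2 :=
    Summable.of_nonneg_of_le (fun _ => sq_nonneg _) hle hs
  have h1 : Summable (fun p : Y × X => ‖T (slice v p.1) p.2‖ ^ 2) := by
    refine (summable_prod_of_nonneg fun _ => sq_nonneg _).2
      ⟨fun y => summable_sq (T (slice v y)), ?_⟩
    have h : (fun y => ∑' x, ‖T (slice v y) x‖ ^ 2) = fun y => ‖T (slice v y)‖ ^ 2 :=
      funext fun y => (norm_sq_eq (T (slice v y))).symm
    rw [h]
    exact hs'
  refine ⟨h1, ?_⟩
  rw [h1.tsum_prod]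
  calc ∑' (y : Y) (x : X), ‖T (slice v y) x‖ ^ 2 = ∑' y, ‖T (slice v y)‖ ^ 2 :=
        tsum_congr fun y => (norm_sq_eq (T (slice v y))).symm
    _ ≤ ∑' y, ‖T‖ ^ 2 * ‖slice v y‖ ^ 2 := hs'.tsum_le_tsum hle hs
    _ = (‖T‖ * ‖v‖) ^ 2 := by rw [tsum_mul_left, (slice_sum v).tsum_eq, mul_pow]

/-- The operator `T ⊗ 1` on `ℓ²(X × Y)`. -/
def ampL {X : Type} (T : Op X) (Y : Type) : Op (X × Y) :=
  LinearMap.mkContinuous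
    { toFun := fun v => ⟨fun p => T (slice v p.2) p.1, (memℓp_two_iff _).2
        ((Equiv.prodComm X Y).summable_iff.2 (amp_aux T v).1)⟩
      map_add' := fun v w => by
        ext p
        have : slice (v + w) p.2 = slice v p.2 + slice w p.2 := rfl
        simp [this]; rfl
      map_smul' := fun c v => by
        ext p
        have : slice (c • v) p.2 = c • slice v p.2 := rfl
        simp [this] }
    ‖T‖ (fun v => by
      refine le_of_sq_le_sq ?_ (by positivity)
      rw [norm_sq_eq]
      refine le_trans (le_of_eq ?_) (amp_aux T v).2
      exact (Equiv.prodComm X Y).tsum_eq (fun p : Y × X => ‖T (slice v p.1) p.2‖ ^ 2))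

theorem ampL_apply {X Y : Type} (T : Op X) (v : L2 (X × Y)) (x : X) (y : Y) :
    ampL T Y v (x, y) = T (slice v y) x := rfl

/-- The operator `1 ⊗ R` on `ℓ²(X × Y)`. -/
def ampR {Y : Type} (X : Type) (R : Op Y) : Op (X × Y) :=
  push Prod.swap Prod.swap_injective ∘L ampL R X ∘L push Prod.swap Prod.swap_injective

/-- The tensor product `T ⊗ R` of bounded operators. -/
def tensor {X Y : Type} (T : Op X) (R : Op Y) : Op (X × Y) := ampL T Y ∘L ampR X R

theorem push_swap_apply {X Y : Type} (w : L2 (X × Y)) (p : Y × X) :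
    push Prod.swap Prod.swap_injective w p = w p.swap := by
  have h1 := push_e (X := X × Y) (Y := Y × X) Prod.swap Prod.swap_injective p.swap
  rw [Prod.swap_swap] at h1
  rw [← inner_e_left, ← h1]
  have h2 := LinearIsometry.inner_map_map
    ((orthonormal_e (Y × X)).comp Prod.swap
      (Prod.swap_injective (α := X) (β := Y))).orthogonalFamily.linearIsometry (e p.swap) w
  rw [inner_e_left] at h2
  exact h2

theorem slice_e {X Y : Type} (x : X) (y y' : Y) [Decidable (y' = y)] :
    slice (e (x, y)) y' = if y' = y then e x else 0 := by
  ext x'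
  rw [slice_apply, e_apply]
  by_cases h : y' = y
  · subst h
    by_cases hx : x' = x <;> simp [hx, e_apply]
  · simp [h]

theorem ampR_apply {X Y : Type} (R : Op Y) (x x' : X) (y y' : Y) [Decidable (x' = x)] :
    ampR X R (e (x, y)) (x', y') = if x' = x then R (e y) y' else 0 := by
  have h : ampR X R (e (x, y)) (x', y')
      = R (slice (push Prod.swap Prod.swap_injective (e (x, y))) x') y' := by
    change push Prod.swap Prod.swap_injective _ (x', y') = _
    rw [push_swap_apply]
    rfl
  rw [h, push_e, Prod.swap_prod_mk, slice_e]
  by_cases hx : x' = x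
  · simp [hx]
  · simp [hx]

/-- The matrix entries of `T ⊗ R` are the products of those of `T` and of `R`. -/
theorem tensor_apply {X Y : Type} (T : Op X) (R : Op Y) (x x' : X) (y y' : Y) :
    tensor T R (e (x, y)) (x', y') = T (e x) x' * R (e y) y' := by
  classical
  change ampL T Y (ampR X R (e (x, y))) (x', y') = _
  rw [ampL_apply]
  have h : slice (ampR X R (e (x, y))) y' = (R (e y) y') • e x := by
    ext z
    rw [slice_apply, ampR_apply]
    by_cases hz : z = x
    · simp [hz, e_apply]
    · simp [hz, e_apply]
  rw [h, map_smul]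
  simp [mul_comm]

/-! ### Shifts -/

/-- The unilateral right shift `S*` on `ℓ²(ℕ)`, `e_n ↦ e_{n+1}`. -/
def Sstar : Op ℕ := push Nat.succ Nat.succ_injective

/-- The left shift `S` on `ℓ²(ℕ)`. -/
def S : Op ℕ := ContinuousLinearMap.adjoint Sstar

/-- The bilateral right shift on `ℓ²(ℤ)`, i.e. multiplication by the coordinate `t` on `L²(𝕋)`. -/
def bz : Op ℤ := push (fun k => k + 1) (add_left_injective 1)

/-- `T^k` for `k ≥ 0`, and `(T*)^{-k}` for `k < 0`. -/
def twoSided {X : Type} (T : Op X) (k : ℤ) : Op X :=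
  if 0 ≤ k then T ^ k.toNat else ContinuousLinearMap.adjoint T ^ (-k).toNat

/-- The rank one projection `|e_x⟩⟨e_x|`. -/
def proj {X : Type} (x : X) : Op X := InnerProductSpace.rankOne ℂ (e x) (e x)

theorem orthonormal_sign :
    Orthonormal ℂ (fun k : ℤ => (if 0 ≤ k then (1 : ℂ) else -1) • (e k : L2 ℤ)) := by
  have h := orthonormal_iff_ite.1 (orthonormal_e ℤ)
  rw [orthonormal_iff_ite]
  intro i j
  rw [inner_smul_left, inner_smul_right, h]
  by_cases hij : i = j
  · subst hij; by_cases hi : 0 ≤ i <;> simp [hi]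
  · simp [hij]

/-- The operator `F₀` on `ℓ²(ℤ)`: `e_k ↦ e_k` for `k ≥ 0` and `e_k ↦ -e_k` for `k < 0`. -/
def F0 : Op ℤ := isom _ orthonormal_sign

/-! ### Index sets and the operators `D_ℓ`, `F_ℓ` -/

/-- `ℕ^ℓ × ℤ`. -/
abbrev Idx : ℕ → Type
  | 0 => ℤ
  | n + 1 => ℕ × Idx n

/-- `ℕ^ℓ`. -/
abbrev NIdx : ℕ → Type
  | 0 => Unit
  | n + 1 => ℕ × NIdx n

/-- The zero multi-index of `ℕ^ℓ`. -/
def nzero : (l : ℕ) → NIdx l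
  | 0 => ()
  | n + 1 => (0, nzero n)

/-- The list `[γ₁, …, γ_{ℓ+1}]` of the coordinates of `γ ∈ ℕ^ℓ × ℤ`. -/
def Idx.toList : (l : ℕ) → Idx l → List ℤ
  | 0, k => [k]
  | n + 1, x => (x.1 : ℤ) :: Idx.toList n x.2

/-- The list of the coordinates of a member of `ℕ^ℓ`. -/
def NIdx.toList : (l : ℕ) → NIdx l → List ℤ
  | 0, _ => []
  | n + 1, x => (x.1 : ℤ) :: NIdx.toList n x.2

/-- `|γ| = γ₁ + ⋯ + γ_ℓ + |γ_{ℓ+1}|`, the eigenvalue of `|D_ℓ|` at `e_γ`. -/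
def absD : (l : ℕ) → Idx l → ℕ
  | 0, k => k.natAbs
  | n + 1, x => x.1 + absD n x.2

/-- `F_ℓ = 1 ⊗ ⋯ ⊗ 1 ⊗ F₀`, the sign of `D_ℓ`. -/
def F : (l : ℕ) → Op (Idx l)
  | 0 => F0
  | n + 1 => tensor (1 : Op ℕ) (F n)

/-- `P_ℓ = (1 + F_ℓ) / 2`. -/
def PF (l : ℕ) : Op (Idx l) := (1 / 2 : ℂ) • (1 + F l)

/-- The projection `P` of `ℓ²(ℕ^ℓ)` onto the span of `e_0 ⊗ ⋯ ⊗ e_0`. -/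
def P0 (l : ℕ) : Op (NIdx l) := proj (nzero l)

/-! ### Fréchet spaces of operators -/

/-- A space of bounded operators on `ℓ²(X)` with a family of seminorms indexed by `ι`.
The seminorms are written as extended functions on all of `Op X`; only their values at members
of the space matter. -/
structure FrechetOps (ι X : Type) where
  carrier : Set (Op X)
  seminorm : ι → Op X → ℝ≥0∞

/-- The locally convex topology given by the seminorms. -/
@[reducible] def FrechetOps.topology {ι X : Type} (A : FrechetOps ι X) : TopologicalSpace A.carrier :=
  TopologicalSpace.generateFrom
    {V | ∃ (i : ι) (x : A.carrier) (r : ℝ≥0∞), 0 < r ∧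
      V = {y : A.carrier | A.seminorm i ((y : Op X) - (x : Op X)) < r}}

/-- The members of `s` that lie in the space `A` form a closed subset of `A`, for the topology
given by the seminorms of `A`. -/
def FrechetOps.IsClosedIn {ι X : Type} (A : FrechetOps ι X) (s : Set (Op X)) : Prop :=
  @IsClosed A.carrier A.topology {x : A.carrier | (x : Op X) ∈ s}

/-- `R = ∑ᵢ xᵢ ⊗ yᵢ` with `xᵢ ∈ A`, `yᵢ ∈ B`, the series being absolutely convergent for all the
projective cross seminorms. -/
def IsTensorRep {ι κ X Y : Type} (A : FrechetOps ι X) (B : FrechetOps κ Y)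
    (R : Op (X × Y)) (x : ℕ → Op X) (y : ℕ → Op Y) : Prop :=
  (∀ i, x i ∈ A.carrier) ∧ (∀ i, y i ∈ B.carrier) ∧
  (∀ p r, ∑' i, A.seminorm p (x i) * B.seminorm r (y i) < ∞) ∧
  HasSum (fun i => tensor (x i) (y i)) R

/-- The (completed) projective tensor product of two Fréchet spaces of operators, identified with
its image under the natural representation on `ℓ²(X × Y)`: its members are the sums of the
absolutely convergent series of elementary tensors, and the projective cross seminorm of `R` is
the infimum of `∑ᵢ ‖xᵢ‖ ‖yᵢ‖` over the representations of `R` as such a series. -/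
def projTensor {ι κ X Y : Type} (A : FrechetOps ι X) (B : FrechetOps κ Y) :
    FrechetOps (ι × κ) (X × Y) where
  carrier := {R | ∃ x y, IsTensorRep A B R x y}
  seminorm := fun pr R => ⨅ (x : ℕ → Op X) (y : ℕ → Op Y) (_ : IsTensorRep A B R x y),
    ∑' i, A.seminorm pr.1 (x i) * B.seminorm pr.2 (y i)

/-- `∑_k (1 + |k|)^m |λ_k|`. -/
def rapidZ (c : ℤ → ℂ) (m : ℕ) : ℝ≥0∞ := ∑' k, (1 + (k.natAbs : ℝ≥0∞)) ^ m * ‖c k‖ₑ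

/-! ### The smooth algebra of the torus equivariant picture -/

/-- `a = ∑_{n ∈ ℤ} c_n z^n` with `(c_n)` rapidly decreasing. -/
def IsCircleRep (a : Op ℤ) (c : ℤ → ℂ) : Prop :=
  (∀ m, rapidZ c m < ∞) ∧ HasSum (fun n => c n • twoSided bz n) a

/-- `C^∞(𝕋)`, acting on `ℓ²(ℤ)`. -/
def smoothCircle : FrechetOps ℕ ℤ where
  carrier := {a | ∃ c, IsCircleRep a c}
  seminorm := fun m a => ⨅ (c : ℤ → ℂ) (_ : IsCircleRep a c), rapidZ c m

/-- `α₁ = S ⊗ 1` on `ℓ²(ℕ × X)`. -/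
def alpha (X : Type) : Op (ℕ × X) := tensor S 1

/-- `∑_{j,k} (1 + j + k)^r ‖a_{jk}‖_s`. -/
def rapidNN {X : Type} (A : FrechetOps ℕ X) (a : ℕ × ℕ → Op X) (r s : ℕ) : ℝ≥0∞ :=
  ∑' p : ℕ × ℕ, (1 + (p.1 : ℝ≥0∞) + p.2) ^ r * A.seminorm s (a p)

/-- `T = ∑_{j,k} α₁*^j (p₀ ⊗ a_{jk}) α₁^k + ∑_{k ≥ 0} λ_k α₁^k + ∑_{k > 0} λ_{-k} α₁*^k`
with `(a_{jk})` and `(λ_k)` rapidly decreasing. -/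
def IsToeplitzRep {X : Type} (A : FrechetOps ℕ X) (T : Op (ℕ × X))
    (a : ℕ × ℕ → Op X) (c : ℤ → ℂ) : Prop :=
  (∀ p, a p ∈ A.carrier) ∧ (∀ r s, rapidNN A a r s < ∞) ∧ (∀ m, rapidZ c m < ∞) ∧
  ∃ T₁ T₂ : Op (ℕ × X),
    HasSum (fun p : ℕ × ℕ => ContinuousLinearMap.adjoint (alpha X) ^ p.1 *
      tensor (proj 0) (a p) * alpha X ^ p.2) T₁ ∧
    HasSum (fun k : ℤ => c k • twoSided (alpha X) k) T₂ ∧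
    T = T₁ + T₂

/-- The step from `𝒜_{ℓ-1}^∞` to `𝒜_ℓ^∞`, with
`‖T‖_m = max_{r,s ≤ m} ∑_{j,k} (1+j+k)^r ‖a_{jk}‖_s + ∑_k (1+|k|)^m |λ_k|`. -/
def smoothToeplitz {X : Type} (A : FrechetOps ℕ X) : FrechetOps ℕ (ℕ × X) where
  carrier := {T | ∃ a c, IsToeplitzRep A T a c}
  seminorm := fun m T => ⨅ (a : ℕ × ℕ → Op X) (c : ℤ → ℂ) (_ : IsToeplitzRep A T a c),
    ((⨆ r ∈ Finset.range (m + 1), ⨆ s ∈ Finset.range (m + 1), rapidNN A a r s) + rapidZ c m)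

/-- The Fréchet algebra `𝒜_ℓ^∞` of operators on `ℓ²(ℕ^ℓ × ℤ)`. -/
def smoothA : (l : ℕ) → FrechetOps ℕ (Idx l)
  | 0 => smoothCircle
  | n + 1 => smoothToeplitz (smoothA n)

/-! ### Smoothing operators and the smooth Toeplitz algebra -/

/-- `B` is the bounded extension of `|D_ℓ|^m T |D_ℓ|^n`. -/
def IsDTD (l : ℕ) (T : Op (Idx l)) (m n : ℕ) (B : Op (Idx l)) : Prop :=
  ∀ x y : Idx l, B (e y) x = (absD l x : ℂ) ^ m * (absD l y : ℂ) ^ n * T (e y) x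

/-- The smoothing operators `OP^{-∞}` of `D_ℓ`, with the seminorms `‖ |D_ℓ|^m T |D_ℓ|^n ‖`. -/
def smoothing (l : ℕ) : FrechetOps (ℕ × ℕ) (Idx l) where
  carrier := {T | ∀ m n, ∃ B, IsDTD l T m n B}
  seminorm := fun p T => ⨅ (B : Op (Idx l)) (_ : IsDTD l T p.1 p.2 B), ‖B‖ₑ

/-- `∑_{j,k} (1 + j + k)^m |λ_{jk}|`. -/
def rapidMat (a : ℕ × ℕ → ℂ) (m : ℕ) : ℝ≥0∞ :=
  ∑' p : ℕ × ℕ, (1 + (p.1 : ℝ≥0∞) + p.2) ^ m * ‖a p‖ₑ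

/-- `T = ∑_{j,k} λ_{jk} S*^j p₀ S^k + ∑_{k ≥ 0} λ_k S^k + ∑_{k > 0} λ_{-k} S*^k`
with `(λ_{jk})` and `(λ_k)` rapidly decreasing. -/
def IsTRep (T : Op ℕ) (a : ℕ × ℕ → ℂ) (c : ℤ → ℂ) : Prop :=
  (∀ m, rapidMat a m < ∞) ∧ (∀ m, rapidZ c m < ∞) ∧
  ∃ T₁ T₂ : Op ℕ,
    HasSum (fun p : ℕ × ℕ => a p • (Sstar ^ p.1 * proj 0 * S ^ p.2)) T₁ ∧
    HasSum (fun k : ℤ => c k • twoSided S k) T₂ ∧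
    T = T₁ + T₂

/-- The smooth Toeplitz algebra `𝒯^∞`. -/
def toeplitzInf : FrechetOps ℕ ℕ where
  carrier := {T | ∃ a c, IsTRep T a c}
  seminorm := fun m T => ⨅ (a : ℕ × ℕ → ℂ) (c : ℤ → ℂ) (_ : IsTRep T a c),
    (rapidMat a m + rapidZ c m)

/-- The scalars, acting on the one-dimensional Hilbert space `ℓ²(ℕ^0)`. -/
def scalarOps : FrechetOps Unit Unit where
  carrier := Set.univ
  seminorm := fun _ T => ‖T‖ₑ

/-- The `ℓ`-fold projective tensor product `𝒯_ℓ^∞` of `𝒯^∞`, on `ℓ²(ℕ^ℓ)`; its seminorms are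
indexed by `ℓ`-tuples of natural numbers. -/
def toeplitzPow : (l : ℕ) → FrechetOps (NIdx l) (NIdx l)
  | 0 => scalarOps
  | n + 1 => projTensor toeplitzInf (toeplitzPow n)

/-- `𝒥 = OP^{-∞} ⊗ 𝒯_ℓ^∞`. -/
def smoothJ (l : ℕ) : FrechetOps ((ℕ × ℕ) × NIdx l) (Idx l × NIdx l) :=
  projTensor (smoothing l) (toeplitzPow l)

/-! ### The algebra `ℬ` -/

/-- `a₁ P_ℓ ⊗ P + a₂ P_ℓ ⊗ (1 - P) + a₃ (1 - P_ℓ) ⊗ P + a₄ (1 - P_ℓ) ⊗ (1 - P)`. -/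
def symbolLift (l : ℕ) (a : Fin 4 → Op (Idx l)) : Op (Idx l × NIdx l) :=
  tensor (a 0 * PF l) (P0 l) + tensor (a 1 * PF l) (1 - P0 l) +
    tensor (a 2 * (1 - PF l)) (P0 l) + tensor (a 3 * (1 - PF l)) (1 - P0 l)

/-- `x = symbolLift a + R` with `a ∈ (𝒜_ℓ^∞)⁴` and `R ∈ 𝒥`. -/
def IsDecomp (l : ℕ) (x : Op (Idx l × NIdx l)) (a : Fin 4 → Op (Idx l))
    (R : Op (Idx l × NIdx l)) : Prop :=
  (∀ i, a i ∈ (smoothA l).carrier) ∧ R ∈ (smoothJ l).carrier ∧ x = symbolLift l a + R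

/-- The Fréchet algebra `ℬ`, with the topology of the direct sum `(𝒜_ℓ^∞)⁴ ⊕ 𝒥`. -/
def scrB (l : ℕ) : FrechetOps (ℕ × (ℕ × ℕ) × NIdx l) (Idx l × NIdx l) where
  carrier := {x | ∃ a R, IsDecomp l x a R}
  seminorm := fun p x => ⨅ (a : Fin 4 → Op (Idx l)) (R : Op (Idx l × NIdx l))
    (_ : IsDecomp l x a R), ((∑ i, (smoothA l).seminorm p.1 (a i)) + (smoothJ l).seminorm p.2 R)

open scoped Classical in
/-- The symbol `θ : ℬ → (𝒜_ℓ^∞)⁴`, `symbolLift a + R ↦ a`. -/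
def theta (l : ℕ) (x : Op (Idx l × NIdx l)) : Fin 4 → Op (Idx l) :=
  if h : ∃ a R, IsDecomp l x a R then h.choose else 0

/-- The diagonal inclusion `ι : a ↦ (a, a, a, a)`. -/
def diag (l : ℕ) (a : Op (Idx l)) : Fin 4 → Op (Idx l) := fun _ => a

/-! ### Gelfand–Tsetlin tableaux and the `C*`-algebra of the quantum sphere

A tableau is a function of the row `a` and the column `b`, both counted from `1`; row `a` has the
columns `1, …, ℓ + 2 - a`. -/

/-- The positions of a tableau. -/
def InTri (l a b : ℕ) : Prop := 1 ≤ a ∧ 1 ≤ b ∧ a + b ≤ l + 2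

/-- Gelfand–Tsetlin tableaux with vanishing top right entry, extended by `0`. -/
def IsGT (l : ℕ) (t : ℕ → ℕ → ℤ) : Prop :=
  (∀ a b, ¬ InTri l a b → t a b = 0) ∧ (∀ a b, 0 ≤ t a b) ∧
  (∀ a b, 1 ≤ a → InTri l (a + 1) b → t (a + 1) b ≤ t a b ∧ t a (b + 1) ≤ t (a + 1) b) ∧
  t 1 (l + 1) = 0

/-- `ψ(t) = -(ℓ/2) ∑_j t_{1j} + ∑_{i ≥ 2} ∑_j t_{ij}`. -/
def psi (l : ℕ) (t : ℕ → ℕ → ℤ) : ℝ :=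
  -((l : ℝ) / 2) * ∑ j ∈ Finset.Icc 1 (l + 1), (t 1 j : ℝ) +
    ∑ i ∈ Finset.Icc 2 (l + 1), ∑ j ∈ Finset.Icc 1 (l + 2 - i), (t i j : ℝ)

/-- `d_λ = ∑ q^{2ψ(s)}`, the sum being over the tableaux `s` with the same top row as `t`. -/
def qDim (l : ℕ) (q : ℝ) (t : ℕ → ℕ → ℤ) : ℝ :=
  ∑ᶠ s ∈ {s : ℕ → ℕ → ℤ | IsGT l s ∧ ∀ b ∈ Finset.Icc 1 (l + 1), s 1 b = t 1 b},
    q ^ (2 * psi l s)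

/-- `κ(r, m) = d_λ^{1/2} d_μ^{-1/2} q^{ψ(r) - ψ(m)}`, where `λ`, `μ` are the top rows. -/
def kappa (l : ℕ) (q : ℝ) (r m : ℕ → ℕ → ℤ) : ℝ :=
  Real.sqrt (qDim l q r / qDim l q m) * q ^ (psi l r - psi l m)

/-- The `q`-number `[n]_q = (q^n - q^{-n}) / (q - q^{-1})`. -/
def qNum (q : ℝ) (n : ℤ) : ℝ := (q ^ n - q ^ (-n)) / (q - q⁻¹)

/-- The factor `R(r, a, j, k)` of the Clebsch–Gordan coefficients. -/
def cgR (l : ℕ) (q : ℝ) (r : ℕ → ℕ → ℤ) (a j k : ℕ) : ℝ :=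
  (if j ≤ k then 1 else -1) *
  q ^ ((((-r a j + r (a + 1) k - k + j : ℤ) : ℝ)) / 2) *
  Real.sqrt
    ((∏ i ∈ (Finset.Icc 1 (l + 2 - a)).erase j,
        qNum q (r a i - r (a + 1) k - i + k) / qNum q (r a i - r a j - i + j)) *
     ∏ i ∈ (Finset.Icc 1 (l + 1 - a)).erase k,
        qNum q (r (a + 1) i - r a j - i + j - 1) /
          qNum q (r (a + 1) i - r (a + 1) k - i + k - 1))

/-- The factor `R'(r, a, j)` of the Clebsch–Gordan coefficients. -/
def cgR' (l : ℕ) (q : ℝ) (r : ℕ → ℕ → ℤ) (a j : ℕ) : ℝ :=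
  q ^ ((((1 - j + ∑ i ∈ Finset.Icc 1 (l + 1 - a), r (a + 1) i -
      ∑ i ∈ (Finset.Icc 1 (l + 2 - a)).erase j, r a i : ℤ) : ℝ)) / 2) *
  Real.sqrt
    ((∏ i ∈ Finset.Icc 1 (l + 1 - a), qNum q (r (a + 1) i - r a j - i + j - 1)) /
      ∏ i ∈ (Finset.Icc 1 (l + 2 - a)).erase j, qNum q (r a i - r a j - i + j))

/-- The Clebsch–Gordan coefficient `C_q(i, r, M(r))` of the move `M = (m 1, …, m i)`. -/
def cg (l : ℕ) (q : ℝ) (i : ℕ) (r : ℕ → ℕ → ℤ) (m : ℕ → ℕ) : ℝ :=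
  (∏ a ∈ Finset.Icc 1 (i - 1), cgR l q r a (m a) (m (a + 1))) * cgR' l q r i (m i)

/-- The moves `(m 1, …, m i)` with `1 ≤ m a ≤ ℓ + 2 - a`. -/
def moves (l i : ℕ) : Finset (Fin i → ℕ) :=
  Fintype.piFinset fun a : Fin i => Finset.Icc 1 (l + 1 - a)

/-- The entry `m a`, `1 ≤ a ≤ i`, of a move. -/
def moveAt {i : ℕ} (m : Fin i → ℕ) (a : ℕ) : ℕ := if h : a - 1 < i then m ⟨a - 1, h⟩ else 0

/-- The tableau `M(t)` for the move `M = (m 1, …, m i)`: `1` is added at the positions `(a, m a)`,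
`a ≤ i`. If this makes the top right entry equal to `1`, then `1` is subtracted from all
the entries, which does not change the representation of `SU_q(ℓ+1)`. -/
def moved (l i : ℕ) (m : ℕ → ℕ) (t : ℕ → ℕ → ℤ) (a b : ℕ) : ℤ :=
  t a b + (if a ≤ i ∧ b = m a then 1 else 0) - (if m 1 = l + 1 then 1 else 0)

/-- The coordinate `γ_i`, `1 ≤ i ≤ 2ℓ + 1`, of `γ ∈ ℕ^ℓ × ℤ × ℕ^ℓ`. -/
def coord (l : ℕ) (g : Idx l × NIdx l) (i : ℕ) : ℤ :=
  (Idx.toList l g.1 ++ NIdx.toList l g.2).getD (i - 1) 0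

/-- `k = γ₁ + ⋯ + γ_ℓ + (γ_{ℓ+1})₊`. -/
def kOf (l : ℕ) (g : Idx l × NIdx l) : ℤ :=
  ∑ i ∈ Finset.Icc 1 l, coord l g i + max (coord l g (l + 1)) 0

/-- `n`, where `n + k = |γ₁| + ⋯ + |γ_{2ℓ+1}|`. -/
def nOf (l : ℕ) (g : Idx l × NIdx l) : ℤ :=
  ∑ i ∈ Finset.Icc 1 (2 * l + 1), |coord l g i| - kOf l g

open scoped Classical in
/-- The tableau `r^{n,k}`: the corner is `n + k`, the top right entry is `0`, and all the other
entries are `k`. -/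
def rTab (l : ℕ) (g : Idx l × NIdx l) (a b : ℕ) : ℤ :=
  if ¬ InTri l a b then 0
  else if a = 1 ∧ b = 1 then nOf l g + kOf l g
  else if a = 1 ∧ b = l + 1 then 0
  else kOf l g

open scoped Classical in
/-- The tableau `s(γ)`; the vector `e_{r^{n,k}, s(γ)}` of `L²(S_q^{2ℓ+1})` is denoted by `ξ_γ`. -/
def sTab (l : ℕ) (g : Idx l × NIdx l) (a b : ℕ) : ℤ :=
  if ¬ InTri l a b then 0
  else if a = l + 1 then ∑ i ∈ Finset.Icc 1 l, coord l g i + max (-coord l g (l + 1)) 0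
  else if b = 1 then ∑ i ∈ Finset.Icc 1 (2 * l + 2 - a), |coord l g i|
  else if b = l + 2 - a then ∑ i ∈ Finset.Icc 1 (a - 1), coord l g i
  else kOf l g

/-- `η(γ) = ∑_{i ≤ ℓ} (i - 1) γ_i + ℓ (γ_{ℓ+1})₊`. -/
def eta (l : ℕ) (g : Idx l × NIdx l) : ℤ :=
  ∑ i ∈ Finset.Icc 1 l, ((i : ℤ) - 1) * coord l g i + l * max (coord l g (l + 1)) 0

open scoped Classical in
/-- The matrix entry `⟨ξ_{g'}, π(u_{1j}) ξ_g⟩` of the left multiplication by the generator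
`u_{1j}` of `C(SU_q(ℓ+1))`. -/
def leftMul (l : ℕ) (q : ℝ) (j : ℕ) (g' g : Idx l × NIdx l) : ℝ :=
  ∑ m ∈ moves l j,
    if (∀ a b, InTri l a b → rTab l g' a b = moved l 1 (moveAt m) (rTab l g) a b) ∧
        (∀ a b, InTri l a b → sTab l g' a b = moved l j (moveAt m) (sTab l g) a b) then
      cg l q 1 (rTab l g) (moveAt m) * cg l q j (sTab l g) (moveAt m) *
        kappa l q (rTab l g) (rTab l g')
    else 0

/-- `Z` is the operator `U Z_{j,q} U*` on `ℓ²(ℕ^ℓ × ℤ × ℕ^ℓ)`, where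
`Z_{j,q} = q^{-j+1} π(u_{1j})*` and `U` is the unitary map `(-1)^{η(γ)} ξ_γ ↦ e_γ`. -/
def IsZ (l : ℕ) (q : ℝ) (j : ℕ) (Z : Op (Idx l × NIdx l)) : Prop :=
  ∀ g g' : Idx l × NIdx l, (ContinuousLinearMap.adjoint Z (e g)) g' =
    (((-1 : ℝ) ^ (eta l g + eta l g') * q ^ (1 - (j : ℤ)) * leftMul l q j g' g : ℝ) : ℂ)

/-- `C_ℓ = π(C(S_q^{2ℓ+1}))`, the unital `C*`-algebra generated by `Z_{1,q}, …, Z_{ℓ+1,q}`. -/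
def sphereAlg (l : ℕ) (q : ℝ) : StarSubalgebra ℂ (Op (Idx l × NIdx l)) :=
  (StarAlgebra.adjoin ℂ
    {Z | ∃ j ∈ Finset.Icc 1 (l + 1), IsZ l q j Z}).topologicalClosure

/-- The smooth function algebra `C^∞(S_q^{2ℓ+1})`. -/
def smoothSphere (l : ℕ) (q : ℝ) : Set (Op (Idx l × NIdx l)) :=
  {a | a ∈ (scrB l).carrier ∧ a ∈ sphereAlg l q ∧ theta l a ∈ diag l '' (smoothA l).carrier}

/-! ### Holomorphic functional calculus -/

/-- `Γ` is a cycle in `U \ K`, made of finitely many closed Lipschitz curves parametrized by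
`[0, 1]`, whose winding number is `1` around the points of `K` and `0` around the points outside
`U`. -/
def IsCycleAround (K U : Set ℂ) {n : ℕ} (Γ : Fin n → ℝ → ℂ) : Prop :=
  (∀ i, ∃ C, LipschitzOnWith C (Γ i) (Set.Icc 0 1)) ∧
  (∀ i, Γ i 0 = Γ i 1) ∧
  (∀ i, ∀ t ∈ Set.Icc (0 : ℝ) 1, Γ i t ∈ U \ K) ∧
  (∀ w ∈ K, (2 * Real.pi * Complex.I)⁻¹ *
    ∑ i, ∫ t in (0 : ℝ)..1, deriv (Γ i) t * (Γ i t - w)⁻¹ = 1) ∧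
  (∀ w ∉ U, (2 * Real.pi * Complex.I)⁻¹ *
    ∑ i, ∫ t in (0 : ℝ)..1, deriv (Γ i) t * (Γ i t - w)⁻¹ = 0)

/-- `b = f(a) = (2πi)⁻¹ ∫_Γ f(z) (z - a)⁻¹ dz` for a cycle `Γ` around the spectrum of `a` in an
open set `U` on which `f` is holomorphic. -/
def IsHolomorphicValue {A : Type*} [NormedRing A] [NormedAlgebra ℂ A] [CompleteSpace A]
    (a : A) (f : ℂ → ℂ) (b : A) : Prop :=
  ∃ U : Set ℂ, IsOpen U ∧ spectrum ℂ a ⊆ U ∧ DifferentiableOn ℂ f U ∧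
    ∃ (n : ℕ) (Γ : Fin n → ℝ → ℂ), IsCycleAround (spectrum ℂ a) U Γ ∧
      b = (2 * Real.pi * Complex.I : ℂ)⁻¹ •
        ∑ i, ∫ t in (0 : ℝ)..1, (deriv (Γ i) t * f (Γ i t)) • resolvent a (Γ i t)

/-- A subset of a Banach algebra is closed under holomorphic functional calculus if it contains
`f(a)` for every member `a` and every `f` holomorphic in a neighbourhood of the spectrum of `a`. -/
def ClosedUnderHFC {A : Type*} [NormedRing A] [NormedAlgebra ℂ A] [CompleteSpace A]
    (s : Set A) : Prop :=
  ∀ a ∈ s, ∀ (f : ℂ → ℂ) (b : A), IsHolomorphicValue a f b → b ∈ s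

instance sphereAlg.completeSpace (l : ℕ) (q : ℝ) : CompleteSpace (sphereAlg l q) :=
  (StarSubalgebra.isClosed_topologicalClosure _).completeSpace_coe

end QSphere

end

/-! For `ℓ ≥ 1` the condition `θ(x) ∈ ι(𝒜_ℓ^∞)` says that `x = a ⊗ 1 + R` with `a ∈ 𝒜_ℓ^∞` and `R ∈
𝒥`. The algebra `C_ℓ` enters only as a norm-closed unital `*`-subalgebra of the bounded operators,
so everything rests on the operators `a ⊗ 1 + R`. They are characterised by estimates for their
matrix entries `t(x, y)` (`good_iff`), chosen so that they survive sums, products, adjoints and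
inverses.

The estimates (`Frame.Good`) are of four kinds, all with arbitrary powers of the weights. The
entries decay in the `ℓ¹` distance of `x` and `y`. Entries that change the `i`-th coordinate decay
also in a weight `v i`: the sum of the preceding coordinates for a direction of `ℕ^ℓ × ℤ`, and
`|D_ℓ|` for a direction of the second `ℕ^ℓ`. Diagonal differences `t(x + e_i, y + e_i) - t(x, y)` in
the `ℕ`-directions gain decay in `v i` and in the `i`-th coordinate; in the second `ℕ^ℓ` this
includes the mixed differences. Finally, the difference of `t` and its translate by `N` along `ℤ`
decays, uniformly in `N`, in the last coordinate (the smaller of its two absolute values) and in the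
preceding ones. The Toeplitz form is the source of these weights: at each level the scalar Toeplitz
part is invariant under diagonal shifts and acts as the identity on the later coordinates, while the
compact part decays in its own coordinate.

Conversely, the translates of a good kernel along `ℤ` converge. The limit is invariant, and its
difference from `t` decays in `|D_ℓ|`. Since an invariant kernel that decays in `|D_ℓ|` vanishes,
the limit must have the form `a ⊗ 1`. Telescoping sums in the `ℕ`-directions then peel off the
compact parts one coordinate at a time, which reconstructs `a` and `R` as members of their Fréchet
spaces (`AFamily.reconstruct`, `toeplitzPow_reconstruct`, `smoothJ_reconstruct`).

Stability under inverses comes from `[D, F⁻¹] = -F⁻¹ [D, F] F⁻¹`, used with truncated coordinates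
for the distance and with spectral projections of the coordinates for the changes of coordinates.
For diagonal differences there is a twisted version: compression by a unilateral shift is
multiplicative only up to a defect. The defect involves only entries joining a positive value of the
`i`-th coordinate to the value zero, so it has the decay required of a difference (`Dec.cut`). All
of this is uniform over families of operators. Hence the resolvents along a contour satisfy uniform
estimates, and these pass to the contour integral `f(a)` (`Good.holomorphic`).

For closedness, the entries of `R` tend to zero along half-lines of `ℤ`, so the four components of
`θ` are limits of entries along four half-lines. Equality of these limits is a norm-closed
condition, and the topology of `ℬ` is finer than that of the norm. -/

noncomputable section

namespace QSphere

/-! ### Kernels of operators -/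

/-- Functions of two variables on `X`, as infinite matrices. -/
abbrev Ker (X : Type) : Type := X → X → ℂ

/-- The matrix entries of an operator. -/
def ker {X : Type} (T : Op X) : Ker X := fun x y => T (e y) x

/-- A matrix entry as a continuous linear functional. -/
def kerL {X : Type} (x y : X) : Op X →L[ℂ] ℂ :=
  (innerSL ℂ (e x : L2 X)) ∘L ContinuousLinearMap.apply ℂ (L2 X) (e y : L2 X)

theorem kerL_apply {X : Type} (x y : X) (T : Op X) : kerL x y T = ker T x y := by
  simp [kerL, ker, inner_e_left]

theorem ker_add {X : Type} (T U : Op X) (x y : X) : ker (T + U) x y = ker T x y + ker U x y := rfl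

theorem ker_sub {X : Type} (T U : Op X) (x y : X) : ker (T - U) x y = ker T x y - ker U x y := rfl

theorem ker_smul {X : Type} (c : ℂ) (T : Op X) (x y : X) : ker (c • T) x y = c * ker T x y := rfl

theorem ker_zero {X : Type} (x y : X) : ker (0 : Op X) x y = 0 := rfl

open scoped Classical in
theorem ker_one {X : Type} (x y : X) : ker (1 : Op X) x y = if x = y then 1 else 0 := by
  simp [ker, e_apply]

theorem norm_e {X : Type} (x : X) : ‖(e x : L2 X)‖ = 1 := (orthonormal_e X).1 x

theorem norm_ker_le {X : Type} (T : Op X) (x y : X) : ‖ker T x y‖ ≤ ‖T‖ := by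
  rw [ker, ← inner_e_left]
  refine (norm_inner_le_norm _ _).trans ?_
  rw [norm_e, one_mul]
  exact (T.le_opNorm _).trans (by rw [norm_e, mul_one])

theorem enorm_ker_le {X : Type} (T : Op X) (x y : X) : ‖ker T x y‖ₑ ≤ ‖T‖ₑ :=
  enorm_le_iff_norm_le.2 (norm_ker_le T x y)

theorem hasSum_ker {X ι : Type} {f : ι → Op X} {T : Op X} (h : HasSum f T) (x y : X) :
    HasSum (fun i => ker (f i) x y) (ker T x y) := by
  simpa only [kerL_apply] using h.mapL (kerL x y)

theorem hasSum_e {X : Type} (v : L2 X) : HasSum (fun x => v x • (e x : L2 X)) v := by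
  classical
  have h := lp.hasSum_single (p := 2) (by norm_num) v
  convert h using 2 with x
  ext y
  by_cases hy : y = x
  · subst hy; simp [e_apply]
  · simp [e_apply, hy]

theorem apply_hasSum {X : Type} (T : Op X) (v : L2 X) (x : X) :
    HasSum (fun y => ker T x y * v y) (T v x) := by
  have h := ((hasSum_e v).mapL T).mapL (innerSL ℂ (e x : L2 X))
  simpa [inner_e_left, ker, mul_comm] using h

theorem ker_mul_hasSum {X : Type} (T U : Op X) (x z : X) :
    HasSum (fun y => ker T x y * ker U y z) (ker (T * U) x z) :=
  apply_hasSum T (U (e z)) x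

theorem ker_ext {X : Type} {T U : Op X} (h : ∀ x y, ker T x y = ker U x y) : T = U := by
  ext v x
  refine (apply_hasSum T v x).unique ?_
  simpa only [h] using apply_hasSum U v x

theorem ker_adjoint {X : Type} (T : Op X) (x y : X) :
    ker (ContinuousLinearMap.adjoint T) x y = starRingEnd ℂ (ker T y x) := by
  rw [ker, ← inner_e_left, ContinuousLinearMap.adjoint_inner_right, ← inner_conj_symm, inner_e_left]
  rfl

/-! ### Injections of the index set -/

theorem norm_push_le {X Y : Type} (f : X → Y) (hf : Function.Injective f) : ‖push f hf‖ ≤ 1 :=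
  LinearIsometry.norm_toContinuousLinearMap_le _

theorem adjoint_push_apply {X Y : Type} (f : X → Y) (hf : Function.Injective f) (v : L2 Y) (x : X) :
    ContinuousLinearMap.adjoint (push f hf) v x = v (f x) := by
  rw [← inner_e_left, ContinuousLinearMap.adjoint_inner_right, push_e, inner_e_left]

theorem ker_mul_push {X : Type} (T : Op X) (f : X → X) (hf : Function.Injective f) (x y : X) :
    ker (T * push f hf) x y = ker T x (f y) := by
  change T (push f hf (e y)) x = _
  rw [push_e]; rfl

theorem ker_adjoint_push_mul {X : Type} (T : Op X) (f : X → X) (hf : Function.Injective f)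
    (x y : X) : ker (ContinuousLinearMap.adjoint (push f hf) * T) x y = ker T (f x) y :=
  adjoint_push_apply f hf _ x

theorem adjoint_push_mul_push {X : Type} (f : X → X) (hf : Function.Injective f) :
    ContinuousLinearMap.adjoint (push f hf) * push f hf = 1 := by
  classical
  refine ker_ext fun x y => ?_
  rw [ker_mul_push, ← mul_one (ContinuousLinearMap.adjoint (push f hf)), ker_adjoint_push_mul,
    ker_one, ker_one]
  simp [hf.eq_iff]

/-- `V T V*` for the co-isometry `V = f^*` adjoint to an injection `f` of the index set. -/
def pull {X : Type} (f : X → X) (hf : Function.Injective f) (T : Op X) : Op X :=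
  ContinuousLinearMap.adjoint (push f hf) * T * push f hf

theorem ker_pull {X : Type} (f : X → X) (hf : Function.Injective f) (T : Op X) (x y : X) :
    ker (pull f hf T) x y = ker T (f x) (f y) := by
  rw [pull, ker_mul_push, ker_adjoint_push_mul]

open scoped Classical in
/-- The projection onto the complement of the range of an injection `f` of the index set. -/
def offRange {X : Type} (f : X → X) (hf : Function.Injective f) : Op X :=
  1 - push f hf * ContinuousLinearMap.adjoint (push f hf)

open scoped Classical in
theorem ker_mul_offRange {X : Type} (T : Op X) (f : X → X) (hf : Function.Injective f) (x y : X) :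
    ker (T * offRange f hf) x y = if y ∈ Set.range f then 0 else ker T x y := by
  have h : offRange f hf (e y) = if y ∈ Set.range f then 0 else e y := by
    change e y - push f hf (ContinuousLinearMap.adjoint (push f hf) (e y)) = _
    split_ifs with hy
    · obtain ⟨z, rfl⟩ := hy
      rw [← push_e f hf z]
      change _ - push f hf ((ContinuousLinearMap.adjoint (push f hf) * push f hf) (e z)) = _
      rw [adjoint_push_mul_push]; simp
    · have : ContinuousLinearMap.adjoint (push f hf) (e y) = 0 := by
        ext x
        rw [adjoint_push_apply, e_apply, if_neg (fun h => hy ⟨x, h⟩)]; rfl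
      rw [this]; simp
  change T (offRange f hf (e y)) x = _
  rw [h]
  split_ifs with hy
  · simp
  · rfl

/-- `T U = T V V* U + T (1 - V V*) U` for the isometry `V = push f`. Compression by a shift that is
not surjective fails to be multiplicative, and the second summand is the defect that the Leibniz
rules for differences have to carry. -/
theorem pull_mul {X : Type} (f : X → X) (hf : Function.Injective f) (T U : Op X) :
    pull f hf (T * U) = pull f hf T * pull f hf U +
      (ContinuousLinearMap.adjoint (push f hf) * T * offRange f hf) * (U * push f hf) := by
  simp only [pull, offRange]
  noncomm_ring

/-! ### Multiplication operators -/

/-- Multiplication by a bounded function. -/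
def mulOp {X : Type} (g : X → ℂ) (B : ℝ) (hB : 0 ≤ B) (hg : ∀ x, ‖g x‖ ≤ B) : Op X :=
  have key : ∀ v : L2 X, ∀ x, ‖g x * v x‖ ^ 2 ≤ B ^ 2 * ‖v x‖ ^ 2 := fun v x => by
    rw [norm_mul, mul_pow]
    gcongr
    exact hg x
  LinearMap.mkContinuous
    { toFun := fun v => ⟨fun x => g x * v x, (memℓp_two_iff _).2
        (Summable.of_nonneg_of_le (fun _ => sq_nonneg _) (key v)
          ((summable_sq v).mul_left _))⟩
      map_add' := fun v w => by
        ext x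
        exact mul_add _ _ _
      map_smul' := fun c v => by
        ext x
        exact mul_left_comm _ _ _ }
    B (fun v => by
      refine le_of_sq_le_sq ?_ (by positivity)
      rw [norm_sq_eq, mul_pow, norm_sq_eq, ← tsum_mul_left]
      exact Summable.tsum_le_tsum (key v)
        (Summable.of_nonneg_of_le (fun _ => sq_nonneg _) (key v) ((summable_sq v).mul_left _))
        ((summable_sq v).mul_left _))

theorem mulOp_apply {X : Type} (g : X → ℂ) (B : ℝ) (hB : 0 ≤ B) (hg : ∀ x, ‖g x‖ ≤ B) (v : L2 X)
    (x : X) : mulOp g B hB hg v x = g x * v x := rfl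

theorem ker_mulOp_mul {X : Type} (g : X → ℂ) (B : ℝ) (hB : 0 ≤ B) (hg : ∀ x, ‖g x‖ ≤ B) (T : Op X)
    (x y : X) : ker (mulOp g B hB hg * T) x y = g x * ker T x y := rfl

theorem ker_mul_mulOp {X : Type} (g : X → ℂ) (B : ℝ) (hB : 0 ≤ B) (hg : ∀ x, ‖g x‖ ≤ B) (T : Op X)
    (x y : X) : ker (T * mulOp g B hB hg) x y = ker T x y * g y := by
  classical
  have h : mulOp g B hB hg (e y) = g y • (e y : L2 X) := by
    ext z
    rw [mulOp_apply, lp.coeFn_smul, Pi.smul_apply, e_apply]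
    split_ifs with hz
    · rw [hz]; rfl
    · simp
  change T (mulOp g B hB hg (e y)) x = _
  rw [h, map_smul, mul_comm]; rfl

/-! ### The Schur test -/

theorem lp_enorm_sq {X : Type} (v : L2 X) : ‖v‖ₑ ^ 2 = ∑' x, ‖v x‖ₑ ^ 2 := by
  have h := norm_sq_eq v
  have h2 : ENNReal.ofReal (‖v‖ ^ 2) = ∑' x, ENNReal.ofReal (‖v x‖ ^ 2) := by
    rw [h, ENNReal.ofReal_tsum_of_nonneg (fun _ => sq_nonneg _) (summable_sq v)]
  simpa [ENNReal.ofReal_pow, ofReal_norm] using h2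

theorem ennreal_two_mul_le_add_sq (a b : ℝ≥0∞) : 2 * (a * b) ≤ a ^ 2 + b ^ 2 := by
  by_cases ha : a = ⊤
  · simp [ha]
  by_cases hb : b = ⊤
  · simp [hb]
  lift a to NNReal using ha
  lift b to NNReal using hb
  rw [← mul_assoc]
  exact_mod_cast two_mul_le_add_sq a b

/-- Cauchy–Schwarz for the weights `a`, with infinite values allowed: the square is expanded as a
double sum and `2 b_x b_y ≤ b_x² + b_y²` is applied termwise. -/
theorem ennreal_tsum_mul_sq_le {X : Type} (a b : X → ℝ≥0∞) :
    (∑' x, a x * b x) ^ 2 ≤ (∑' x, a x) * ∑' x, a x * b x ^ 2 := by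
  have h : 2 * (∑' x, a x * b x) ^ 2 ≤ 2 * ((∑' x, a x) * ∑' x, a x * b x ^ 2) := by
    calc 2 * (∑' x, a x * b x) ^ 2 = ∑' x, ∑' y, a x * a y * (2 * (b x * b y)) := by
          rw [sq, ← ENNReal.tsum_mul_right, ← ENNReal.tsum_mul_left]
          refine tsum_congr fun x => ?_
          rw [← ENNReal.tsum_mul_left, ← ENNReal.tsum_mul_left]
          exact tsum_congr fun y => by ring
      _ ≤ ∑' x, ∑' y, (a y * (a x * b x ^ 2) + a x * (a y * b y ^ 2)) := by
          refine ENNReal.tsum_le_tsum fun x => ENNReal.tsum_le_tsum fun y => ?_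
          calc a x * a y * (2 * (b x * b y)) ≤ a x * a y * (b x ^ 2 + b y ^ 2) := by
                gcongr; exact ennreal_two_mul_le_add_sq _ _
            _ = _ := by ring
      _ = _ := by
          simp_rw [ENNReal.tsum_add, ENNReal.tsum_mul_left, ENNReal.tsum_mul_right,
            ENNReal.tsum_mul_left]
          ring
  exact (ENNReal.mul_le_mul_iff_right (by norm_num) (by norm_num)).1 h

/-- The Schur test. -/
theorem enorm_le_of_schur {X : Type} (T : Op X) (C : ℝ≥0∞) (h1 : ∀ x, ∑' y, ‖ker T x y‖ₑ ≤ C)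
    (h2 : ∀ y, ∑' x, ‖ker T x y‖ₑ ≤ C) : ‖T‖ₑ ≤ C := by
  by_cases hC : C = ⊤
  · simp [hC]
  lift C to NNReal using hC
  rw [enorm_le_coe, ← NNReal.coe_le_coe, coe_nnnorm]
  refine ContinuousLinearMap.opNorm_le_bound _ C.2 fun v => ?_
  have key : ‖T v‖ₑ ^ 2 ≤ ((C : ℝ≥0∞) * ‖v‖ₑ) ^ 2 := by
    rw [lp_enorm_sq, mul_pow, lp_enorm_sq]
    calc ∑' x, ‖T v x‖ₑ ^ 2 ≤ ∑' x, C * ∑' y, ‖ker T x y‖ₑ * ‖v y‖ₑ ^ 2 := by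
          refine ENNReal.tsum_le_tsum fun x => ?_
          have h3 : ‖T v x‖ₑ ≤ ∑' y, ‖ker T x y‖ₑ * ‖v y‖ₑ := by
            rw [← (apply_hasSum T v x).tsum_eq]
            refine enorm_tsum_le_tsum_enorm.trans (le_of_eq ?_)
            simp [enorm_mul]
          calc ‖T v x‖ₑ ^ 2 ≤ (∑' y, ‖ker T x y‖ₑ * ‖v y‖ₑ) ^ 2 := by gcongr
            _ ≤ _ := ennreal_tsum_mul_sq_le _ _
            _ ≤ _ := by gcongr; exact h1 x
      _ = C * ∑' y, (∑' x, ‖ker T x y‖ₑ) * ‖v y‖ₑ ^ 2 := by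
          rw [ENNReal.tsum_mul_left, ENNReal.tsum_comm]
          simp_rw [ENNReal.tsum_mul_right]
      _ ≤ C * ∑' y, C * ‖v y‖ₑ ^ 2 := by
          gcongr with y; exact h2 y
      _ = _ := by rw [ENNReal.tsum_mul_left, ← mul_assoc, sq]
  have h4 : ‖T v‖ₑ ≤ (C : ℝ≥0∞) * ‖v‖ₑ := by
    by_contra! hlt
    exact absurd key (not_le.2 (by gcongr))
  rw [enorm_eq_nnnorm, enorm_eq_nnnorm] at h4
  exact_mod_cast h4

end QSphere

end

noncomputable section

namespace QSphere

/-! ### Rapid decay -/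

/-- `1 + n`, as an extended real. -/
def wt (n : ℕ) : ℝ≥0∞ := 1 + (n : ℝ≥0∞)

theorem wt_eq (n : ℕ) : wt n = ((n + 1 : ℕ) : ℝ≥0∞) := by
  simp [wt, add_comm]

theorem one_le_wt (n : ℕ) : 1 ≤ wt n := le_self_add

theorem wt_ne_zero (n : ℕ) : wt n ≠ 0 := (one_pos.trans_le (one_le_wt n)).ne'

theorem wt_ne_top (n : ℕ) : wt n ≠ ⊤ := by rw [wt_eq]; exact ENNReal.natCast_ne_top _

theorem wt_pow_ne_zero (n m : ℕ) : wt n ^ m ≠ 0 := pow_ne_zero _ (wt_ne_zero n)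

theorem wt_pow_ne_top (n m : ℕ) : wt n ^ m ≠ ⊤ := ENNReal.pow_ne_top (wt_ne_top n)

theorem wt_le_mul {a b A : ℕ} (h : a ≤ A * (1 + b)) : wt a ≤ wt A * wt b := by
  rw [wt_eq, wt_eq, wt_eq]
  norm_cast
  nlinarith

theorem wt_mono {a b : ℕ} (h : a ≤ b) : wt a ≤ wt b := by
  unfold wt; gcongr

theorem wt_add_le (a b : ℕ) : wt (a + b) ≤ wt a * wt b := by
  rw [wt_eq, wt_eq, wt_eq]
  norm_cast
  nlinarith

theorem le_inv_wt_mul {n m : ℕ} {f C : ℝ≥0∞} (h : wt n ^ m * f ≤ C) : f ≤ (wt n ^ m)⁻¹ * C := by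
  calc f = (wt n ^ m)⁻¹ * (wt n ^ m * f) := by
        rw [← mul_assoc, ENNReal.inv_mul_cancel (wt_pow_ne_zero _ _) (wt_pow_ne_top _ _), one_mul]
    _ ≤ _ := by gcongr

/-- `f` decays faster than all the powers of `1 + ρ`. -/
def Rapid {P : Type} (ρ : P → ℕ) (f : P → ℝ≥0∞) : Prop :=
  ∀ m : ℕ, ∃ C : NNReal, ∀ p, wt (ρ p) ^ m * f p ≤ C

namespace Rapid

variable {P P' I : Type} {ρ ρ₁ ρ₂ : P → ℕ} {f g : P → ℝ≥0∞}

/-- The comparison principle behind most decay estimates: values are compared along a map `φ`,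
weights up to an affine bound. Nothing is asked where `f'` vanishes, so information about the
support may be used to compare the weights. -/
theorem of_le_mul (h : Rapid ρ f) {ρ' : P' → ℕ} {f' : P' → ℝ≥0∞} (φ : P' → P) (A : ℕ) (B : NNReal)
    (hle : ∀ p, f' p ≠ 0 → f' p ≤ B * f (φ p) ∧ ρ' p ≤ A * (1 + ρ (φ p))) : Rapid ρ' f' := by
  intro m
  obtain ⟨C, hC⟩ := h m
  refine ⟨((A + 1 : ℕ) : NNReal) ^ m * (B * C), fun p => ?_⟩
  by_cases h0 : f' p = 0
  · simp [h0]
  obtain ⟨h1, h2⟩ := hle p h0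
  calc wt (ρ' p) ^ m * f' p ≤ (wt A * wt (ρ (φ p))) ^ m * (B * f (φ p)) := by
        gcongr; exact wt_le_mul h2
    _ = wt A ^ m * (B * (wt (ρ (φ p)) ^ m * f (φ p))) := by ring
    _ ≤ wt A ^ m * (B * C) := by gcongr; exact hC _
    _ = _ := by rw [wt_eq]; push_cast; rfl

theorem of_le (h : Rapid ρ f) {ρ' : P' → ℕ} {f' : P' → ℝ≥0∞} (φ : P' → P) (A : ℕ)
    (hle : ∀ p, f' p ≠ 0 → f' p ≤ f (φ p) ∧ ρ' p ≤ A * (1 + ρ (φ p))) : Rapid ρ' f' :=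
  h.of_le_mul φ A 1 (by simpa using hle)

theorem mono (h : Rapid ρ f) (hle : ∀ p, g p ≤ f p) : Rapid ρ g :=
  h.of_le id 1 fun p _ => ⟨hle p, by simp⟩

theorem weight (h : Rapid ρ f) (A : ℕ) (hle : ∀ p, ρ₁ p ≤ A * (1 + ρ p)) : Rapid ρ₁ f :=
  h.of_le id A fun p _ => ⟨le_rfl, hle p⟩

theorem zero : Rapid ρ (fun _ => 0) := fun _ => ⟨0, by simp⟩

theorem add (hf : Rapid ρ f) (hg : Rapid ρ g) : Rapid ρ (fun p => f p + g p) := by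
  intro m
  obtain ⟨C, hC⟩ := hf m
  obtain ⟨D, hD⟩ := hg m
  refine ⟨C + D, fun p => ?_⟩
  rw [mul_add]
  push_cast
  exact add_le_add (hC p) (hD p)

theorem sup (h₁ : Rapid ρ₁ f) (h₂ : Rapid ρ₂ f) : Rapid (fun p => max (ρ₁ p) (ρ₂ p)) f := by
  intro m
  obtain ⟨C, hC⟩ := h₁ m
  obtain ⟨D, hD⟩ := h₂ m
  refine ⟨max C D, fun p => ?_⟩
  rcases le_total (ρ₁ p) (ρ₂ p) with h | h
  · simp only [max_eq_right h]
    exact (hD p).trans (by exact_mod_cast le_max_right C D)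
  · simp only [max_eq_left h]
    exact (hC p).trans (by exact_mod_cast le_max_left C D)

theorem mul (hf : Rapid ρ₁ f) (hg : Rapid ρ₂ g) :
    Rapid (fun p => ρ₁ p + ρ₂ p) (fun p => f p * g p) := by
  intro m
  obtain ⟨C, hC⟩ := hf m
  obtain ⟨D, hD⟩ := hg m
  refine ⟨C * D, fun p => ?_⟩
  calc wt (ρ₁ p + ρ₂ p) ^ m * (f p * g p) ≤ (wt (ρ₁ p) * wt (ρ₂ p)) ^ m * (f p * g p) := by
        gcongr; exact wt_add_le _ _
    _ = (wt (ρ₁ p) ^ m * f p) * (wt (ρ₂ p) ^ m * g p) := by ring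
    _ ≤ _ := by push_cast; exact mul_le_mul' (hC p) (hD p)

/-- `N` of the available powers of the weight pay for the convergence of the sum over `i`; the
remaining ones survive. -/
theorem tsum {ρ' : P × I → ℕ} {f : P × I → ℝ≥0∞} (h : Rapid ρ' f) (A N : ℕ) (B : NNReal)
    (hρ : ∀ p i, ρ p ≤ A * (1 + ρ' (p, i)))
    (hB : ∀ p, ∑' i, (wt (ρ' (p, i)) ^ N)⁻¹ ≤ B) : Rapid ρ (fun p => ∑' i, f (p, i)) := by
  intro m
  obtain ⟨C, hC⟩ := h (N + m)
  refine ⟨((A + 1 : ℕ) : NNReal) ^ m * (B * C), fun p => ?_⟩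
  rw [← ENNReal.tsum_mul_left]
  calc ∑' i, wt (ρ p) ^ m * f (p, i)
      ≤ ∑' i, wt A ^ m * ((wt (ρ' (p, i)) ^ N)⁻¹ * C) := by
        refine ENNReal.tsum_le_tsum fun i => ?_
        calc wt (ρ p) ^ m * f (p, i) ≤ (wt A * wt (ρ' (p, i))) ^ m * f (p, i) := by
              gcongr; exact wt_le_mul (hρ p i)
          _ = wt A ^ m * (wt (ρ' (p, i)) ^ m * f (p, i)) := by ring
          _ ≤ _ := by
              refine mul_le_mul' le_rfl (le_inv_wt_mul ?_)
              rw [← mul_assoc, ← pow_add]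
              exact hC _
    _ = wt A ^ m * ((∑' i, (wt (ρ' (p, i)) ^ N)⁻¹) * C) := by
        rw [ENNReal.tsum_mul_left, ENNReal.tsum_mul_right]
    _ ≤ wt A ^ m * (B * C) := by gcongr; exact hB p
    _ = _ := by rw [wt_eq]; push_cast; rfl

end Rapid

theorem enorm_le_of_hasSum {I : Type} {E : Type} [NormedAddCommGroup E] {f : I → E} {a : E}
    (h : HasSum f a) : ‖a‖ₑ ≤ ∑' i, ‖f i‖ₑ := by
  rw [← h.tsum_eq]; exact enorm_tsum_le_tsum_enorm

/-! ### Summability of powers -/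

theorem tsum_inv_wt_sq_int : ∑' n : ℤ, (wt n.natAbs ^ 2)⁻¹ ≠ ⊤ := by
  have h : Summable fun n : ℕ => (((n + 1 : ℕ) : ℝ) ^ 2)⁻¹ :=
    (summable_nat_add_iff 1).2 (Real.summable_nat_pow_inv.2 one_lt_two)
  have h' : ∑' n : ℕ, (wt n ^ 2)⁻¹ ≠ ⊤ := by
    have h2 := h.tsum_ofReal_ne_top
    convert h2 using 3 with n
    rw [wt_eq, ENNReal.ofReal_inv_of_pos (by positivity), ENNReal.ofReal_pow (by positivity),
      ENNReal.ofReal_natCast]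
  have h3 : ∑' n : ℤ, (wt n.natAbs ^ 2)⁻¹
      = ∑' p : ℕ ⊕ ℕ, (wt (Equiv.intEquivNatSumNat.symm p).natAbs ^ 2)⁻¹ :=
    (Equiv.intEquivNatSumNat.symm.tsum_eq (fun n : ℤ => (wt n.natAbs ^ 2)⁻¹)).symm
  rw [h3, ENNReal.summable.tsum_sum (ENNReal.summable)]
  refine ENNReal.add_ne_top.2 ⟨h', ne_top_of_le_ne_top h' ?_⟩
  refine ENNReal.tsum_le_tsum fun n => ?_
  gcongr
  refine wt_mono ?_
  change n ≤ (Int.negSucc n).natAbs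
  simp

theorem tsum_inv_wt_sq_nat : ∑' n : ℕ, (wt n ^ 2)⁻¹ ≠ ⊤ :=
  ne_top_of_le_ne_top tsum_inv_wt_sq_int
    (ENNReal.tsum_comp_le_tsum_of_injective Nat.cast_injective
      (fun n : ℤ => (wt n.natAbs ^ 2)⁻¹))

theorem tsum_prod_inv_wt_sq (ι : Type) [Fintype ι] :
    ∑' z : ι → ℤ, ∏ i, (wt (z i).natAbs ^ 2)⁻¹ ≠ ⊤ := by
  refine Fintype.induction_empty_option
    (P := fun ι _ => ∑' z : ι → ℤ, ∏ i, (wt (z i).natAbs ^ 2)⁻¹ ≠ ⊤) ?_ ?_ ?_ ι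
  · intro α β _ e ih
    let _ : Fintype α := Fintype.ofEquiv β e.symm
    rw [← (Equiv.arrowCongr e (Equiv.refl ℤ)).tsum_eq]
    convert ih using 3 with z
    rw [← e.prod_comp]
    simp [Equiv.arrowCongr]
  · simp
  · intro α _ ih
    rw [← (Equiv.piOptionEquivProd (β := fun _ : Option α => ℤ)).symm.tsum_eq, ENNReal.tsum_prod']
    simp only [Fintype.prod_option]
    simp only [Equiv.piOptionEquivProd, Equiv.coe_fn_symm_mk]
    simp_rw [ENNReal.tsum_mul_left, ENNReal.tsum_mul_right]
    exact ENNReal.mul_ne_top tsum_inv_wt_sq_int ih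

/-! ### Index sets with integral coordinates -/

/-- A set `X` with coordinates in `ℕ` and `ℤ`: the `i`-th coordinate takes its values in `ℕ`
if `nat i`, and `s i` increases it by one. -/
structure Grid (X ι : Type) [Fintype ι] where
  c : X → ι → ℤ
  s : ι → X → X
  nat : ι → Prop
  c_s_self : ∀ i x, c (s i x) i = c x i + 1
  c_s_of_ne : ∀ i j x, j ≠ i → c (s i x) j = c x j
  c_inj : Function.Injective c
  nonneg : ∀ i x, nat i → 0 ≤ c x i
  range_iff : ∀ i x, x ∈ Set.range (s i) ↔ (nat i → c x i ≠ 0)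
  const : ∀ φ : X → ℂ, (∀ i x, φ (s i x) = φ x) → ∀ x y, φ x = φ y

namespace Grid

variable {X ι : Type} [Fintype ι] (g : Grid X ι)

theorem s_inj (i : ι) : Function.Injective (g.s i) := by
  intro x y h
  apply g.c_inj
  funext j
  by_cases hj : j = i
  · subst hj
    have := g.c_s_self j x
    rw [h, g.c_s_self] at this
    omega
  · rw [← g.c_s_of_ne i j x hj, h, g.c_s_of_ne i j y hj]

theorem s_comm {i j : ι} (h : i ≠ j) (x : X) : g.s i (g.s j x) = g.s j (g.s i x) := by
  apply g.c_inj
  funext k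
  by_cases hi : k = i
  · subst hi
    rw [g.c_s_self, g.c_s_of_ne j k _ h, g.c_s_of_ne j k _ h, g.c_s_self]
  · rw [g.c_s_of_ne i k _ hi]
    by_cases hj : k = j
    · subst hj
      rw [g.c_s_self, g.c_s_self, g.c_s_of_ne i k _ hi]
    · rw [g.c_s_of_ne j k _ hj, g.c_s_of_ne j k _ hj, g.c_s_of_ne i k _ hi]

/-- The `ℓ¹` distance. -/
def d (x y : X) : ℕ := ∑ i, (g.c x i - g.c y i).natAbs

/-- The absolute value of the `i`-th coordinate. -/
def u (i : ι) (x : X) : ℕ := (g.c x i).natAbs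

theorem d_self (x : X) : g.d x x = 0 := by simp [d]

theorem d_comm (x y : X) : g.d x y = g.d y x := by
  unfold d
  exact Finset.sum_congr rfl fun i _ => by omega

theorem d_triangle (x y z : X) : g.d x z ≤ g.d x y + g.d y z := by
  unfold d
  rw [← Finset.sum_add_distrib]
  exact Finset.sum_le_sum fun i _ => by omega

theorem natAbs_le_d (i : ι) (x y : X) : (g.c x i - g.c y i).natAbs ≤ g.d x y :=
  Finset.single_le_sum (f := fun i => (g.c x i - g.c y i).natAbs) (fun _ _ => Nat.zero_le _)
    (Finset.mem_univ i)

theorem u_le (i : ι) (x y : X) : g.u i x ≤ g.u i y + g.d x y := by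
  have := g.natAbs_le_d i x y
  unfold u
  omega

theorem c_sub_s (i j : ι) (x y : X) : g.c (g.s i x) j - g.c (g.s i y) j = g.c x j - g.c y j := by
  by_cases h : j = i
  · subst h; rw [g.c_s_self, g.c_s_self]; ring
  · rw [g.c_s_of_ne i j _ h, g.c_s_of_ne i j _ h]

theorem d_s (i : ι) (x y : X) : g.d (g.s i x) (g.s i y) = g.d x y := by
  unfold d
  exact Finset.sum_congr rfl fun j _ => by rw [g.c_sub_s]

theorem d_s_self (i : ι) (x : X) : g.d x (g.s i x) ≤ 1 := by
  classical
  unfold d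
  calc ∑ j, (g.c x j - g.c (g.s i x) j).natAbs ≤ ∑ j, if j = i then 1 else 0 := by
        refine Finset.sum_le_sum fun j _ => ?_
        split_ifs with h
        · subst h; rw [g.c_s_self]; simp
        · rw [g.c_s_of_ne i j _ h]; simp
    _ = 1 := by simp

/-- The distance dominates each coordinate difference, so `(1 + d(x, y))^{2|ι|}` is at least the
product of the `(1 + |x_i - y_i|)²`, and the sum over `y` is bounded by a product of convergent sums
over `ℤ`, independently of `x`. -/
theorem tsum_wt_d (g : Grid X ι) : ∃ (N : ℕ) (B : NNReal), ∀ x, ∑' y, (wt (g.d x y) ^ N)⁻¹ ≤ B := by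
  refine ⟨2 * Fintype.card ι, (∑' z : ι → ℤ, ∏ i, (wt (z i).natAbs ^ 2)⁻¹).toNNReal, fun x => ?_⟩
  rw [ENNReal.coe_toNNReal (tsum_prod_inv_wt_sq ι)]
  have hinj : Function.Injective fun y : X => fun i => g.c x i - g.c y i := by
    intro y y' h
    apply g.c_inj
    funext i
    have := congrFun h i
    simp only at this
    omega
  refine le_trans ?_ (ENNReal.tsum_comp_le_tsum_of_injective hinj _)
  refine ENNReal.tsum_le_tsum fun y => ?_
  rw [← ENNReal.prod_inv_distrib]
  · gcongr
    rw [pow_mul, ← Finset.card_univ]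
    refine Finset.prod_le_pow_card _ _ _ fun i _ => ?_
    gcongr
    exact wt_mono (g.natAbs_le_d i x y)
  · intro i _ j _ _
    exact Or.inl (wt_pow_ne_zero _ _)

end Grid

end QSphere

end

noncomputable section

namespace QSphere

namespace Grid

variable {X ι : Type} [Fintype ι] (g : Grid X ι) {K : Type}

/-! ### Classes of families of kernels -/

/-- Weight functions that are `1`-Lipschitz. -/
def Lip (w : X → ℕ) : Prop := ∀ x y, w x ≤ w y + g.d x y

theorem lip_const (n : ℕ) : g.Lip fun _ => n := fun _ _ => Nat.le_add_right _ _

theorem lip_zero : g.Lip 0 := fun _ _ => Nat.zero_le _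

theorem lip_u (i : ι) : g.Lip (g.u i) := fun x y => g.u_le i x y

variable {g} in
theorem Lip.sup {w w' : X → ℕ} (h : g.Lip w) (h' : g.Lip w') : g.Lip (w ⊔ w') := by
  intro x y
  have := h x y
  have := h' x y
  simp only [Pi.sup_apply]
  omega

variable {g} in
theorem Lip.inf {w w' : X → ℕ} (h : g.Lip w) (h' : g.Lip w') : g.Lip (w ⊓ w') := by
  intro x y
  have := h x y
  have := h' x y
  simp only [Pi.inf_apply]
  omega

variable {g} in
theorem Lip.s {w : X → ℕ} (h : g.Lip w) (i : ι) (x : X) : w x ≤ w (g.s i x) + 1 := by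
  have := h x (g.s i x)
  have := g.d_s_self i x
  omega

/-- The difference of a kernel in the `i`-th direction. -/
def grad (i : ι) (t : Ker X) : Ker X := fun x y => t (g.s i x) (g.s i y) - t x y

open scoped Classical in
/-- The part of a kernel that changes the `i`-th coordinate. -/
def off (i : ι) (t : Ker X) : Ker X := fun x y => if g.c x i = g.c y i then 0 else t x y

/-- `sup_{x,y} (1 + d(x,y) + w(x))^m |t(x,y)|`. -/
def pn (w : X → ℕ) (m : ℕ) (t : Ker X) : ℝ≥0∞ :=
  ⨆ p : X × X, wt (g.d p.1 p.2 + w p.1) ^ m * ‖t p.1 p.2‖ₑ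

/-- The sum of the norms `pn` of the iterated differences of `t` in the directions of `L`. -/
def qn (v : ι → X → ℕ) : List ι → (X → ℕ) → ℕ → Ker X → ℝ≥0∞
  | [], w, m, t => g.pn w m t
  | i :: L, w, m, t => qn v L w m t + qn v L (w ⊔ (v i ⊔ g.u i)) m (g.grad i t)

/-- Families of kernels with rapid decay away from the diagonal and with respect to `w`. -/
def Dec (w : K → X → ℕ) (t : K → Ker X) : Prop :=
  Rapid (fun p : K × X × X => g.d p.2.1 p.2.2 + w p.1 p.2.1) (fun p => ‖t p.1 p.2.1 p.2.2‖ₑ)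

/-- Families of kernels whose iterated differences decay rapidly. -/
def Cls (v : ι → X → ℕ) (L : List ι) (w : K → X → ℕ) (t : K → Ker X) : Prop :=
  ∀ m, ∃ C : NNReal, ∀ k, g.qn v L (w k) m (t k) ≤ C

variable {g} {v : ι → X → ℕ} {w w₁ w₂ : K → X → ℕ} {t t₁ t₂ : K → Ker X}

theorem cls_nil : g.Cls v [] w t ↔ g.Dec w t := by
  refine forall_congr' fun m => exists_congr fun C => ⟨fun h p => ?_, fun h k => ?_⟩
  · exact (le_iSup (fun q : X × X => wt (g.d q.1 q.2 + w p.1 q.1) ^ m * ‖t p.1 q.1 q.2‖ₑ) p.2).trans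
      (h p.1)
  · exact iSup_le fun q => h (k, q)

/-- The recursion by which statements about `Cls` are proved. A difference in the direction `i` has
to gain the weight `v i ⊔ u i`. -/
theorem cls_cons {i : ι} {L : List ι} : g.Cls v (i :: L) w t ↔
    g.Cls v L w t ∧ g.Cls v L (fun k => w k ⊔ (v i ⊔ g.u i)) (fun k => g.grad i (t k)) := by
  constructor
  · intro h
    refine ⟨fun m => ?_, fun m => ?_⟩ <;> obtain ⟨C, hC⟩ := h m
    · exact ⟨C, fun k => le_self_add.trans (hC k)⟩
    · exact ⟨C, fun k => le_add_self.trans (hC k)⟩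
  · rintro ⟨h, h'⟩ m
    obtain ⟨C, hC⟩ := h m
    obtain ⟨D, hD⟩ := h' m
    refine ⟨C + D, fun k => ?_⟩
    push_cast
    exact add_le_add (hC k) (hD k)

theorem Cls.dec {L : List ι} (h : g.Cls v L w t) : g.Dec w t := by
  induction L with
  | nil => exact cls_nil.1 h
  | cons i L ih => exact ih (cls_cons.1 h).1

theorem Dec.comp {K' : Type} (h : g.Dec w t) (φ : K' → K) :
    g.Dec (fun k => w (φ k)) (fun k => t (φ k)) :=
  Rapid.of_le h (fun p : K' × X × X => (φ p.1, p.2)) 1 fun p _ => ⟨le_rfl, by simp⟩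

theorem Cls.comp {K' : Type} {L : List ι} (h : g.Cls v L w t) (φ : K' → K) :
    g.Cls v L (fun k => w (φ k)) (fun k => t (φ k)) := fun m => by
  obtain ⟨C, hC⟩ := h m
  exact ⟨C, fun k => hC _⟩

theorem Dec.weight (h : g.Dec w t) (A : ℕ) (hA : ∀ k x, w₁ k x ≤ A * (1 + w k x)) : g.Dec w₁ t := by
  refine Rapid.weight h (A + 1) fun p => ?_
  have := hA p.1 p.2.1
  nlinarith

theorem Dec.sup (h : g.Dec w t) (h₁ : g.Dec w₁ t) : g.Dec (fun k => w k ⊔ w₁ k) t := by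
  refine (Rapid.sup h h₁).weight 1 fun p => ?_
  simp only [Pi.sup_apply]
  omega

theorem Cls.weight {v₁ : ι → X → ℕ} {L : List ι} (h : g.Cls v L w t) (A : ℕ)
    (hA : ∀ k x, w₁ k x ≤ A * (1 + w k x))
    (hv : ∀ i ∈ L, ∀ k x, v₁ i x ≤ A * (1 + max (w k x) (v i x))) : g.Cls v₁ L w₁ t := by
  induction L generalizing w w₁ t A with
  | nil => exact cls_nil.2 ((cls_nil.1 h).weight A hA)
  | cons i L ih =>
    rw [cls_cons] at h ⊢
    refine ⟨ih h.1 A hA fun j hj => hv j (List.mem_cons_of_mem _ hj),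
      ih h.2 (A + 1) (fun k x => ?_) fun j hj k x => ?_⟩
    · have h1 := hA k x
      have h2 := hv i List.mem_cons_self k x
      simp only [Pi.sup_apply]
      refine max_le ?_ (max_le ?_ ?_)
      · refine h1.trans (Nat.mul_le_mul (by omega) (by omega))
      · refine h2.trans (Nat.mul_le_mul (by omega) (by omega))
      · nlinarith [le_max_right (w k x) (max (v i x) (g.u i x)), le_max_right (v i x) (g.u i x)]
    · refine (hv j (List.mem_cons_of_mem _ hj) k x).trans (Nat.mul_le_mul (by omega) ?_)
      simp only [Pi.sup_apply]
      omega

theorem Dec.add (h₁ : g.Dec w t₁) (h₂ : g.Dec w t₂) : g.Dec w (fun k => t₁ k + t₂ k) :=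
  (Rapid.add h₁ h₂).mono fun _ => enorm_add_le _ _

theorem Dec.mono (h : g.Dec w t) (h' : ∀ k x y, ‖t₁ k x y‖ₑ ≤ ‖t k x y‖ₑ) : g.Dec w t₁ :=
  Rapid.mono h fun p => h' p.1 p.2.1 p.2.2

theorem Dec.neg (h : g.Dec w t) : g.Dec w (fun k => -t k) := h.mono fun _ _ _ => by simp

theorem Dec.sub (h₁ : g.Dec w t₁) (h₂ : g.Dec w t₂) : g.Dec w (fun k => t₁ k - t₂ k) := by
  simpa only [sub_eq_add_neg] using h₁.add h₂.neg

theorem Dec.smul (h : g.Dec w t) {c : K → ℂ} (C : NNReal) (hc : ∀ k, ‖c k‖₊ ≤ C) :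
    g.Dec w (fun k => c k • t k) :=
  Rapid.of_le_mul h id 1 C fun p _ => ⟨by
    simp only [Pi.smul_apply, smul_eq_mul, enorm_mul, id]
    gcongr
    exact enorm_le_coe.2 (hc _), by simp⟩

theorem dec_zero : g.Dec w (fun _ => (0 : Ker X)) := by
  simpa [Dec] using Rapid.zero

theorem grad_add (i : ι) (t t' : Ker X) : g.grad i (t + t') = g.grad i t + g.grad i t' := by
  funext x y; simp only [grad, Pi.add_apply]; ring

theorem grad_sub (i : ι) (t t' : Ker X) : g.grad i (t - t') = g.grad i t - g.grad i t' := by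
  funext x y; simp only [grad, Pi.sub_apply]; ring

theorem grad_smul (i : ι) (c : ℂ) (t : Ker X) : g.grad i (c • t) = c • g.grad i t := by
  funext x y; simp only [grad, Pi.smul_apply, smul_eq_mul]; ring

theorem Cls.add {L : List ι} (h₁ : g.Cls v L w t₁) (h₂ : g.Cls v L w t₂) :
    g.Cls v L w (fun k => t₁ k + t₂ k) := by
  induction L generalizing w t₁ t₂ with
  | nil => exact cls_nil.2 ((cls_nil.1 h₁).add (cls_nil.1 h₂))
  | cons i L ih =>
    rw [cls_cons] at h₁ h₂ ⊢
    simp only [grad_add]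
    exact ⟨ih h₁.1 h₂.1, ih h₁.2 h₂.2⟩

theorem Cls.smul {L : List ι} (h : g.Cls v L w t) {c : K → ℂ} (C : NNReal)
    (hc : ∀ k, ‖c k‖₊ ≤ C) : g.Cls v L w (fun k => c k • t k) := by
  induction L generalizing w t with
  | nil => exact cls_nil.2 ((cls_nil.1 h).smul C hc)
  | cons i L ih =>
    rw [cls_cons] at h ⊢
    simp only [grad_smul]
    exact ⟨ih h.1, ih h.2⟩

theorem Cls.neg {L : List ι} (h : g.Cls v L w t) : g.Cls v L w (fun k => -t k) := by
  simpa using h.smul (c := fun _ => -1) 1 (by simp)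

theorem cls_zero {L : List ι} : g.Cls v L w (fun _ => (0 : Ker X)) := by
  induction L generalizing w with
  | nil => exact cls_nil.2 dec_zero
  | cons i L ih =>
    have : g.grad i (0 : Ker X) = 0 := by funext x y; simp [grad]
    rw [cls_cons, this]
    exact ⟨ih, ih⟩

theorem grad_grad (i j : ι) (t : Ker X) (x y : X) :
    g.grad j (fun x y => t (g.s i x) (g.s i y)) x y = g.grad j t (g.s i x) (g.s i y) := by
  by_cases h : i = j
  · subst h; rfl
  · simp only [grad, g.s_comm h]

theorem Dec.shift (hw : ∀ k, g.Lip (w k)) (i : ι) (h : g.Dec w t) :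
    g.Dec w (fun k x y => t k (g.s i x) (g.s i y)) := by
  refine Rapid.of_le h (fun p => (p.1, g.s i p.2.1, g.s i p.2.2)) 1 fun p _ => ⟨le_rfl, ?_⟩
  have := (hw p.1).s i p.2.1
  simp only [g.d_s]
  omega

theorem Cls.shift (hv : ∀ i, g.Lip (v i)) {L : List ι} (hw : ∀ k, g.Lip (w k)) (i : ι)
    (h : g.Cls v L w t) : g.Cls v L w (fun k x y => t k (g.s i x) (g.s i y)) := by
  induction L generalizing w t with
  | nil => exact cls_nil.2 ((cls_nil.1 h).shift hw i)
  | cons j L ih =>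
    rw [cls_cons] at h ⊢
    refine ⟨ih hw h.1, ?_⟩
    convert ih (fun k => (hw k).sup ((hv j).sup (g.lip_u j))) h.2 using 1
    funext k x y
    exact grad_grad i j (t k) x y

/-- Serves the factor `U V` of the defect in `pull_mul`, where only the column is shifted; this
changes the distance by at most one. -/
theorem Cls.shift_right (hv : ∀ i, g.Lip (v i)) {L : List ι} (hw : ∀ k, g.Lip (w k)) {i : ι}
    (hi : i ∉ L) (h : g.Cls v L w t) : g.Cls v L w (fun k x y => t k x (g.s i y)) := by
  induction L generalizing w t with
  | nil =>
    refine cls_nil.2 (Rapid.of_le (cls_nil.1 h) (fun p => (p.1, p.2.1, g.s i p.2.2)) 1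
      fun p _ => ⟨le_rfl, ?_⟩)
    have := g.d_triangle p.2.1 (g.s i p.2.2) p.2.2
    have := g.d_s_self i p.2.2
    rw [g.d_comm] at this
    simp only
    omega
  | cons j L ih =>
    rw [cls_cons] at h ⊢
    rw [List.mem_cons, not_or] at hi
    refine ⟨ih hw hi.2 h.1, ?_⟩
    convert ih (fun k => (hw k).sup ((hv j).sup (g.lip_u j))) hi.2 h.2 using 1
    funext k x y
    simp only [grad, g.s_comm hi.1]

open scoped Classical in
/-- The kernel of `S_i T p_i`, where `p_i` is the projection onto the complement of the range of
`S_i^*`. -/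
def cut (g : Grid X ι) (i : ι) (t : Ker X) : Ker X :=
  fun x y => if y ∈ Set.range (g.s i) then 0 else t (g.s i x) y

theorem c_cut {i : ι} {y : X} (hy : y ∉ Set.range (g.s i)) : g.nat i ∧ g.c y i = 0 := by
  rw [g.range_iff] at hy
  push Not at hy
  exact hy

theorem mem_range_s (g : Grid X ι) {i j : ι} (h : i ≠ j) (y : X) :
    g.s j y ∈ Set.range (g.s i) ↔ y ∈ Set.range (g.s i) := by
  rw [g.range_iff, g.range_iff, g.c_s_of_ne j i y h]

/-- The reason why the defect of `pull_mul` is harmless. A column `y` outside the range of the shift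
has `i`-th coordinate `0`, while that of the shifted row is positive. So the entry changes the
`i`-th coordinate and decays in `v i`; moreover `d(x, y)` is at least the `i`-th coordinate of `x`,
which gives the decay in `u i`. -/
theorem Dec.cut (hw : ∀ k, g.Lip (w k)) (hv : g.Lip (v i)) (h : g.Dec w t)
    (ho : g.Dec (fun _ => v i) (fun k => g.off i (t k))) :
    g.Dec (fun k => w k ⊔ (v i ⊔ g.u i)) (fun k => g.cut i (t k)) := by
  classical
  refine Dec.sup ?_ (Dec.sup ?_ ?_)
  · refine Rapid.of_le h (fun p => (p.1, g.s i p.2.1, p.2.2)) 2 fun p _ => ⟨?_, ?_⟩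
    · simp only [Grid.cut]; split_ifs <;> simp
    · have := (hw p.1).s i p.2.1
      have := g.d_triangle p.2.1 (g.s i p.2.1) p.2.2
      have := g.d_s_self i p.2.1
      simp only
      omega
  · refine Rapid.of_le ho (fun p => (p.1, g.s i p.2.1, p.2.2)) 2 fun p hp => ⟨?_, ?_⟩
    · by_cases h1 : p.2.2 ∈ Set.range (g.s i)
      · simp [Grid.cut, h1]
      · obtain ⟨h3, h4⟩ := c_cut h1
        have h2 : g.c (g.s i p.2.1) i ≠ g.c p.2.2 i := by
          rw [g.c_s_self, h4]
          have := g.nonneg i p.2.1 h3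
          omega
        simp only [Grid.cut, off, if_neg h1, if_neg h2, le_refl]
    · have := hv.s i p.2.1
      have := g.d_triangle p.2.1 (g.s i p.2.1) p.2.2
      have := g.d_s_self i p.2.1
      simp only
      omega
  · refine Rapid.of_le h (fun p => (p.1, g.s i p.2.1, p.2.2)) 2 fun p hp => ⟨?_, ?_⟩
    · simp only [Grid.cut]; split_ifs <;> simp
    · have h1 : p.2.2 ∉ Set.range (g.s i) := by
        intro h1
        simp [Grid.cut, h1] at hp
      have h4 := (c_cut h1).2
      have := g.d_triangle p.2.1 (g.s i p.2.1) p.2.2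
      have h5 := g.d_s_self i p.2.1
      have h6 := g.natAbs_le_d i p.2.1 p.2.2
      rw [h4] at h6
      simp only [Grid.u]
      omega

theorem off_off_le (i : ι) (t : Ker X) (x y : X) : ‖g.off i t x y‖ₑ ≤ ‖t x y‖ₑ := by
  unfold off; split_ifs <;> simp

theorem off_grad (i j : ι) (t : Ker X) (x y : X) :
    g.off i (g.grad j t) x y = g.grad j (g.off i t) x y := by
  have h := g.c_sub_s j i x y
  have : g.c (g.s j x) i = g.c (g.s j y) i ↔ g.c x i = g.c y i := by omega
  simp only [off, grad, this]
  split_ifs <;> simp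

theorem Dec.off_grad (hw : ∀ k, g.Lip (w k)) {i : ι} (j : ι)
    (ho : g.Dec w (fun k => g.off i (t k))) : g.Dec w (fun k => g.off i (g.grad j (t k))) := by
  refine ((ho.shift hw j).sub ho).mono fun k x y => ?_
  rw [Grid.off_grad]
  rfl

/-- Differences in directions other than `i` commute with `cut i` and preserve the decay of the
entries that change the `i`-th coordinate, so `Dec.cut` applies after each of them. -/
theorem Cls.cut (hv : ∀ i, g.Lip (v i)) {L : List ι} (hw : ∀ k, g.Lip (w k)) {i : ι}
    (hi : i ∉ L) (h : g.Cls v L w t) (ho : g.Dec (fun _ => v i) (fun k => g.off i (t k))) :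
    g.Cls v L (fun k => w k ⊔ (v i ⊔ g.u i)) (fun k => g.cut i (t k)) := by
  induction L generalizing w t with
  | nil => exact cls_nil.2 ((cls_nil.1 h).cut hw (hv i) ho)
  | cons j L ih =>
    rw [cls_cons] at h ⊢
    rw [List.mem_cons, not_or] at hi
    refine ⟨ih hw hi.2 h.1 ho, ?_⟩
    have := ih (fun k => (hw k).sup ((hv j).sup (g.lip_u j))) hi.2 h.2
      (Dec.off_grad (fun _ => hv i) j ho)
    convert this using 1
    · funext k
      exact sup_right_comm _ _ _
    · funext k x y
      have hm := g.mem_range_s hi.1 y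
      by_cases hy : y ∈ Set.range (g.s i)
      · have hy' := hm.2 hy
        simp only [Grid.cut, grad, if_pos hy, if_pos hy', sub_zero]
      · have hy' := mt hm.1 hy
        simp only [Grid.cut, grad, if_neg hy, if_neg hy', g.s_comm hi.1]

theorem Dec.off_cut {i j : ι} (hij : j ≠ i) (hw : ∀ k, g.Lip (w k))
    (ho : g.Dec w (fun k => g.off j (t k))) : g.Dec w (fun k => g.off j (g.cut i (t k))) := by
  refine Rapid.of_le ho (fun p => (p.1, g.s i p.2.1, p.2.2)) 2 fun p _ => ⟨?_, ?_⟩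
  · simp only [off, Grid.cut, g.c_s_of_ne i j _ hij]
    split_ifs <;> simp
  · have := (hw p.1).s i p.2.1
    have := g.d_triangle p.2.1 (g.s i p.2.1) p.2.2
    have := g.d_s_self i p.2.1
    simp only
    omega

theorem Cls.conj (hv : ∀ i, g.Lip (v i)) {L : List ι} (hw : ∀ k, g.Lip (w k))
    (h : g.Cls v L w t) : g.Cls v L w (fun k x y => starRingEnd ℂ (t k y x)) := by
  induction L generalizing w t with
  | nil =>
    refine cls_nil.2 (Rapid.of_le (cls_nil.1 h) (fun p => (p.1, p.2.2, p.2.1)) 2 fun p _ => ⟨?_, ?_⟩)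
    · simp
    · have := hw p.1 p.2.1 p.2.2
      have := g.d_comm p.2.1 p.2.2
      simp only
      omega
  | cons j L ih =>
    rw [cls_cons] at h ⊢
    refine ⟨ih hw h.1, ?_⟩
    convert ih (fun k => (hw k).sup ((hv j).sup (g.lip_u j))) h.2 using 1
    funext k x y
    simp [grad]

end Grid

end QSphere

end

noncomputable section

namespace QSphere

namespace Grid

variable {X ι : Type} [Fintype ι] {g : Grid X ι} {K : Type}
variable {v : ι → X → ℕ} {w w₁ w₂ : K → X → ℕ} {F G : K → Op X}

/-! ### Products -/

/-- The weight of `G` is evaluated at the intermediate point `y`; the Lipschitz condition moves it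
to `x` at the cost of `d(x, y)`, which the decay of `F` absorbs. -/
theorem Dec.mul (h₁ : g.Dec w₁ (fun k => ker (F k))) (h₂ : g.Dec w₂ (fun k => ker (G k)))
    (hw : ∀ k, g.Lip (w₂ k)) :
    g.Dec (fun k => w₁ k ⊔ w₂ k) (fun k => ker (F k * G k)) := by
  obtain ⟨N, B, hB⟩ := g.tsum_wt_d
  have h1 : Rapid (fun p : (K × X × X) × X => g.d p.1.2.1 p.2 + w₁ p.1.1 p.1.2.1)
      (fun p => ‖ker (F p.1.1) p.1.2.1 p.2‖ₑ) :=
    Rapid.of_le h₁ (fun p => (p.1.1, p.1.2.1, p.2)) 1 fun p _ => ⟨le_rfl, by simp⟩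
  have h2 : Rapid (fun p : (K × X × X) × X => g.d p.2 p.1.2.2 + w₂ p.1.1 p.2)
      (fun p => ‖ker (G p.1.1) p.2 p.1.2.2‖ₑ) :=
    Rapid.of_le h₂ (fun p => (p.1.1, p.2, p.1.2.2)) 1 fun p _ => ⟨le_rfl, by simp⟩
  refine ((h1.mul h2).tsum (ρ := fun p : K × X × X => g.d p.2.1 p.2.2 + (w₁ p.1 ⊔ w₂ p.1) p.2.1)
    2 N B ?_ ?_).mono fun p => ?_
  · rintro ⟨k, x, z⟩ y
    have := hw k x y
    have := g.d_triangle x y z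
    simp only [Pi.sup_apply]
    omega
  · rintro ⟨k, x, z⟩
    refine le_trans (ENNReal.tsum_le_tsum fun y => ?_) (hB x)
    gcongr
    exact wt_mono (by dsimp only; omega)
  · refine (enorm_le_of_hasSum (ker_mul_hasSum _ _ _ _)).trans (le_of_eq ?_)
    simp [enorm_mul]

theorem ker_gradOp (i : ι) (T : Op X) : ker (pull (g.s i) (g.s_inj i) T - T) = g.grad i (ker T) := by
  funext x y
  rw [ker_sub, ker_pull]; rfl

theorem ker_cutOp (i : ι) (T : Op X) :
    ker (ContinuousLinearMap.adjoint (push (g.s i) (g.s_inj i)) * T * offRange (g.s i) (g.s_inj i))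
      = g.cut i (ker T) := by
  classical
  funext x y
  rw [ker_mul_offRange, ker_adjoint_push_mul, cut]

/-- The twisted Leibniz rule: with the compression `F'` of `F` by the shift `V`, the difference of
`F G` is `(F' - F) G' + F (G' - G)` plus the defect `(V* F (1 - V V*)) (G V)`. Each of the three
products has one factor with the gained weight. Only the left factor is cut, so only `F` needs decay
of the entries that change a coordinate. -/
theorem Cls.mul (hv : ∀ i, g.Lip (v i)) {L : List ι} (hL : L.Nodup) (hw₁ : ∀ k, g.Lip (w₁ k))
    (hw₂ : ∀ k, g.Lip (w₂ k)) (h₁ : g.Cls v L w₁ (fun k => ker (F k)))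
    (h₂ : g.Cls v L w₂ (fun k => ker (G k)))
    (ho : ∀ i ∈ L, g.Dec (fun _ => v i) (fun k => g.off i (ker (F k)))) :
    g.Cls v L (fun k => w₁ k ⊔ w₂ k) (fun k => ker (F k * G k)) := by
  induction L generalizing w₁ w₂ F G with
  | nil => exact cls_nil.2 ((cls_nil.1 h₁).mul (cls_nil.1 h₂) hw₂)
  | cons i L ih =>
    rw [cls_cons] at h₁ h₂ ⊢
    rw [List.nodup_cons] at hL
    have hoL : ∀ j ∈ L, g.Dec (fun _ => v j) (fun k => g.off j (ker (F k))) :=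
      fun j hj => ho j (List.mem_cons_of_mem _ hj)
    have hoi := ho i List.mem_cons_self
    have hvu := (hv i).sup (g.lip_u i)
    refine ⟨ih hL.2 hw₁ hw₂ h₁.1 h₂.1 hoL, ?_⟩
    have e1 := h₁.2
    have e2 := h₂.2
    simp only [← ker_gradOp] at e1 e2
    have t1 := ih (G := fun k => pull (g.s i) (g.s_inj i) (G k)) hL.2
      (fun k => (hw₁ k).sup hvu) hw₂ e1
      (by
        have := h₂.1.shift hv hw₂ i
        convert this using 2 with k
        funext x y
        exact ker_pull _ _ _ _ _)
      (fun j hj => by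
        simp only [ker_gradOp]
        exact Dec.off_grad (fun _ => hv j) i (hoL j hj))
    have t2 := ih hL.2 hw₁ (fun k => (hw₂ k).sup hvu) h₁.1 e2 hoL
    have e3 := h₁.1.cut hv hw₁ hL.1 hoi
    simp only [← ker_cutOp] at e3
    have t3 := ih (G := fun k => G k * push (g.s i) (g.s_inj i)) hL.2
      (fun k => (hw₁ k).sup hvu) hw₂ e3
      (by
        have := h₂.1.shift_right hv hw₂ hL.1
        convert this using 2 with k
        funext x y
        exact ker_mul_push _ _ _ _ _)
      (fun j hj => by
        simp only [ker_cutOp]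
        exact Dec.off_cut (fun h => hL.1 (h ▸ hj)) (fun _ => hv j) (hoL j hj))
    have a1 : ∀ k, w₁ k ⊔ (v i ⊔ g.u i) ⊔ w₂ k = w₁ k ⊔ w₂ k ⊔ (v i ⊔ g.u i) :=
      fun k => sup_right_comm _ _ _
    have a2 : ∀ k, w₁ k ⊔ (w₂ k ⊔ (v i ⊔ g.u i)) = w₁ k ⊔ w₂ k ⊔ (v i ⊔ g.u i) :=
      fun k => (sup_assoc _ _ _).symm
    simp only [a1] at t1 t3
    simp only [a2] at t2
    convert (t1.add t2).add t3 using 1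
    funext k
    rw [← ker_gradOp, pull_mul]
    funext x y
    simp only [Pi.add_apply, ← ker_add]
    congr 1
    noncomm_ring

theorem Dec.conj (hw : ∀ k, g.Lip (w k)) {t : K → Ker X} (h : g.Dec w t) :
    g.Dec w (fun k x y => starRingEnd ℂ (t k y x)) :=
  cls_nil.1 (Cls.conj (v := fun _ => 0) (fun _ => g.lip_zero) hw (cls_nil.2 h))

theorem ker_adjoint' (T : Op X) :
    ker (ContinuousLinearMap.adjoint T) = fun x y => starRingEnd ℂ (ker T y x) := by
  funext x y; exact ker_adjoint T x y

/-! ### Inverses -/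

/-- Uniform boundedness of a family of operators. -/
def Bd (F : K → Op X) : Prop := ∃ C : NNReal, ∀ k, ‖F k‖ₑ ≤ C

theorem Bd.mul (hF : Bd F) (hG : Bd G) : Bd (fun k => F k * G k) := by
  obtain ⟨C, hC⟩ := hF
  obtain ⟨D, hD⟩ := hG
  refine ⟨C * D, fun k => ?_⟩
  push_cast
  refine le_trans ?_ (mul_le_mul' (hC k) (hD k))
  simp only [enorm_eq_nnnorm]
  exact_mod_cast nnnorm_mul_le _ _

theorem Bd.add (hF : Bd F) (hG : Bd G) : Bd (fun k => F k + G k) := by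
  obtain ⟨C, hC⟩ := hF
  obtain ⟨D, hD⟩ := hG
  refine ⟨C + D, fun k => ?_⟩
  push_cast
  refine (enorm_add_le (F k) (G k)).trans ?_
  gcongr
  exacts [hC k, hD k]

theorem Bd.neg (hF : Bd F) : Bd (fun k => -F k) := by
  obtain ⟨C, hC⟩ := hF
  exact ⟨C, fun k => by rw [enorm_neg]; exact hC k⟩

/-- Boundedness of the iterated commutators with `D` up to the order `m`. -/
def Smooth (D : K → Op X) : ℕ → (K → Op X) → Prop
  | 0, F => Bd F
  | m + 1, F => Bd F ∧ Smooth D m (fun k => D k * F k - F k * D k)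

theorem Smooth.pred {D : K → Op X} {m : ℕ} (h : Smooth D (m + 1) F) : Smooth D m F := by
  induction m generalizing F with
  | zero => exact h.1
  | succ m ih => exact ⟨h.1, ih h.2⟩

theorem Smooth.add {D : K → Op X} {m : ℕ} (hF : Smooth D m F) (hG : Smooth D m G) :
    Smooth D m (fun k => F k + G k) := by
  induction m generalizing F G with
  | zero => exact Bd.add hF hG
  | succ m ih =>
    refine ⟨hF.1.add hG.1, ?_⟩
    convert ih hF.2 hG.2 using 2 with k
    noncomm_ring

theorem Smooth.neg {D : K → Op X} {m : ℕ} (hF : Smooth D m F) : Smooth D m (fun k => -F k) := by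
  induction m generalizing F with
  | zero => exact Bd.neg hF
  | succ m ih =>
    refine ⟨hF.1.neg, ?_⟩
    convert ih hF.2 using 2 with k
    noncomm_ring

theorem Smooth.mul {D : K → Op X} {m : ℕ} (hF : Smooth D m F) (hG : Smooth D m G) :
    Smooth D m (fun k => F k * G k) := by
  induction m generalizing F G with
  | zero => exact Bd.mul hF hG
  | succ m ih =>
    refine ⟨hF.1.mul hG.1, ?_⟩
    convert (ih hF.2 hG.pred).add (ih hF.pred hG.2) using 2 with k
    noncomm_ring

theorem comm_inv {A : Type} [Ring A] (D F G : A) (h₁ : F * G = 1) (h₂ : G * F = 1) :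
    D * G - G * D = -(G * (D * F - F * D) * G) := by
  have e1 : G * D * (F * G) = G * D := by rw [h₁, mul_one]
  have e2 : (G * F) * D * G = D * G := by rw [h₂, one_mul]
  calc D * G - G * D = (G * F) * D * G - G * D * (F * G) := by rw [e1, e2]
    _ = _ := by noncomm_ring

/-- `[D, F⁻¹] = -F⁻¹ [D, F] F⁻¹`: control of `m` commutators of the inverse and `m + 1` of `F` gives
`m + 1` of the inverse. The norm bound for the inverse starts the induction. -/
theorem Smooth.inv {D : K → Op X} {m : ℕ} (hF : Smooth D m F) (hG : Bd G)
    (h₁ : ∀ k, F k * G k = 1) (h₂ : ∀ k, G k * F k = 1) : Smooth D m G := by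
  induction m with
  | zero => exact hG
  | succ m ih =>
    have hGm := ih hF.pred
    refine ⟨hG, ?_⟩
    convert ((hGm.mul hF.2).mul hGm).neg using 2 with k
    exact comm_inv _ _ _ (h₁ k) (h₂ k)

theorem Dec.bd (h : g.Dec (fun _ => 0) (fun k => ker (F k))) : Bd F := by
  obtain ⟨N, B, hB⟩ := g.tsum_wt_d
  obtain ⟨C, hC⟩ := h N
  have h0 : ∀ k x y, ‖ker (F k) x y‖ₑ ≤ (wt (g.d x y) ^ N)⁻¹ * C :=
    fun k x y => le_inv_wt_mul (hC (k, x, y))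
  refine ⟨B * C, fun k => ?_⟩
  push_cast
  refine enorm_le_of_schur _ _ (fun x => ?_) (fun y => ?_)
  · refine (ENNReal.tsum_le_tsum fun y => h0 k x y).trans ?_
    rw [ENNReal.tsum_mul_right]
    gcongr
    exact hB x
  · refine (ENNReal.tsum_le_tsum fun x => h0 k x y).trans ?_
    rw [ENNReal.tsum_mul_right]
    gcongr
    simpa only [g.d_comm y] using hB y

/-- Truncation of integers to `[-N, N]`. -/
def trunc (N : ℕ) (n : ℤ) : ℤ := max (-N) (min N n)

theorem trunc_bound (N : ℕ) (n : ℤ) : ‖((trunc N n : ℤ) : ℂ)‖ ≤ N := by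
  rw [Complex.norm_intCast]
  have h1 : trunc N n ≤ N := by unfold trunc; omega
  have h2 : -(N : ℤ) ≤ trunc N n := by unfold trunc; omega
  rw [abs_le]
  constructor
  · exact_mod_cast h2
  · exact_mod_cast h1

/-- Multiplication by the truncated `i`-th coordinate. -/
def coordOp (g : Grid X ι) (i : ι) (N : ℕ) : Op X :=
  mulOp (fun x => ((trunc N (g.c x i) : ℤ) : ℂ)) N (Nat.cast_nonneg N) (fun _ => trunc_bound _ _)

theorem ker_comm_coordOp (i : ι) (N : ℕ) (T : Op X) (x y : X) :
    ker (g.coordOp i N * T - T * g.coordOp i N) x y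
      = ((trunc N (g.c x i) - trunc N (g.c y i) : ℤ) : ℂ) * ker T x y := by
  rw [ker_sub, coordOp, ker_mulOp_mul, ker_mul_mulOp]
  push_cast
  ring

theorem enorm_intCast (n : ℤ) : ‖(n : ℂ)‖ₑ = (n.natAbs : ℝ≥0∞) := by
  rw [enorm_eq_nnnorm, ← ENNReal.coe_natCast]
  congr 1
  ext
  rw [coe_nnnorm, Complex.norm_intCast]
  simp [Nat.cast_natAbs]

/-- Truncation makes a coordinate a bounded operator without increasing differences of coordinates.
So a commutator multiplies an entry by at most `d(x, y)`, uniformly in the level of truncation, and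
the decay absorbs this factor. -/
theorem Dec.smooth {F : K × ℕ → Op X} (i : ι) (h : g.Dec (fun _ => 0) (fun k => ker (F k)))
    (m : ℕ) : Smooth (fun k : K × ℕ => g.coordOp i k.2) m F := by
  induction m generalizing F with
  | zero => exact h.bd
  | succ m ih =>
    refine ⟨h.bd, ih ?_⟩
    intro n
    obtain ⟨C, hC⟩ := h (n + 1)
    refine ⟨C, fun p => le_trans ?_ (hC p)⟩
    simp only
    rw [ker_comm_coordOp, enorm_mul, enorm_intCast, pow_succ, mul_assoc]
    gcongr
    have := g.natAbs_le_d i p.2.1 p.2.2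
    have h2 : (trunc p.1.2 (g.c p.2.1 i) - trunc p.1.2 (g.c p.2.2 i)).natAbs
        ≤ (g.c p.2.1 i - g.c p.2.2 i).natAbs := by unfold trunc; omega
    unfold wt
    refine le_trans ?_ le_add_self
    norm_cast
    omega

/-- An `m`-fold commutator with a diagonal operator multiplies the entry at `(x, y)` by the `m`-th
power of the difference of the diagonal values, and entries are bounded by operator norms. -/
theorem Smooth.bound {F : K × ℕ → Op X} {i : ι} {m : ℕ}
    (h : Smooth (fun k : K × ℕ => g.coordOp i k.2) m F) :
    ∃ C : NNReal, ∀ k x y,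
      ((trunc k.2 (g.c x i) - trunc k.2 (g.c y i)).natAbs : ℝ≥0∞) ^ m * ‖ker (F k) x y‖ₑ ≤ C := by
  induction m generalizing F with
  | zero =>
    obtain ⟨C, hC⟩ := h
    exact ⟨C, fun k x y => by simpa using (enorm_ker_le _ x y).trans (hC k)⟩
  | succ m ih =>
    obtain ⟨C, hC⟩ := ih h.2
    refine ⟨C, fun k x y => le_trans (le_of_eq ?_) (hC k x y)⟩
    rw [ker_comm_coordOp, enorm_mul, enorm_intCast]
    ring

theorem wt_pow_le (a m : ℕ) : wt a ^ m ≤ 2 ^ m * (1 + (a : ℝ≥0∞) ^ m) := by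
  rw [wt_eq]
  norm_cast
  rcases Nat.eq_zero_or_pos a with h | h
  · subst h
    have := Nat.one_le_two_pow (n := m)
    simp only [zero_add, one_pow]
    nlinarith [Nat.zero_le (0 ^ m)]
  · calc (a + 1) ^ m ≤ (2 * a) ^ m := Nat.pow_le_pow_left (by omega) m
      _ = 2 ^ m * a ^ m := mul_pow _ _ _
      _ ≤ _ := Nat.mul_le_mul_left _ (by omega)

theorem Rapid.sum {P ι' : Type} {f : P → ℝ≥0∞} {ρ : ι' → P → ℕ} (s : Finset ι')
    (h0 : Rapid (fun _ => 0) f) (h : ∀ i ∈ s, Rapid (ρ i) f) :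
    Rapid (fun p => ∑ i ∈ s, ρ i p) f := by
  classical
  induction s using Finset.induction_on with
  | empty => simpa using h0
  | insert a s ha ih =>
    simp only [Finset.sum_insert ha]
    refine ((h a (Finset.mem_insert_self a s)).sup
      (ih fun i hi => h i (Finset.mem_insert_of_mem hi))).weight 2 fun p => by omega

/-- Inverses of matrices with rapid decay away from the diagonal. -/
theorem Dec.inv (h : g.Dec (fun _ => 0) (fun k => ker (F k))) (hG : Bd G)
    (h₁ : ∀ k, F k * G k = 1) (h₂ : ∀ k, G k * F k = 1) :
    g.Dec (fun _ => 0) (fun k => ker (G k)) := by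
  obtain ⟨C₀, hC₀⟩ := hG
  have h0 : ∀ p : K × X × X, ‖ker (G p.1) p.2.1 p.2.2‖ₑ ≤ C₀ :=
    fun p => (enorm_ker_le _ _ _).trans (hC₀ _)
  unfold Dec Grid.d
  refine Rapid.sum _ (fun m => ⟨C₀, fun p => by simpa [wt] using h0 p⟩) fun i _ m => ?_
  have hS := (Dec.smooth i (h.comp (fun k : K × ℕ => k.1)) m).inv
    (G := fun k : K × ℕ => G k.1) ⟨C₀, fun k => hC₀ _⟩ (fun k => h₁ _) (fun k => h₂ _)
  obtain ⟨C, hC⟩ := hS.bound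
  refine ⟨2 ^ m * (C₀ + C), fun p => ?_⟩
  -- The level `|x_i| + |y_i|` leaves both coordinates untruncated. It may depend on the entry
  -- because `C` does not depend on the level.
  have h3 := hC (p.1, (g.c p.2.1 i).natAbs + (g.c p.2.2 i).natAbs) p.2.1 p.2.2
  have h4 : (trunc ((g.c p.2.1 i).natAbs + (g.c p.2.2 i).natAbs) (g.c p.2.1 i)
      - trunc ((g.c p.2.1 i).natAbs + (g.c p.2.2 i).natAbs) (g.c p.2.2 i))
      = (g.c p.2.1 i - g.c p.2.2 i) := by unfold trunc; omega
  simp only [h4] at h3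
  calc _ ≤ 2 ^ m * (1 + ((g.c p.2.1 i - g.c p.2.2 i).natAbs : ℝ≥0∞) ^ m)
        * ‖ker (G p.1) p.2.1 p.2.2‖ₑ := by
        gcongr; exact wt_pow_le _ _
    _ = 2 ^ m * (‖ker (G p.1) p.2.1 p.2.2‖ₑ + ((g.c p.2.1 i - g.c p.2.2 i).natAbs : ℝ≥0∞) ^ m
        * ‖ker (G p.1) p.2.1 p.2.2‖ₑ) := by ring
    _ ≤ _ := by
        push_cast
        gcongr
        exact h0 p

end Grid

end QSphere

end

noncomputable section

namespace QSphere

/-! ### Stability of the estimates under inversion -/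

namespace Grid

variable {X ι : Type} [Fintype ι] {g : Grid X ι} {K : Type}
variable {v : ι → X → ℕ} {w w₁ w₂ : K → X → ℕ} {F G : K → Op X}

/-- Compressing `F G = 1` by the shift gives `1 = F' G' +` defect, where primes denote compressions.
Multiplication by `G` from the left yields `G' - G = -G ((F' - F) G' +` defect`)`. Here only
differences of `F` occur, and `G` is already controlled for the shorter list. -/
theorem Cls.inv (hv : ∀ i, g.Lip (v i)) {L : List ι} (hL : L.Nodup)
    (hG : g.Dec (fun _ => 0) (fun k => ker (G k)))
    (h₁ : ∀ k, F k * G k = 1) (h₂ : ∀ k, G k * F k = 1)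
    (hF : g.Cls v L (fun _ => 0) (fun k => ker (F k)))
    (ho : ∀ i ∈ L, g.Dec (fun _ => v i) (fun k => g.off i (ker (F k))))
    (ho' : ∀ i ∈ L, g.Dec (fun _ => v i) (fun k => g.off i (ker (G k)))) :
    g.Cls v L (fun _ => 0) (fun k => ker (G k)) := by
  induction L with
  | nil => exact cls_nil.2 hG
  | cons i L ih =>
    rw [cls_cons] at hF ⊢
    rw [List.nodup_cons] at hL
    have hoL : ∀ j ∈ L, g.Dec (fun _ => v j) (fun k => g.off j (ker (F k))) :=
      fun j hj => ho j (List.mem_cons_of_mem _ hj)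
    have hoL' : ∀ j ∈ L, g.Dec (fun _ => v j) (fun k => g.off j (ker (G k))) :=
      fun j hj => ho' j (List.mem_cons_of_mem _ hj)
    have hoi := ho i List.mem_cons_self
    have hG' := ih hL.2 hF.1 hoL hoL'
    have hvu := (hv i).sup (g.lip_u i)
    have hlip0 : ∀ k : K, g.Lip ((fun _ => 0) k) := fun _ => g.lip_zero
    have hlip : ∀ k : K, g.Lip ((fun _ => v i ⊔ g.u i) k) := fun _ => hvu
    refine ⟨hG', ?_⟩
    have hz : (0 : X → ℕ) ⊔ (v i ⊔ g.u i) = v i ⊔ g.u i := by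
      funext x; simp
    have hz' : (v i ⊔ g.u i) ⊔ (0 : X → ℕ) = v i ⊔ g.u i := by
      funext x; simp
    have e1 := hF.2
    simp only [← ker_gradOp, hz] at e1
    simp only [hz]
    have t1 := e1.mul (G := fun k => pull (g.s i) (g.s_inj i) (G k)) hv hL.2 hlip hlip0
      (by
        have := hG'.shift hv hlip0 i
        convert this using 2 with k
        funext x y
        exact ker_pull _ _ _ _ _)
      (fun j hj => by
        simp only [ker_gradOp]
        exact Dec.off_grad (fun _ => hv j) i (hoL j hj))
    have e3 := hF.1.cut hv hlip0 hL.1 hoi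
    simp only [← ker_cutOp, hz] at e3
    have t3 := e3.mul (G := fun k => G k * push (g.s i) (g.s_inj i)) hv hL.2 hlip hlip0
      (by
        have := hG'.shift_right hv hlip0 hL.1
        convert this using 2 with k
        funext x y
        exact ker_mul_push _ _ _ _ _)
      (fun j hj => by
        simp only [ker_cutOp]
        exact Dec.off_cut (fun h => hL.1 (h ▸ hj)) (fun _ => hv j) (hoL j hj))
    simp only [hz'] at t1 t3
    have t4 := t1.add t3
    have e4 : ∀ T U : Op X, ker T + ker U = ker (T + U) := fun _ _ => rfl
    simp only [e4] at t4
    have t5 := (hG'.mul hv hL.2 hlip0 hlip t4 hoL').neg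
    simp only [hz] at t5
    convert t5 using 1
    funext k
    have e5 : ∀ T : Op X, -ker T = ker (-T) := fun _ => rfl
    rw [← ker_gradOp, e5]
    congr 1
    have e6 : pull (g.s i) (g.s_inj i) (F k * G k) = 1 := by
      rw [h₁, pull, mul_one, adjoint_push_mul_push]
    rw [pull_mul] at e6
    have e7 : ContinuousLinearMap.adjoint (push (g.s i) (g.s_inj i)) * F k *
        offRange (g.s i) (g.s_inj i) * (G k * push (g.s i) (g.s_inj i)) =
        1 - pull (g.s i) (g.s_inj i) (F k) * pull (g.s i) (g.s_inj i) (G k) :=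
      eq_sub_of_add_eq' e6
    have e8 : (pull (g.s i) (g.s_inj i) (F k) - F k) * pull (g.s i) (g.s_inj i) (G k) +
        (1 - pull (g.s i) (g.s_inj i) (F k) * pull (g.s i) (g.s_inj i) (G k)) =
        1 - F k * pull (g.s i) (g.s_inj i) (G k) := by noncomm_ring
    rw [e7, e8, mul_sub, ← mul_assoc, h₂, one_mul, mul_one, neg_sub]

/-! ### Commutators with spectral projections of the coordinates -/

open scoped Classical in
/-- The projection onto the span of the `e_x` whose `i`-th coordinate is `p`. -/
def indOp (g : Grid X ι) (i : ι) (p : ℤ) : Op X :=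
  mulOp (fun x => if g.c x i = p then 1 else 0) 1 zero_le_one fun x => by split_ifs <;> simp

/-- The commutator with the projection onto `x_i = p` has the entries `(1_{x_i = p} - 1_{y_i = p})
t(x, y)`. They vanish if `x_i = y_i`, and otherwise the choice `p = x_i` recovers the entry. Unlike
`off`, commutators obey a Leibniz rule and the formula for inverses. -/
theorem off_iff {i : ι} {w₀ : X → ℕ} : g.Dec (fun _ => w₀) (fun k => g.off i (ker (F k))) ↔
    g.Dec (fun _ : K × ℤ => w₀)
      (fun k => ker (g.indOp i k.2 * F k.1 - F k.1 * g.indOp i k.2)) := by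
  classical
  constructor <;> intro h
  · refine Rapid.of_le h (fun p => (p.1.1, p.2)) 1 fun p _ => ⟨?_, by simp⟩
    simp only [off, ker_sub, indOp, ker_mulOp_mul, ker_mul_mulOp]
    by_cases hxy : g.c p.2.1 i = g.c p.2.2 i
    · simp only [hxy, if_true]
      split_ifs <;> simp
    · rw [if_neg hxy]
      split_ifs with h1 h2
      · exact absurd (h1.trans h2.symm) hxy
      all_goals simp
  · refine Rapid.of_le h (fun p => ((p.1, g.c p.2.1 i), p.2)) 1 fun p hp => ⟨?_, by simp⟩
    simp only [off, ker_sub, indOp, ker_mulOp_mul, ker_mul_mulOp]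
    by_cases hxy : g.c p.2.1 i = g.c p.2.2 i
    · simp [hxy]
    · simp [hxy, Ne.symm hxy]

theorem sup_zero' (w₀ : X → ℕ) : w₀ ⊔ 0 = w₀ := by funext x; simp

theorem zero_sup' (w₀ : X → ℕ) : 0 ⊔ w₀ = w₀ := by funext x; simp

theorem Dec.off_mul {i : ι} {w₀ : X → ℕ} (hw : g.Lip w₀)
    (hF : g.Dec (fun _ => 0) (fun k => ker (F k))) (hG : g.Dec (fun _ => 0) (fun k => ker (G k)))
    (hF' : g.Dec (fun _ => w₀) (fun k => g.off i (ker (F k))))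
    (hG' : g.Dec (fun _ => w₀) (fun k => g.off i (ker (G k)))) :
    g.Dec (fun _ => w₀) (fun k => g.off i (ker (F k * G k))) := by
  rw [off_iff] at hF' hG' ⊢
  have t1 := hF'.mul (hG.comp fun k : K × ℤ => k.1) fun _ => g.lip_zero
  have t2 := (hF.comp fun k : K × ℤ => k.1).mul hG' fun _ => hw
  simp only [sup_zero', zero_sup'] at t1 t2
  convert t1.add t2 using 1
  funext k
  change _ = ker (_ + _)
  congr 1
  noncomm_ring

theorem Dec.off_inv {i : ι} {w₀ : X → ℕ} (hw : g.Lip w₀)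
    (hG : g.Dec (fun _ => 0) (fun k => ker (G k)))
    (h₁ : ∀ k, F k * G k = 1) (h₂ : ∀ k, G k * F k = 1)
    (hF' : g.Dec (fun _ => w₀) (fun k => g.off i (ker (F k)))) :
    g.Dec (fun _ => w₀) (fun k => g.off i (ker (G k))) := by
  rw [off_iff] at hF' ⊢
  have hG1 := hG.comp fun k : K × ℤ => k.1
  have t1 := ((hG1.mul hF' fun _ => hw).mul hG1 fun _ => g.lip_zero).neg
  simp only [sup_zero', zero_sup'] at t1
  convert t1 using 1
  funext k
  rw [comm_inv _ _ _ (h₁ k.1) (h₂ k.1)]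
  rfl

/-! ### Translations -/

/-- The difference of a kernel and its translate by `N` in the direction `z`. -/
def transl (g : Grid X ι) (z : ι) (N : ℕ) (t : Ker X) : Ker X :=
  fun x y => t ((g.s z)^[N] x) ((g.s z)^[N] y) - t x y

theorem d_iterate (g : Grid X ι) (z : ι) (N : ℕ) (x y : X) :
    g.d ((g.s z)^[N] x) ((g.s z)^[N] y) = g.d x y := by
  induction N with
  | zero => rfl
  | succ N ih => rw [Function.iterate_succ_apply', Function.iterate_succ_apply', g.d_s, ih]

theorem pull_mul_of_surjective {f : X → X} (hf : Function.Injective f)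
    (hs : Function.Surjective f) (T U : Op X) :
    pull f hf (T * U) = pull f hf T * pull f hf U := by
  have h : offRange f hf = 0 := by
    classical
    refine ker_ext fun x y => ?_
    rw [← one_mul (offRange f hf), ker_mul_offRange, if_pos (Set.mem_range.2 (hs y)), ker_zero]
  rw [pull_mul, h, mul_zero, zero_mul, add_zero]

theorem iterate_inj (g : Grid X ι) (z : ι) (N : ℕ) : Function.Injective ((g.s z)^[N]) :=
  (g.s_inj z).iterate N

theorem iterate_surj (g : Grid X ι) {z : ι} (hz : ¬g.nat z) (N : ℕ) :
    Function.Surjective ((g.s z)^[N]) :=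
  Function.Surjective.iterate (fun x => (g.range_iff z x).2 fun h => absurd h hz) N

theorem ker_translOp (z : ι) (N : ℕ) (T : Op X) :
    ker (pull ((g.s z)^[N]) (g.iterate_inj z N) T - T) = g.transl z N (ker T) := by
  funext x y
  rw [ker_sub, ker_pull]; rfl

theorem Dec.translate {z : ι} (h : g.Dec (fun _ => 0) (fun k => ker (F k))) :
    g.Dec (fun _ : K × ℕ => 0)
      (fun k => ker (pull ((g.s z)^[k.2]) (g.iterate_inj z k.2) (F k.1))) := by
  refine Rapid.of_le h (fun p => (p.1.1, (g.s z)^[p.1.2] p.2.1, (g.s z)^[p.1.2] p.2.2)) 1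
    fun p _ => ⟨?_, ?_⟩
  · simp only [ker_pull, le_refl]
  · simp only [d_iterate]
    simp

/-- A direction of type `ℤ` has bijective translations, so compression by them is multiplicative and
the Leibniz rule has no defect. -/
theorem Dec.transl_mul {z : ι} (hz : ¬g.nat z) {wz : ℕ → X → ℕ} (hw : ∀ N, g.Lip (wz N))
    (hF : g.Dec (fun _ => 0) (fun k => ker (F k))) (hG : g.Dec (fun _ => 0) (fun k => ker (G k)))
    (hF' : g.Dec (fun k : K × ℕ => wz k.2) (fun k => g.transl z k.2 (ker (F k.1))))
    (hG' : g.Dec (fun k : K × ℕ => wz k.2) (fun k => g.transl z k.2 (ker (G k.1)))) :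
    g.Dec (fun k : K × ℕ => wz k.2) (fun k => g.transl z k.2 (ker (F k.1 * G k.1))) := by
  simp only [← ker_translOp] at hF' hG' ⊢
  have t1 := hF'.mul (hG.translate (z := z)) fun _ => g.lip_zero
  have t2 := (hF.comp fun k : K × ℕ => k.1).mul hG' fun k => hw k.2
  simp only [sup_zero', zero_sup'] at t1 t2
  convert t1.add t2 using 1
  funext k
  change _ = ker (_ + _)
  congr 1
  rw [pull_mul_of_surjective _ (g.iterate_surj hz k.2)]
  noncomm_ring

theorem Dec.transl_inv {z : ι} (hz : ¬g.nat z) {wz : ℕ → X → ℕ} (hw : ∀ N, g.Lip (wz N))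
    (hG : g.Dec (fun _ => 0) (fun k => ker (G k)))
    (h₁ : ∀ k, F k * G k = 1) (h₂ : ∀ k, G k * F k = 1)
    (hF' : g.Dec (fun k : K × ℕ => wz k.2) (fun k => g.transl z k.2 (ker (F k.1)))) :
    g.Dec (fun k : K × ℕ => wz k.2) (fun k => g.transl z k.2 (ker (G k.1))) := by
  simp only [← ker_translOp] at hF' ⊢
  have hG1 := hG.comp fun k : K × ℕ => k.1
  have t1 := ((hG1.mul hF' fun k => hw k.2).mul (hG.translate (z := z)) fun _ => g.lip_zero).neg
  simp only [sup_zero', zero_sup'] at t1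
  convert t1 using 1
  funext k
  have e5 : ∀ T : Op X, -ker T = ker (-T) := fun _ => rfl
  rw [e5]
  congr 1
  have e6 : pull ((g.s z)^[k.2]) (g.iterate_inj z k.2) (F k.1) *
      pull ((g.s z)^[k.2]) (g.iterate_inj z k.2) (G k.1) = 1 := by
    rw [← pull_mul_of_surjective _ (g.iterate_surj hz k.2), h₁, pull, mul_one,
      adjoint_push_mul_push]
  rw [mul_sub, sub_mul, mul_assoc, e6, h₂, mul_one, one_mul, neg_sub]

end Grid

/-! ### Superpositions -/

/-- The finite linear combinations of the entries of `t₀` are bounded by those of the `t k`. -/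
def Super {X K : Type} (t₀ : Ker X) (t : K → Ker X) : Prop :=
  ∃ C : NNReal, ∀ (a : (X × X) →₀ ℂ) (M : ℝ≥0∞),
    (∀ k, ‖a.sum fun p z => z * t k p.1 p.2‖ₑ ≤ M) → ‖a.sum fun p z => z * t₀ p.1 p.2‖ₑ ≤ C * M

namespace Super

variable {X ι K : Type} [Fintype ι] {g : Grid X ι} {t₀ : Ker X} {t : K → Ker X}

/-- Superpositions are stable under finite linear transformations of the entries. -/
theorem map (h : Super t₀ t) (Φ : X × X → (X × X) →₀ ℂ) :
    Super (fun x y => (Φ (x, y)).sum fun p z => z * t₀ p.1 p.2)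
      (fun k x y => (Φ (x, y)).sum fun p z => z * t k p.1 p.2) := by
  obtain ⟨C, hC⟩ := h
  refine ⟨C, fun a M hM => ?_⟩
  have key : ∀ t : Ker X, (a.sum fun p z => z * (Φ (p.1, p.2)).sum fun p z => z * t p.1 p.2)
      = (a.sum fun p z => z • Φ p).sum fun p z => z * t p.1 p.2 := by
    intro t
    rw [Finsupp.sum_sum_index (by simp) (by intros; ring)]
    refine Finsupp.sum_congr fun p _ => ?_
    rw [Finsupp.sum_smul_index (by simp), Finsupp.mul_sum]
    exact Finsupp.sum_congr fun _ _ => (mul_assoc _ _ _).symm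
  simp only [key] at hM ⊢
  exact hC _ M hM

theorem grad (h : Super t₀ t) (i : ι) : Super (g.grad i t₀) (fun k => g.grad i (t k)) := by
  convert h.map (fun p => Finsupp.single (g.s i p.1, g.s i p.2) 1 - Finsupp.single p 1) using 1
  · funext x y
    rw [Finsupp.sum_sub_index (by intros; ring)]
    simp [Grid.grad]
  · funext k x y
    rw [Finsupp.sum_sub_index (by intros; ring)]
    simp [Grid.grad]

end Super

end QSphere

end

noncomputable section

namespace QSphere

/-! ### Estimates for superpositions -/

namespace Super

variable {X ι K : Type} [Fintype ι] {g : Grid X ι} {t₀ : Ker X} {t : K → Ker X}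

theorem entry (h : Super t₀ t) :
    ∃ C : NNReal, ∀ x y (M : ℝ≥0∞), (∀ k, ‖t k x y‖ₑ ≤ M) → ‖t₀ x y‖ₑ ≤ C * M := by
  obtain ⟨C, hC⟩ := h
  exact ⟨C, fun x y M hM => by
    simpa using hC (Finsupp.single (x, y) 1) M (fun k => by simpa using hM k)⟩

theorem off (h : Super t₀ t) (i : ι) : Super (g.off i t₀) (fun k => g.off i (t k)) := by
  classical
  convert h.map (fun p => if g.c p.1 i = g.c p.2 i then 0 else Finsupp.single p 1) using 1
  · funext x y
    by_cases hxy : g.c x i = g.c y i <;> simp [Grid.off, hxy]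
  · funext k x y
    by_cases hxy : g.c x i = g.c y i <;> simp [Grid.off, hxy]

theorem bound {C D : NNReal} {x y : X} {n m : ℕ}
    (h : ∀ M : ℝ≥0∞, (∀ k, ‖t k x y‖ₑ ≤ M) → ‖t₀ x y‖ₑ ≤ C * M)
    (hD : ∀ k, wt n ^ m * ‖t k x y‖ₑ ≤ D) : wt n ^ m * ‖t₀ x y‖ₑ ≤ C * D := by
  calc wt n ^ m * ‖t₀ x y‖ₑ ≤ wt n ^ m * (C * ((wt n ^ m)⁻¹ * D)) := by
        gcongr; exact h _ fun k => le_inv_wt_mul (hD k)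
    _ = (wt n ^ m * (wt n ^ m)⁻¹) * (C * D) := by ring
    _ = C * D := by rw [ENNReal.mul_inv_cancel (wt_pow_ne_zero _ _) (wt_pow_ne_top _ _), one_mul]

/-- Every norm in `Cls` is built from suprema of weighted absolute values of finite combinations of
entries; a bound uniform over the family passes to `t₀` with the constant of the superposition. -/
theorem cls (h : Super t₀ t) {v : ι → X → ℕ} {L : List ι} {w : X → ℕ}
    (ht : g.Cls v L (fun _ => w) t) : g.Cls v L (fun _ : Unit => w) (fun _ => t₀) := by
  induction L generalizing w t₀ t with
  | nil =>
    rw [Grid.cls_nil] at ht ⊢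
    obtain ⟨C, hC⟩ := h.entry
    intro m
    obtain ⟨D, hD⟩ := ht m
    refine ⟨C * D, fun p => ?_⟩
    push_cast
    exact bound (hC p.2.1 p.2.2) fun k => hD (k, p.2)
  | cons i L ih =>
    rw [Grid.cls_cons] at ht ⊢
    exact ⟨ih h ht.1, ih (h.grad i) ht.2⟩

theorem dec (h : Super t₀ t) {w : X → ℕ} (ht : g.Dec (fun _ => w) t) :
    g.Dec (fun _ : Unit => w) (fun _ => t₀) :=
  Grid.cls_nil.1 (h.cls (v := fun _ => 0) (Grid.cls_nil.2 ht))

theorem transl_dec (h : Super t₀ t) {z : ι} {wz : ℕ → X → ℕ}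
    (ht : g.Dec (fun k : K × ℕ => wz k.2) (fun k => g.transl z k.2 (t k.1))) :
    g.Dec (fun k : Unit × ℕ => wz k.2) (fun k => g.transl z k.2 t₀) := by
  obtain ⟨C, hC⟩ := h
  intro m
  obtain ⟨D, hD⟩ := ht m
  refine ⟨C * D, fun p => ?_⟩
  push_cast
  refine bound (t := fun k => g.transl z p.1.2 (t k)) (fun M hM => ?_)
    fun k => hD ((k, p.1.2), p.2)
  have e1 : ∀ t : Ker X, g.transl z p.1.2 t p.2.1 p.2.2 =
      ((Finsupp.single ((g.s z)^[p.1.2] p.2.1, (g.s z)^[p.1.2] p.2.2) 1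
    - Finsupp.single p.2 1 : (X × X) →₀ ℂ)).sum fun p z => z * t p.1 p.2 := by
    intro t
    rw [Finsupp.sum_sub_index (by intros; ring)]
    simp [Grid.transl]
  simp only [e1] at hM ⊢
  exact hC _ M hM

end Super

/-! ### The class of good families -/

/-- A grid with the weights and the lists of directions that enter the definition of good
families. -/
structure Frame (X ι : Type) [Fintype ι] where
  g : Grid X ι
  v : ι → X → ℕ
  z : ι
  wz : ℕ → X → ℕ
  Ls : Set (List ι)
  lip_v : ∀ i, g.Lip (v i)
  lip_wz : ∀ N, g.Lip (wz N)
  not_nat : ¬g.nat z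
  nodup : ∀ L ∈ Ls, L.Nodup

namespace Frame

variable {X ι : Type} [Fintype ι] (S : Frame X ι) {K : Type}

/-- Good families of kernels. -/
structure Good (t : K → Ker X) : Prop where
  dec : S.g.Dec (fun _ => 0) t
  off : ∀ i, S.g.Dec (fun _ => S.v i) (fun k => S.g.off i (t k))
  cls : ∀ L ∈ S.Ls, S.g.Cls S.v L (fun _ => 0) t
  transl : S.g.Dec (fun k : K × ℕ => S.wz k.2) (fun k => S.g.transl S.z k.2 (t k.1))

variable {S} {t t' : K → Ker X} {F G : K → Op X}

namespace Good

theorem add (h : S.Good t) (h' : S.Good t') : S.Good (fun k => t k + t' k) where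
  dec := h.dec.add h'.dec
  off i := by
    refine ((h.off i).add (h'.off i)).mono fun k x y => le_of_eq ?_
    simp only [Grid.off, Pi.add_apply]
    split_ifs <;> simp
  cls L hL := (h.cls L hL).add (h'.cls L hL)
  transl := by
    refine (h.transl.add h'.transl).mono fun k x y => le_of_eq ?_
    simp only [Grid.transl, Pi.add_apply]
    congr 1
    ring

theorem smul (h : S.Good t) {c : K → ℂ} (C : NNReal) (hc : ∀ k, ‖c k‖₊ ≤ C) :
    S.Good (fun k => c k • t k) where
  dec := h.dec.smul C hc
  off i := by
    refine ((h.off i).smul C hc).mono fun k x y => le_of_eq ?_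
    simp only [Grid.off, Pi.smul_apply, smul_eq_mul]
    split_ifs <;> simp
  cls L hL := (h.cls L hL).smul C hc
  transl := by
    refine (h.transl.smul (c := fun k : K × ℕ => c k.1) C fun k => hc k.1).mono
      fun k x y => le_of_eq ?_
    simp only [Grid.transl, Pi.smul_apply, smul_eq_mul]
    congr 1
    ring

theorem neg (h : S.Good t) : S.Good (fun k => -t k) := by
  simpa using h.smul (c := fun _ => -1) 1 (by simp)

theorem comp {K' : Type} (h : S.Good t) (φ : K' → K) : S.Good (fun k => t (φ k)) where
  dec := h.dec.comp φ
  off i := (h.off i).comp φ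
  cls L hL := (h.cls L hL).comp φ
  transl := h.transl.comp fun k : K' × ℕ => (φ k.1, k.2)

theorem one : S.Good (fun _ : K => ker (1 : Op X)) where
  dec := by
    classical
    refine fun m => ⟨1, fun p => ?_⟩
    simp only [ker_one]
    split_ifs with h
    · simp [h, Grid.d_self, wt]
    · simp
  off i := by
    classical
    refine Grid.dec_zero.mono fun _ x y => ?_
    simp only [Grid.off, ker_one]
    split_ifs with h h'
    · simp
    · exact absurd (by rw [h']) h
    · simp
  cls L hL := by
    classical
    have hg : ∀ i, S.g.grad i (ker (1 : Op X)) = 0 := by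
      intro i
      funext x y
      simp [Grid.grad, ker_one, (S.g.s_inj i).eq_iff]
    have h0 : S.g.Dec (fun _ : K => 0) (fun _ : K => ker (1 : Op X)) := by
      refine fun m => ⟨1, fun p => ?_⟩
      simp only [ker_one]
      split_ifs with h
      · simp [h, Grid.d_self, wt]
      · simp
    clear hL
    induction L with
    | nil => exact Grid.cls_nil.2 h0
    | cons i L ih =>
      rw [Grid.cls_cons, hg]
      exact ⟨ih, Grid.cls_zero⟩
  transl := by
    classical
    refine Grid.dec_zero.mono fun k x y => ?_
    simp [Grid.transl, ker_one, (S.g.iterate_inj S.z k.2).eq_iff]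

theorem adjoint (h : S.Good (fun k => ker (F k))) :
    S.Good (fun k => ker (ContinuousLinearMap.adjoint (F k))) where
  dec := by
    simp only [Grid.ker_adjoint']
    exact h.dec.conj fun _ => S.g.lip_zero
  off i := by
    simp only [Grid.ker_adjoint']
    refine ((h.off i).conj fun _ => S.lip_v i).mono fun k x y => le_of_eq ?_
    simp only [Grid.off, eq_comm]
    split_ifs <;> simp
  cls L hL := by
    simp only [Grid.ker_adjoint']
    exact (h.cls L hL).conj S.lip_v fun _ => S.g.lip_zero
  transl := by
    simp only [Grid.ker_adjoint']
    have h1 := Grid.Dec.conj (g := S.g) (w := fun k : K × ℕ => S.wz k.2)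
      (t := fun k => S.g.transl S.z k.2 (ker (F k.1))) (fun k => S.lip_wz k.2) h.transl
    refine h1.mono fun k x y => le_of_eq ?_
    simp only [Grid.transl, map_sub]

theorem mul (h : S.Good (fun k => ker (F k))) (h' : S.Good (fun k => ker (G k))) :
    S.Good (fun k => ker (F k * G k)) where
  dec := by
    simpa only [Grid.sup_zero'] using h.dec.mul h'.dec fun _ => S.g.lip_zero
  off i := Grid.Dec.off_mul (S.lip_v i) h.dec h'.dec (h.off i) (h'.off i)
  cls L hL := by
    simpa only [Grid.sup_zero'] using
      (h.cls L hL).mul S.lip_v (S.nodup L hL) (fun _ => S.g.lip_zero) (fun _ => S.g.lip_zero)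
        (h'.cls L hL) fun i _ => h.off i
  transl := Grid.Dec.transl_mul S.not_nat S.lip_wz h.dec h'.dec h.transl h'.transl

theorem inv (h : S.Good (fun k => ker (F k))) (hG : Grid.Bd G)
    (h₁ : ∀ k, F k * G k = 1) (h₂ : ∀ k, G k * F k = 1) : S.Good (fun k => ker (G k)) :=
  have hd := h.dec.inv hG h₁ h₂
  have ho := fun i => Grid.Dec.off_inv (S.lip_v i) hd h₁ h₂ (h.off i)
  { dec := hd
    off := ho
    cls := fun L hL => Grid.Cls.inv S.lip_v (S.nodup L hL) hd h₁ h₂ (h.cls L hL)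
      (fun i _ => h.off i) fun i _ => ho i
    transl := Grid.Dec.transl_inv S.not_nat S.lip_wz hd h₁ h₂ h.transl }

theorem super {t₀ : Ker X} (h : S.Good t) (hs : Super t₀ t) : S.Good (fun _ : Unit => t₀) where
  dec := hs.dec h.dec
  off i := (hs.off i).dec (h.off i)
  cls L hL := hs.cls (h.cls L hL)
  transl := hs.transl_dec h.transl

end Good

/-- The good operators of a closed `*`-algebra are closed under holomorphic functional calculus. -/
theorem Good.holomorphic {A : StarSubalgebra ℂ (Op X)} [CompleteSpace A] {a b : A} {f : ℂ → ℂ}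
    (ha : S.Good (fun _ : Unit => ker (a : Op X))) (hb : IsHolomorphicValue a f b) :
    S.Good (fun _ : Unit => ker (b : Op X)) := by
  obtain ⟨U, hU, hsU, hf, n, Γ, ⟨hlip, -, hmem, -, -⟩, hb⟩ := hb
  choose Λ hΛ using hlip
  -- All points of the contour index a single family, so that one application of `Good.inv` gives
  -- estimates for the resolvents that are uniform along `Γ`.
  let K : Type := Fin n × Set.Icc (0 : ℝ) 1
  have hcont : ∀ i, ContinuousOn (Γ i) (Set.Icc 0 1) := fun i => (hΛ i).continuousOn
  have hres : ∀ i, ∀ t ∈ Set.Icc (0 : ℝ) 1, Γ i t ∈ resolventSet ℂ a := fun i t ht => by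
    by_contra h
    exact (hmem i t ht).2 h
  have hRc : ∀ i, ContinuousOn (fun t => resolvent a (Γ i t)) (Set.Icc 0 1) := by
    intro i t ht
    exact (spectrum.hasDerivAt_resolvent_const_left (hres i t ht)).continuousAt.comp_continuousWithinAt
      (hcont i t ht)
  have hfc : ∀ i, ContinuousOn (fun t => f (Γ i t)) (Set.Icc 0 1) := fun i =>
    hf.continuousOn.comp (hcont i) fun t ht => (hmem i t ht).1
  have bdd : ∀ {E : Type} [NormedAddCommGroup E] (φ : Fin n → ℝ → E),
      (∀ i, ContinuousOn (φ i) (Set.Icc 0 1)) →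
      ∃ C : NNReal, ∀ i, ∀ t ∈ Set.Icc (0 : ℝ) 1, ‖φ i t‖₊ ≤ C := by
    intro E _ φ hφ
    choose C hC using fun i => isCompact_Icc.exists_bound_of_continuousOn (hφ i)
    refine ⟨∑ i, (C i).toNNReal, fun i t ht => ?_⟩
    refine le_trans ?_ (Finset.single_le_sum (f := fun i => (C i).toNNReal)
      (fun _ _ => zero_le) (Finset.mem_univ i))
    rw [← NNReal.coe_le_coe]
    exact (hC i t ht).trans (Real.le_coe_toNNReal _)
  obtain ⟨CΓ, hCΓ⟩ := bdd Γ hcont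
  obtain ⟨CR, hCR⟩ := bdd _ hRc
  obtain ⟨Cf, hCf⟩ := bdd _ hfc
  let F : K → Op X := fun k => Γ k.1 k.2 • (1 : Op X) - (a : Op X)
  let G : K → Op X := fun k => ((resolvent a (Γ k.1 k.2) : A) : Op X)
  have hF : S.Good (fun k => ker (F k)) := by
    have h1 := (Good.one (S := S) (K := K)).smul (c := fun k => Γ k.1 k.2) CΓ
      fun k => hCΓ k.1 k.2 k.2.2
    have h2 := (ha.comp fun _ : K => ()).neg
    convert h1.add h2 using 1
    funext k x y
    simp only [F, ker_sub, ker_smul, Pi.add_apply, Pi.smul_apply, Pi.neg_apply, smul_eq_mul]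
    ring
  have hinv : ∀ k : K, F k * G k = 1 ∧ G k * F k = 1 := by
    intro k
    have h1 : IsUnit (algebraMap ℂ A (Γ k.1 k.2) - a) := hres k.1 k.2 k.2.2
    have e : F k = ((algebraMap ℂ A (Γ k.1 k.2) - a : A) : Op X) := by
      simp only [F, Algebra.algebraMap_eq_smul_one]
      rfl
    have e1 : (algebraMap ℂ A (Γ k.1 k.2) - a) * resolvent a (Γ k.1 k.2) = 1 :=
      Ring.mul_inverse_cancel _ h1
    have e2 : resolvent a (Γ k.1 k.2) * (algebraMap ℂ A (Γ k.1 k.2) - a) = 1 :=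
      Ring.inverse_mul_cancel _ h1
    rw [e]
    exact ⟨congrArg (fun x : A => (x : Op X)) e1, congrArg (fun x : A => (x : Op X)) e2⟩
  have hG : Grid.Bd G := ⟨CR, fun k => enorm_le_coe.2 (hCR k.1 k.2 k.2.2)⟩
  have hgood := hF.inv hG (fun k => (hinv k).1) fun k => (hinv k).2
  refine hgood.super ?_
  -- The sum bounds the total mass of `(2πi)⁻¹ f(z) dz` on the contour. The added `1` keeps the
  -- constant nonzero, which settles the case `M = ⊤`.
  refine ⟨‖(2 * Real.pi * Complex.I : ℂ)⁻¹‖₊ * ∑ i, (Λ i * Cf) + 1, fun c M hM => ?_⟩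
  by_cases hMtop : M = ⊤
  · subst hMtop
    rw [ENNReal.mul_top]
    · exact le_top
    · simp
  lift M to NNReal using hMtop
  -- A finite combination of entries is a bounded functional, so it can be moved under the integral.
  let φ : Op X →L[ℂ] ℂ := c.sum fun p z => z • kerL p.1 p.2
  have hφ : ∀ T, φ T = c.sum fun p z => z * ker T p.1 p.2 := by
    intro T
    simp [φ, Finsupp.sum, kerL_apply]
  let incl : A →L[ℂ] Op X :=
    ⟨(A.toSubalgebra.val : A →ₐ[ℂ] Op X).toLinearMap, continuous_subtype_val⟩
  let ψ : A →L[ℂ] ℂ := φ ∘L incl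
  have hψ : ∀ T : A, ψ T = φ (T : Op X) := fun T => rfl
  have hM' : ∀ i, ∀ t ∈ Set.Icc (0 : ℝ) 1, ‖ψ (resolvent a (Γ i t))‖ ≤ M := by
    intro i t ht
    have := hM (i, ⟨t, ht⟩)
    rw [← hφ] at this
    exact NNReal.coe_le_coe.2 (enorm_le_coe.1 this)
  rw [← hφ, ← hψ, hb, map_smul, map_sum, enorm_smul]
  have hint : ∀ i, ‖ψ (∫ t in (0 : ℝ)..1, (deriv (Γ i) t * f (Γ i t)) • resolvent a (Γ i t))‖
      ≤ Λ i * Cf * M := by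
    intro i
    by_cases hI : IntervalIntegrable (fun t => (deriv (Γ i) t * f (Γ i t)) • resolvent a (Γ i t))
        volume 0 1
    · rw [← ContinuousLinearMap.intervalIntegral_comp_comm _ hI]
      refine (intervalIntegral.norm_integral_le_of_norm_le_const_ae (C := Λ i * Cf * M) ?_).trans
        (by simp)
      -- The Lipschitz bound for the derivative needs an interior point of `[0, 1]`; the endpoint is
      -- a null set.
      have h1 : ∀ᵐ t : ℝ, t ≠ 1 := by simp [ae_iff]
      filter_upwards [h1] with t ht ht'
      rw [Set.uIoc_of_le zero_le_one] at ht'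
      have ht2 : t ∈ Set.Ioo (0 : ℝ) 1 := ⟨ht'.1, lt_of_le_of_ne ht'.2 ht⟩
      have ht3 := Set.Ioo_subset_Icc_self ht2
      rw [map_smul, norm_smul, norm_mul]
      gcongr
      · exact norm_deriv_le_of_lipschitzOn (Icc_mem_nhds ht2.1 ht2.2) (hΛ i)
      · exact hCf i t ht3
      · exact hM' i t ht3
    -- The integral of a function that is not integrable is `0` by convention, so the bound holds in
    -- this case too.
    · rw [intervalIntegral.integral_undef hI, map_zero, norm_zero]
      positivity
  have hsum : ‖∑ i, ψ (∫ t in (0 : ℝ)..1, (deriv (Γ i) t * f (Γ i t)) • resolvent a (Γ i t))‖ₑ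
      ≤ ((∑ i, Λ i * Cf) * M : NNReal) := by
    rw [enorm_le_coe, ← NNReal.coe_le_coe, coe_nnnorm]
    refine (norm_sum_le _ _).trans ?_
    push_cast
    rw [Finset.sum_mul]
    exact Finset.sum_le_sum fun i _ => hint i
  calc _ ≤ ((‖(2 * Real.pi * Complex.I : ℂ)⁻¹‖₊ : NNReal) : ℝ≥0∞)
        * ((∑ i, Λ i * Cf) * M : NNReal) := by
        rw [enorm_eq_nnnorm]
        gcongr
    _ ≤ _ := by
        push_cast
        rw [← mul_assoc]
        gcongr
        exact le_self_add

end Frame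

end QSphere

end

noncomputable section

namespace QSphere

/-! ### Concrete grids -/

namespace Grid

/-- The grid `ℕ`. -/
def natGrid : Grid ℕ Unit where
  c n _ := n
  s _ n := n + 1
  nat _ := True
  c_s_self _ _ := by push_cast; ring
  c_s_of_ne _ _ _ h := absurd rfl h
  c_inj m n h := by have := congrFun h (); simpa using this
  nonneg _ _ _ := by positivity
  range_iff _ n := by
    cases n with
    | zero => simp
    | succ n => simp; omega
  const φ h x y := by
    have key : ∀ n, φ n = φ 0 := fun n => by
      induction n with
      | zero => rfl
      | succ n ih => rw [← ih]; exact h () n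
    rw [key x, key y]

/-- The grid `ℤ`. -/
def intGrid : Grid ℤ Unit where
  c n _ := n
  s _ n := n + 1
  nat _ := False
  c_s_self _ _ := rfl
  c_s_of_ne _ _ _ h := absurd rfl h
  c_inj m n h := congrFun h ()
  nonneg _ _ h := h.elim
  range_iff _ n := by
    simp only [false_imp_iff, iff_true]
    exact ⟨n - 1, by simp⟩
  const φ h x y := by
    have key : ∀ n, φ n = φ 0 := fun n => by
      induction n using Int.induction_on with
      | zero => rfl
      | succ n ih => rw [← ih]; exact h () n
      | pred n ih =>
        rw [← ih, ← h () (-n - 1)]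
        congr 1
        ring
    rw [key x, key y]

/-- The grid with one point and no directions. -/
def unitGrid : Grid Unit Empty where
  c _ i := i.elim
  s i := i.elim
  nat i := i.elim
  c_s_self i := i.elim
  c_s_of_ne i := i.elim
  c_inj _ _ _ := rfl
  nonneg i := i.elim
  range_iff i := i.elim
  const _ _ _ _ := rfl

/-- The product of two grids. -/
def prod {X Y ι κ : Type} [Fintype ι] [Fintype κ] (g : Grid X ι) (h : Grid Y κ) :
    Grid (X × Y) (ι ⊕ κ) where
  c p := Sum.elim (g.c p.1) (h.c p.2)
  s i p := Sum.elim (fun i => (g.s i p.1, p.2)) (fun j => (p.1, h.s j p.2)) i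
  nat := Sum.elim g.nat h.nat
  c_s_self i p := by
    cases i with
    | inl i => exact g.c_s_self i p.1
    | inr j => exact h.c_s_self j p.2
  c_s_of_ne i j p hij := by
    cases i with
    | inl i =>
      cases j with
      | inl j => exact g.c_s_of_ne i j p.1 fun e => hij (by rw [e])
      | inr j => rfl
    | inr i =>
      cases j with
      | inl j => rfl
      | inr j => exact h.c_s_of_ne i j p.2 fun e => hij (by rw [e])
  c_inj p q e := by
    refine Prod.ext (g.c_inj ?_) (h.c_inj ?_)
    · funext i; exact congrFun e (Sum.inl i)
    · funext j; exact congrFun e (Sum.inr j)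
  nonneg i p := by
    cases i with
    | inl i => exact g.nonneg i p.1
    | inr j => exact h.nonneg j p.2
  range_iff i p := by
    cases i with
    | inl i =>
      refine Iff.trans ?_ (g.range_iff i p.1)
      constructor
      · rintro ⟨q, hq⟩; exact ⟨q.1, congrArg Prod.fst hq⟩
      · rintro ⟨q, hq⟩; exact ⟨(q, p.2), Prod.ext hq rfl⟩
    | inr j =>
      refine Iff.trans ?_ (h.range_iff j p.2)
      constructor
      · rintro ⟨q, hq⟩; exact ⟨q.2, congrArg Prod.snd hq⟩
      · rintro ⟨q, hq⟩; exact ⟨(p.1, q), Prod.ext rfl hq⟩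
  const φ hφ p q := by
    have h1 : φ p = φ (q.1, p.2) :=
      g.const (fun x => φ (x, p.2)) (fun i x => hφ (Sum.inl i) (x, p.2)) p.1 q.1
    rw [h1]
    exact h.const (fun y => φ (q.1, y)) (fun j y => hφ (Sum.inr j) (q.1, y)) p.2 q.2

section

variable {X Y ι κ : Type} [Fintype ι] [Fintype κ] (g : Grid X ι) (h : Grid Y κ)

theorem prod_d (p q : X × Y) : (g.prod h).d p q = g.d p.1 q.1 + h.d p.2 q.2 := by
  simp [d, prod, Fintype.sum_sum_type]

theorem prod_u_inr (j : κ) (p : X × Y) : (g.prod h).u (Sum.inr j) p = h.u j p.2 := rfl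

theorem prod_s_inl (i : ι) (p : X × Y) : (g.prod h).s (Sum.inl i) p = (g.s i p.1, p.2) := rfl

theorem prod_s_inr (j : κ) (p : X × Y) : (g.prod h).s (Sum.inr j) p = (p.1, h.s j p.2) := rfl

theorem Lip.fst {w : X → ℕ} (hw : g.Lip w) : (g.prod h).Lip fun p => w p.1 := fun p q => by
  have := hw p.1 q.1
  rw [prod_d]
  dsimp only
  omega

end

end Grid

/-- The directions of `ℕ^n × ℤ`. -/
abbrev IdxDir : ℕ → Type
  | 0 => Unit
  | n + 1 => Unit ⊕ IdxDir n

/-- The directions of `ℕ^n`. -/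
abbrev NIdxDir : ℕ → Type
  | 0 => Empty
  | n + 1 => Unit ⊕ NIdxDir n

instance idxDirFintype : (n : ℕ) → Fintype (IdxDir n)
  | 0 => inferInstanceAs (Fintype Unit)
  | n + 1 => @instFintypeSum Unit (IdxDir n) _ (idxDirFintype n)

instance nidxDirFintype : (n : ℕ) → Fintype (NIdxDir n)
  | 0 => inferInstanceAs (Fintype Empty)
  | n + 1 => @instFintypeSum Unit (NIdxDir n) _ (nidxDirFintype n)

/-- The grid `ℕ^n × ℤ`. -/
def gridI : (n : ℕ) → Grid (Idx n) (IdxDir n)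
  | 0 => Grid.intGrid
  | n + 1 => Grid.natGrid.prod (gridI n)

/-- The grid `ℕ^n`. -/
def gridN : (n : ℕ) → Grid (NIdx n) (NIdxDir n)
  | 0 => Grid.unitGrid
  | n + 1 => Grid.natGrid.prod (gridN n)

/-- The direction of `ℤ` in `ℕ^n × ℤ`. -/
def zdir : (n : ℕ) → IdxDir n
  | 0 => ()
  | n + 1 => Sum.inr (zdir n)

/-- The sum of the coordinates that precede a given one. -/
def pre : (n : ℕ) → IdxDir n → Idx n → ℕ
  | 0, _, _ => 0
  | _ + 1, Sum.inl _, _ => 0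
  | n + 1, Sum.inr i, x => x.1 + pre n i x.2

/-- All the directions of `ℕ^n`. -/
def listN : (n : ℕ) → List (NIdxDir n)
  | 0 => []
  | n + 1 => Sum.inl () :: (listN n).map Sum.inr

/-- The origin of `ℕ^n × ℤ`. -/
def izero : (n : ℕ) → Idx n
  | 0 => (0 : ℤ)
  | n + 1 => ((0 : ℕ), izero n)

theorem zdir_not_nat (n : ℕ) : ¬(gridI n).nat (zdir n) := by
  induction n with
  | zero => exact id
  | succ n ih => exact ih

theorem nat_of_ne_zdir (n : ℕ) (i : IdxDir n) (h : i ≠ zdir n) : (gridI n).nat i := by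
  induction n with
  | zero => exact absurd rfl h
  | succ n ih =>
    cases i with
    | inl i => trivial
    | inr i => exact ih i fun e => h (by rw [e]; rfl)

theorem gridI_d_succ (n : ℕ) (x y : Idx (n + 1)) :
    (gridI (n + 1)).d x y = ((x.1 : ℤ) - y.1).natAbs + (gridI n).d x.2 y.2 := by
  rw [gridI, Grid.prod_d]
  simp [Grid.d, Grid.natGrid]

theorem gridI_u_inl (n : ℕ) (x : Idx (n + 1)) : (gridI (n + 1)).u (Sum.inl ()) x = x.1 := rfl

theorem pre_lip (n : ℕ) (i : IdxDir n) : (gridI n).Lip (pre n i) := by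
  induction n with
  | zero => exact fun _ _ => Nat.zero_le _
  | succ n ih =>
    cases i with
    | inl i => exact fun _ _ => Nat.zero_le _
    | inr i =>
      intro x y
      have := ih i x.2 y.2
      rw [gridI_d_succ]
      simp only [pre]
      omega

theorem absD_lip (n : ℕ) : (gridI n).Lip (absD n) := by
  induction n with
  | zero =>
    intro x y
    have : (gridI 0).d x y = ((x : ℤ) - y).natAbs := by
      simp [gridI, Grid.d, Grid.intGrid]
    rw [this]
    simp only [absD]
    omega
  | succ n ih =>
    intro x y
    have := ih x.2 y.2
    rw [gridI_d_succ]
    simp only [absD]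
    omega

theorem pre_zdir (n : ℕ) (x : Idx n) : pre n (zdir n) x + (gridI n).u (zdir n) x = absD n x := by
  induction n with
  | zero => simp [pre, gridI, Grid.u, Grid.intGrid, absD]
  | succ n ih =>
    have : (gridI (n + 1)).u (zdir (n + 1)) x = (gridI n).u (zdir n) x.2 := rfl
    rw [this]
    simp only [zdir, pre, absD]
    rw [← ih]
    omega

theorem pre_add_u_le (n : ℕ) (i : IdxDir n) (x : Idx n) : pre n i x + (gridI n).u i x ≤ absD n x := by
  induction n with
  | zero => simp [pre, gridI, Grid.u, Grid.intGrid, absD]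
  | succ n ih =>
    cases i with
    | inl i =>
      have h2 : (gridI (n + 1)).u (Sum.inl i) x = x.1 := rfl
      rw [h2]
      simp only [pre, absD]
      omega
    | inr i =>
      have := ih i x.2
      have h2 : (gridI (n + 1)).u (Sum.inr i) x = (gridI n).u i x.2 := rfl
      rw [h2]
      simp only [pre, absD]
      omega

theorem d_le_absD (n : ℕ) (x y : Idx n) : (gridI n).d x y ≤ absD n x + absD n y := by
  induction n with
  | zero =>
    have : (gridI 0).d x y = ((x : ℤ) - y).natAbs := by
      simp [gridI, Grid.d, Grid.intGrid]
    rw [this]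
    simp only [absD]
    omega
  | succ n ih =>
    have := ih x.2 y.2
    rw [gridI_d_succ]
    simp only [absD]
    omega

theorem absD_izero (n : ℕ) : absD n (izero n) = 0 := by
  induction n with
  | zero => rfl
  | succ n ih => simp [absD, izero, ih]

/-- `|D|` dominates the distance from the origin, so `tsum_wt_d` applies. -/
theorem absD_pow_tsum (n : ℕ) : ∃ (N : ℕ) (B : NNReal), ∑' x, (wt (absD n x) ^ N)⁻¹ ≤ B := by
  obtain ⟨N, B, hB⟩ := (gridI n).tsum_wt_d
  refine ⟨N, B, le_trans (ENNReal.tsum_le_tsum fun x => ?_) (hB (izero n))⟩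
  gcongr
  refine wt_mono ?_
  have := d_le_absD n (izero n) x
  rwa [absD_izero, zero_add] at this

theorem listN_nodup (n : ℕ) : (listN n).Nodup := by
  induction n with
  | zero => exact List.nodup_nil
  | succ n ih =>
    refine List.nodup_cons.2 ⟨by simp, ih.map Sum.inr_injective⟩

/-- The product grid `(ℕ^n × ℤ) × ℕ^m`. -/
def gridB (n m : ℕ) : Grid (Idx n × NIdx m) (IdxDir n ⊕ NIdxDir m) := (gridI n).prod (gridN m)

/-- The weight of a direction of `(ℕ^n × ℤ) × ℕ^m`. -/
def vB (n m : ℕ) : IdxDir n ⊕ NIdxDir m → Idx n × NIdx m → ℕ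
  | Sum.inl i, p => pre n i p.1
  | Sum.inr _, p => absD n p.1

/-- The weight of a translation by `N` in `(ℕ^n × ℤ) × ℕ^m`. -/
def wzB (n m N : ℕ) : Idx n × NIdx m → ℕ :=
  (fun p => pre n (zdir n) p.1) ⊔ ((gridB n m).u (Sum.inl (zdir n)) ⊓
    fun p => (gridB n m).u (Sum.inl (zdir n)) (((gridB n m).s (Sum.inl (zdir n)))^[N] p))

/-- The frame that describes the smooth functions on the quantum sphere. -/
def frameB (n m : ℕ) : Frame (Idx n × NIdx m) (IdxDir n ⊕ NIdxDir m) where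
  g := gridB n m
  v := vB n m
  z := Sum.inl (zdir n)
  -- A translation along `ℤ` fixes the preceding coordinates and moves the last one from `z` to `z +
  -- N`. For a kernel that decays in `|D|`, the difference with its translate is therefore governed
  -- by the preceding coordinates and by the smaller of `|z|` and `|z + N|`.
  wz := wzB n m
  -- One difference in a single `ℕ`-direction of the first factor, and mixed differences, each
  -- direction at most once, in the second. The direction of `ℤ` is left to the translations.
  Ls := {L | (∃ i, (gridI n).nat i ∧ L = [Sum.inl i]) ∨ L = (listN m).map Sum.inr}
  lip_v i := by
    cases i with
    | inl i => exact Grid.Lip.fst _ _ (pre_lip n i)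
    | inr j => exact Grid.Lip.fst _ _ (absD_lip n)
  lip_wz N := by
    refine (Grid.Lip.fst _ _ (pre_lip n _)).sup (Grid.Lip.inf (Grid.lip_u _ _) fun p q => ?_)
    have := (gridB n m).lip_u (Sum.inl (zdir n)) (((gridB n m).s (Sum.inl (zdir n)))^[N] p)
      (((gridB n m).s (Sum.inl (zdir n)))^[N] q)
    rwa [Grid.d_iterate] at this
  not_nat := zdir_not_nat n
  nodup L hL := by
    rcases hL with ⟨i, -, rfl⟩ | rfl
    · exact List.nodup_singleton _
    · exact (listN_nodup m).map Sum.inr_injective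

/-! ### Kernels and norms of tensor products -/

theorem ker_tensor {X Y : Type} (T : Op X) (R : Op Y) (p q : X × Y) :
    ker (tensor T R) p q = ker T p.1 q.1 * ker R p.2 q.2 :=
  tensor_apply T R q.1 p.1 q.2 p.2

theorem norm_tensor_le {X Y : Type} (T : Op X) (R : Op Y) : ‖tensor T R‖ ≤ ‖T‖ * ‖R‖ := by
  have h1 : ∀ {X : Type} (T : Op X) (Y : Type), ‖ampL T Y‖ ≤ ‖T‖ := fun T Y =>
    LinearMap.mkContinuous_norm_le _ (norm_nonneg _) _
  have h2 : ‖ampR X R‖ ≤ ‖R‖ := by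
    unfold ampR
    refine (ContinuousLinearMap.opNorm_comp_le _ _).trans ?_
    refine (mul_le_mul (norm_push_le _ _) (ContinuousLinearMap.opNorm_comp_le _ _) (norm_nonneg _)
      zero_le_one).trans ?_
    rw [one_mul]
    refine (mul_le_mul (h1 R X) (norm_push_le _ _) (norm_nonneg _) (norm_nonneg _)).trans ?_
    rw [mul_one]
  refine (ContinuousLinearMap.opNorm_comp_le _ _).trans ?_
  exact mul_le_mul (h1 T Y) h2 (norm_nonneg _) (norm_nonneg _)

theorem enorm_tensor_le {X Y : Type} (T : Op X) (R : Op Y) : ‖tensor T R‖ₑ ≤ ‖T‖ₑ * ‖R‖ₑ := by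
  simp only [enorm_eq_nnnorm]
  exact_mod_cast norm_tensor_le T R

end QSphere

end

noncomputable section

namespace QSphere

/-! ### More on rapid decay -/

namespace Rapid

variable {P I : Type} {ρ : P → ℕ} {f : P → ℝ≥0∞}

theorem mul_wt (h : Rapid ρ f) {σ : P → ℕ} (hσ : ∀ p, σ p ≤ ρ p) (r : ℕ) :
    Rapid ρ (fun p => wt (σ p) ^ r * f p) := by
  intro m
  obtain ⟨C, hC⟩ := h (m + r)
  refine ⟨C, fun p => le_trans ?_ (hC p)⟩
  rw [pow_add, mul_assoc]
  dsimp only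
  gcongr
  exact wt_mono (hσ p)

theorem finset_sum {f : I → P → ℝ≥0∞} (s : Finset I) (h : ∀ i ∈ s, Rapid ρ (f i)) :
    Rapid ρ (fun p => ∑ i ∈ s, f i p) := by
  classical
  induction s using Finset.induction_on with
  | empty => simpa using Rapid.zero
  | insert a s ha ih =>
    simp only [Finset.sum_insert ha]
    exact (h a (Finset.mem_insert_self a s)).add (ih fun i hi => h i (Finset.mem_insert_of_mem hi))

theorem ne_top (h : Rapid ρ f) (p : P) : f p ≠ ⊤ := by
  obtain ⟨C, hC⟩ := h 0
  exact ne_top_of_le_ne_top ENNReal.coe_ne_top (by simpa using hC p)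

/-- Summation over an index set on which the inverse powers of a weight are summable. -/
theorem tsum_weight {ρ' : P × I → ℕ} {f : P × I → ℝ≥0∞} (h : Rapid ρ' f) {σ : I → ℕ}
    (hσ : ∃ (N : ℕ) (B : NNReal), ∑' i, (wt (σ i) ^ N)⁻¹ ≤ B)
    (hρ : ∀ p i, ρ p + σ i ≤ ρ' (p, i)) : Rapid ρ (fun p => ∑' i, f (p, i)) := by
  obtain ⟨N, B, hB⟩ := hσ
  refine h.tsum 1 N B (fun p i => ?_) fun p => le_trans (ENNReal.tsum_le_tsum fun i => ?_) hB
  · have := hρ p i; omega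
  · gcongr
    exact wt_mono (by have := hρ p i; omega)

end Rapid

theorem exists_tsum_nat : ∃ (N : ℕ) (B : NNReal), ∑' n : ℕ, (wt n ^ N)⁻¹ ≤ B :=
  ⟨2, (∑' n : ℕ, (wt n ^ 2)⁻¹).toNNReal, (ENNReal.coe_toNNReal tsum_inv_wt_sq_nat).ge⟩

theorem exists_tsum_int : ∃ (N : ℕ) (B : NNReal), ∑' n : ℤ, (wt n.natAbs ^ N)⁻¹ ≤ B :=
  ⟨2, (∑' n : ℤ, (wt n.natAbs ^ 2)⁻¹).toNNReal, (ENNReal.coe_toNNReal tsum_inv_wt_sq_int).ge⟩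

theorem exists_tsum_prod {I J : Type} {σ : I → ℕ} {τ : J → ℕ}
    (hσ : ∃ (N : ℕ) (B : NNReal), ∑' i, (wt (σ i) ^ N)⁻¹ ≤ B)
    (hτ : ∃ (N : ℕ) (B : NNReal), ∑' j, (wt (τ j) ^ N)⁻¹ ≤ B) :
    ∃ (N : ℕ) (B : NNReal), ∑' p : I × J, (wt (σ p.1 + τ p.2) ^ N)⁻¹ ≤ B := by
  obtain ⟨N, B, hB⟩ := hσ
  obtain ⟨M, C, hC⟩ := hτ
  refine ⟨N + M, B * C, ?_⟩
  calc ∑' p : I × J, (wt (σ p.1 + τ p.2) ^ (N + M))⁻¹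
      ≤ ∑' p : I × J, (wt (σ p.1) ^ N)⁻¹ * (wt (τ p.2) ^ M)⁻¹ := by
        refine ENNReal.tsum_le_tsum fun p => ?_
        rw [← ENNReal.mul_inv (Or.inl (wt_pow_ne_zero _ _)) (Or.inl (wt_pow_ne_top _ _)), pow_add]
        gcongr <;> exact wt_mono (by omega)
    _ = (∑' i, (wt (σ i) ^ N)⁻¹) * ∑' j, (wt (τ j) ^ M)⁻¹ := by
        rw [ENNReal.tsum_prod']
        simp_rw [ENNReal.tsum_mul_left, ENNReal.tsum_mul_right]
    _ ≤ _ := by push_cast; gcongr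

theorem exists_tsum_sum {I J : Type} {σ : I → ℕ} {τ : J → ℕ}
    (hσ : ∃ (N : ℕ) (B : NNReal), ∑' i, (wt (σ i) ^ N)⁻¹ ≤ B)
    (hτ : ∃ (N : ℕ) (B : NNReal), ∑' j, (wt (τ j) ^ N)⁻¹ ≤ B) :
    ∃ (N : ℕ) (B : NNReal), ∑' p : I ⊕ J, (wt (Sum.elim σ τ p) ^ N)⁻¹ ≤ B := by
  obtain ⟨N, B, hB⟩ := hσ
  obtain ⟨M, C, hC⟩ := hτ
  refine ⟨N + M, B + C, ?_⟩
  rw [ENNReal.summable.tsum_sum (ENNReal.summable)]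
  push_cast
  refine add_le_add (le_trans (ENNReal.tsum_le_tsum fun i => ?_) hB)
    (le_trans (ENNReal.tsum_le_tsum fun i => ?_) hC)
  · gcongr
    · exact one_le_wt _
    · simp
    · omega
  · gcongr
    · exact one_le_wt _
    · simp
    · omega

theorem summable_of_tsum_enorm {I E : Type} [NormedAddCommGroup E] [CompleteSpace E] {f : I → E}
    (h : ∑' i, ‖f i‖ₑ ≠ ⊤) : Summable f :=
  Summable.of_nnnorm (ENNReal.tsum_coe_ne_top_iff_summable.1 h)

namespace Grid

variable {X ι : Type} [Fintype ι] {g : Grid X ι} {K : Type}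
variable {v : ι → X → ℕ} {w W : K → X → ℕ} {t G : K → Ker X}

/-- The Schur test for families with parameters. -/
theorem Dec.rapid_norm {ω : K → ℕ} {F : K → Op X}
    (h : g.Dec (fun k _ => ω k) (fun k => ker (F k))) : Rapid ω (fun k => ‖F k‖ₑ) := by
  obtain ⟨N, B, hB⟩ := g.tsum_wt_d
  intro m
  obtain ⟨C, hC⟩ := h (m + N)
  have h0 : ∀ k x y, ‖ker (F k) x y‖ₑ ≤ (wt (g.d x y) ^ N)⁻¹ * ((wt (ω k) ^ m)⁻¹ * C) := by
    intro k x y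
    refine le_inv_wt_mul (le_inv_wt_mul (le_trans ?_ (hC (k, x, y))))
    rw [← mul_assoc, pow_add]
    gcongr <;> exact wt_mono (by simp)
  refine ⟨B * C, fun k => ?_⟩
  have h1 : ‖F k‖ₑ ≤ B * ((wt (ω k) ^ m)⁻¹ * C) := by
    refine enorm_le_of_schur _ _ (fun x => ?_) (fun y => ?_)
    · refine (ENNReal.tsum_le_tsum fun y => h0 k x y).trans ?_
      rw [ENNReal.tsum_mul_right]
      gcongr
      exact hB x
    · refine (ENNReal.tsum_le_tsum fun x => h0 k x y).trans ?_
      rw [ENNReal.tsum_mul_right]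
      gcongr
      simpa only [g.d_comm y] using hB y
  calc wt (ω k) ^ m * ‖F k‖ₑ ≤ wt (ω k) ^ m * (B * ((wt (ω k) ^ m)⁻¹ * C)) := by gcongr
    _ = (wt (ω k) ^ m * (wt (ω k) ^ m)⁻¹) * (B * C) := by ring
    _ = _ := by
        rw [ENNReal.mul_inv_cancel (wt_pow_ne_zero _ _) (wt_pow_ne_top _ _), one_mul]
        push_cast; rfl

/-! ### Telescoping sums -/

theorem c_iterate (g : Grid X ι) (i : ι) (N : ℕ) (x : X) : g.c ((g.s i)^[N] x) i = g.c x i + N := by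
  induction N with
  | zero => simp
  | succ N ih =>
    rw [Function.iterate_succ_apply', g.c_s_self, ih]
    push_cast
    ring

theorem u_iterate (g : Grid X ι) {i : ι} (hi : g.nat i) (N : ℕ) (x : X) :
    g.u i ((g.s i)^[N] x) = g.u i x + N := by
  have := g.nonneg i x hi
  unfold u
  rw [c_iterate]
  omega

theorem Lip.iterate {w : X → ℕ} (h : g.Lip w) (i : ι) (N : ℕ) (x : X) :
    w x ≤ w ((g.s i)^[N] x) + N := by
  induction N with
  | zero => simp
  | succ N ih =>
    rw [Function.iterate_succ_apply']
    have := h.s i ((g.s i)^[N] x)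
    omega

/-- `-∑_{N ≥ 0} G(x + N e_i, y + N e_i)`. -/
def tail (g : Grid X ι) (i : ι) (G : Ker X) : Ker X :=
  fun x y => -∑' N : ℕ, G ((g.s i)^[N] x) ((g.s i)^[N] y)

/-- `W` dominates the `i`-th coordinate, which has grown by `N` after `N` shifts. This gives the
terms of the telescoping series their decay in `N`. -/
theorem Dec.iterate {i : ι} (hi : g.nat i) (hWu : ∀ k x, g.u i x ≤ W k x) (h : g.Dec W G) :
    Rapid (fun p : (K × X × X) × ℕ =>
        g.d p.1.2.1 p.1.2.2 + W p.1.1 ((g.s i)^[p.2] p.1.2.1) + p.2)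
      (fun p => ‖G p.1.1 ((g.s i)^[p.2] p.1.2.1) ((g.s i)^[p.2] p.1.2.2)‖ₑ) := by
  refine Rapid.of_le h (fun p => (p.1.1, (g.s i)^[p.2] p.1.2.1, (g.s i)^[p.2] p.1.2.2)) 2
    fun p _ => ⟨le_rfl, ?_⟩
  have h1 := hWu p.1.1 ((g.s i)^[p.2] p.1.2.1)
  rw [u_iterate _ hi] at h1
  simp only [d_iterate]
  omega

theorem Dec.tail_summable {i : ι} (hi : g.nat i) (hWu : ∀ k x, g.u i x ≤ W k x) (h : g.Dec W G)
    (k : K) (x y : X) : Summable fun N : ℕ => G k ((g.s i)^[N] x) ((g.s i)^[N] y) := by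
  refine summable_of_tsum_enorm ?_
  have h1 := (h.iterate hi hWu).tsum_weight (ρ := fun _ => 0) exists_tsum_nat (by intros; omega)
  exact h1.ne_top (k, x, y)

theorem Dec.tail {i : ι} (hi : g.nat i) (hW : ∀ k, g.Lip (W k)) (hWu : ∀ k x, g.u i x ≤ W k x)
    (h : g.Dec W G) : g.Dec W (fun k => g.tail i (G k)) := by
  obtain ⟨N, B, hB⟩ := exists_tsum_nat
  have h1 := (h.iterate hi hWu).tsum (ρ := fun p : K × X × X => g.d p.2.1 p.2.2 + W p.1 p.2.1) 1 N B
    (fun p N => by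
      have := (hW p.1).iterate i N p.2.1
      dsimp only
      omega)
    (fun p => by
      refine le_trans (ENNReal.tsum_le_tsum fun N => ?_) hB
      gcongr
      exact wt_mono (by dsimp only; omega))
  refine Rapid.mono h1 fun p => ?_
  change ‖-∑' N : ℕ, G p.1 ((g.s i)^[N] p.2.1) ((g.s i)^[N] p.2.2)‖ₑ ≤ _
  rw [enorm_neg]
  exact enorm_tsum_le_tsum_enorm

theorem iterate_comm (g : Grid X ι) (i j : ι) (N : ℕ) (x : X) :
    (g.s i)^[N] (g.s j x) = g.s j ((g.s i)^[N] x) := by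
  induction N with
  | zero => rfl
  | succ N ih =>
    rw [Function.iterate_succ_apply', Function.iterate_succ_apply', ih]
    by_cases h : i = j
    · rw [h]
    · exact g.s_comm h _

theorem grad_tail {i : ι} (hi : g.nat i) (hWu : ∀ k x, g.u i x ≤ W k x) (h : g.Dec W G)
    (j : ι) (k : K) : g.grad j (g.tail i (G k)) = g.tail i (g.grad j (G k)) := by
  funext x y
  have h1 := h.tail_summable hi hWu k (g.s j x) (g.s j y)
  have h2 := h.tail_summable hi hWu k x y
  simp only [iterate_comm] at h1
  simp only [grad, Grid.tail, iterate_comm]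
  rw [h1.tsum_sub h2]
  ring

theorem Cls.tail (hv : ∀ i, g.Lip (v i)) {L : List ι} {i : ι} (hi : g.nat i)
    (hW : ∀ k, g.Lip (W k)) (hWu : ∀ k x, g.u i x ≤ W k x) (h : g.Cls v L W G) :
    g.Cls v L W (fun k => g.tail i (G k)) := by
  induction L generalizing W G with
  | nil => exact cls_nil.2 ((cls_nil.1 h).tail hi hW hWu)
  | cons j L ih =>
    have hd := h.dec
    rw [cls_cons] at h ⊢
    simp only [grad_tail hi hWu hd]
    exact ⟨ih hW hWu h.1, ih (fun k => (hW k).sup ((hv j).sup (g.lip_u j)))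
      (fun k x => (hWu k x).trans le_sup_left) h.2⟩

/-- Subtracting the telescoping sum makes a kernel invariant. -/
theorem grad_sub_tail {i : ι} (hi : g.nat i) (hWu : ∀ k x, g.u i x ≤ W k x)
    (h : g.Dec W (fun k => g.grad i (t k))) (k : K) :
    g.grad i (t k - g.tail i (g.grad i (t k))) = 0 := by
  funext x y
  have h1 := (h.tail_summable hi hWu k x y).tsum_eq_zero_add
  simp only [Function.iterate_succ_apply, Function.iterate_zero, id] at h1
  have h2 : g.tail i (g.grad i (t k)) x y =
      -(g.grad i (t k) x y) + g.tail i (g.grad i (t k)) (g.s i x) (g.s i y) := by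
    simp only [Grid.tail, h1]
    ring
  have h3 : g.grad i (t k) x y = t k (g.s i x) (g.s i y) - t k x y := rfl
  change (t k (g.s i x) (g.s i y) - g.tail i (g.grad i (t k)) (g.s i x) (g.s i y)) -
    (t k x y - g.tail i (g.grad i (t k)) x y) = 0
  rw [h2, h3]
  ring

theorem eq_iterate_of_grad {i : ι} {t : Ker X} (h : g.grad i t = 0) (N : ℕ) (x y : X) :
    t ((g.s i)^[N] x) ((g.s i)^[N] y) = t x y := by
  induction N with
  | zero => rfl
  | succ N ih =>
    rw [Function.iterate_succ_apply', Function.iterate_succ_apply', ← ih]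
    exact sub_eq_zero.1 (congrFun (congrFun h _) _)

theorem eq_zero_of_bound {a : ℝ≥0∞} {C : NNReal} (h : ∀ N : ℕ, wt N * a ≤ C) : a = 0 := by
  by_contra ha
  have hatop : a ≠ ⊤ := by
    have := h 0
    intro e
    rw [e, wt, Nat.cast_zero, add_zero, one_mul, top_le_iff] at this
    exact ENNReal.coe_ne_top this
  obtain ⟨N, hN⟩ := ENNReal.exists_nat_mul_gt ha (ENNReal.coe_ne_top (r := C))
  refine absurd (h N) (not_le.2 (hN.trans_le ?_))
  gcongr
  exact le_add_self

/-- An invariant kernel that decays in the direction of its invariance vanishes. -/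
theorem Dec.eq_zero {i : ι} (hi : g.nat i) (hWu : ∀ k x, g.u i x ≤ W k x) (h : g.Dec W t)
    (ht : ∀ k, g.grad i (t k) = 0) (k : K) : t k = 0 := by
  obtain ⟨C, hC⟩ := h 1
  funext x y
  rw [Pi.zero_apply, Pi.zero_apply, ← enorm_eq_zero]
  refine eq_zero_of_bound (C := C) fun N => le_trans ?_
    (hC (k, (g.s i)^[N] x, (g.s i)^[N] y))
  rw [pow_one]
  simp only [eq_iterate_of_grad (ht k)]
  gcongr
  refine wt_mono ?_
  have := hWu k ((g.s i)^[N] x)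
  rw [u_iterate _ hi] at this
  omega

end Grid

end QSphere

end

noncomputable section

namespace QSphere

/-! ### Powers of shifts -/

section Shift

variable {X : Type} (f : X → X) (hf : Function.Injective f)

theorem push_pow_e (k : ℕ) (x : X) : (push f hf ^ k) (e x) = e (f^[k] x) := by
  induction k with
  | zero => rfl
  | succ k ih =>
    rw [pow_succ', Function.iterate_succ_apply']
    change push f hf ((push f hf ^ k) (e x)) = _
    rw [ih, push_e]

theorem ker_mul_push_pow (T : Op X) (k : ℕ) (x y : X) :
    ker (T * push f hf ^ k) x y = ker T x (f^[k] y) := by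
  change T ((push f hf ^ k) (e y)) x = _
  rw [push_pow_e]; rfl

theorem ker_adjoint_pow_mul (T : Op X) (k : ℕ) (x y : X) :
    ker (ContinuousLinearMap.adjoint (push f hf) ^ k * T) x y = ker T (f^[k] x) y := by
  induction k generalizing x with
  | zero => simp
  | succ k ih =>
    rw [pow_succ', mul_assoc, ker_adjoint_push_mul, ih, Function.iterate_succ_apply]

open scoped Classical in
theorem ker_push_pow (k : ℕ) (x y : X) :
    ker (push f hf ^ k) x y = if x = f^[k] y then 1 else 0 := by
  rw [← one_mul (push f hf ^ k), ker_mul_push_pow, ker_one]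

open scoped Classical in
theorem ker_adjoint_pow (k : ℕ) (x y : X) :
    ker (ContinuousLinearMap.adjoint (push f hf) ^ k) x y = if f^[k] x = y then 1 else 0 := by
  rw [← mul_one (ContinuousLinearMap.adjoint (push f hf) ^ k), ker_adjoint_pow_mul, ker_one]

theorem adjoint_pow_e (k : ℕ) (x : X) :
    (ContinuousLinearMap.adjoint (push f hf) ^ k) (e (f^[k] x)) = e x := by
  classical
  ext z
  change ker _ z _ = _
  rw [ker_adjoint_pow, e_apply]
  simp [(hf.iterate k).eq_iff]

theorem adjoint_pow_e_zero (k : ℕ) (y : X) (hy : ∀ x, f^[k] x ≠ y) :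
    (ContinuousLinearMap.adjoint (push f hf) ^ k) (e y) = 0 := by
  classical
  ext z
  change ker _ z _ = _
  rw [ker_adjoint_pow, if_neg (hy z)]
  rfl

theorem ker_mul_adjoint_pow (T : Op X) (k : ℕ) (x y : X) :
    ker (T * ContinuousLinearMap.adjoint (push f hf) ^ k) x (f^[k] y) = ker T x y := by
  change T ((ContinuousLinearMap.adjoint (push f hf) ^ k) (e (f^[k] y))) x = _
  rw [adjoint_pow_e]; rfl

theorem ker_mul_adjoint_pow_zero (T : Op X) (k : ℕ) (x y : X) (hy : ∀ z, f^[k] z ≠ y) :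
    ker (T * ContinuousLinearMap.adjoint (push f hf) ^ k) x y = 0 := by
  change T ((ContinuousLinearMap.adjoint (push f hf) ^ k) (e y)) x = _
  rw [adjoint_pow_e_zero _ _ _ _ hy]; simp

theorem push_pow_apply (k : ℕ) (v : L2 X) (x : X) : (push f hf ^ k) v (f^[k] x) = v x := by
  have h : ContinuousLinearMap.adjoint (push f hf) ^ k * push f hf ^ k = 1 := by
    classical
    refine ker_ext fun x y => ?_
    rw [ker_mul_push_pow, ker_adjoint_pow, ker_one]
    simp [(hf.iterate k).eq_iff]
  have h2 : ContinuousLinearMap.adjoint (push f hf ^ k) = ContinuousLinearMap.adjoint (push f hf) ^ k :=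
    star_pow (push f hf) k
  have h3 : ∀ w : L2 X, (ContinuousLinearMap.adjoint (push f hf) ^ k) w x = w (f^[k] x) := by
    intro w
    rw [← h2, ← inner_e_left, ContinuousLinearMap.adjoint_inner_right, push_pow_e, inner_e_left]
  rw [← h3]
  change (ContinuousLinearMap.adjoint (push f hf) ^ k * push f hf ^ k) v x = v x
  rw [h]; rfl

theorem ker_push_pow_mul (T : Op X) (k : ℕ) (x y : X) :
    ker (push f hf ^ k * T) (f^[k] x) y = ker T x y :=
  push_pow_apply f hf k _ x

theorem ker_push_pow_mul_zero (T : Op X) (k : ℕ) (x y : X) (hx : ∀ z, f^[k] z ≠ x) :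
    ker (push f hf ^ k * T) x y = 0 := by
  have h2 : ContinuousLinearMap.adjoint (ContinuousLinearMap.adjoint (push f hf) ^ k) =
      push f hf ^ k := by
    have := star_pow (ContinuousLinearMap.adjoint (push f hf)) k
    rw [ContinuousLinearMap.star_eq_adjoint, ContinuousLinearMap.star_eq_adjoint,
      ContinuousLinearMap.adjoint_adjoint] at this
    exact this
  rw [ker, ← inner_e_left]
  change inner ℂ (e x) ((push f hf ^ k) (T (e y))) = 0
  rw [← h2, ContinuousLinearMap.adjoint_inner_right, adjoint_pow_e_zero _ _ _ _ hx, inner_zero_left]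

theorem norm_pow_push_le (k : ℕ) : ‖push f hf ^ k‖ ≤ 1 := by
  induction k with
  | zero => rw [pow_zero]; exact ContinuousLinearMap.norm_id_le
  | succ k ih =>
    rw [pow_succ]
    exact (norm_mul_le _ _).trans (mul_le_one₀ ih (norm_nonneg _) (norm_push_le _ _))

theorem norm_pow_adjoint_le (k : ℕ) : ‖ContinuousLinearMap.adjoint (push f hf) ^ k‖ ≤ 1 := by
  have h : ContinuousLinearMap.adjoint (push f hf ^ k) = ContinuousLinearMap.adjoint (push f hf) ^ k :=
    star_pow (push f hf) k
  rw [← h, LinearIsometryEquiv.norm_map]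
  exact norm_pow_push_le f hf k

end Shift

/-! ### Toeplitz expansions -/

theorem S_eq : S = ContinuousLinearMap.adjoint (push Nat.succ Nat.succ_injective) := rfl

/-- The shift of the first coordinate. -/
def succFst (X : Type) : ℕ × X → ℕ × X := Prod.map Nat.succ id

theorem succFst_inj (X : Type) : Function.Injective (succFst X) :=
  Nat.succ_injective.prodMap Function.injective_id

theorem succFst_iterate (X : Type) (k : ℕ) (p : ℕ × X) : (succFst X)^[k] p = (p.1 + k, p.2) := by
  induction k with
  | zero => rfl
  | succ k ih => rw [Function.iterate_succ_apply', ih]; rfl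

theorem succ_iterate' (k n : ℕ) : Nat.succ^[k] n = n + k := Nat.succ_iterate n k

theorem ker_S (j k : ℕ) : ker S j k = if k = j + 1 then 1 else 0 := by
  have := ker_adjoint_pow Nat.succ Nat.succ_injective 1 j k
  rw [pow_one, ← S_eq] at this
  rw [this]
  simp [eq_comm]

theorem alpha_eq (X : Type) : alpha X = ContinuousLinearMap.adjoint (push (succFst X) (succFst_inj X)) := by
  classical
  refine ker_ext fun p q => ?_
  have := ker_adjoint_pow (succFst X) (succFst_inj X) 1 p q
  rw [pow_one] at this
  rw [this, alpha, ker_tensor, ker_S, ker_one]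
  obtain ⟨j, x⟩ := p
  obtain ⟨k, y⟩ := q
  by_cases h1 : k = j + 1 <;> by_cases h2 : x = y <;> simp [succFst, h1, h2, eq_comm]

theorem adjoint_alpha_eq (X : Type) :
    ContinuousLinearMap.adjoint (alpha X) = push (succFst X) (succFst_inj X) := by
  rw [alpha_eq, ContinuousLinearMap.adjoint_adjoint]

open scoped Classical in
theorem ker_proj {X : Type} (z x y : X) : ker (proj z) x y = if x = z ∧ y = z then 1 else 0 := by
  have h : proj z (e y) = (inner ℂ (e z : L2 X) (e y)) • (e z : L2 X) := by
    simp [proj, InnerProductSpace.rankOne_apply]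
  rw [ker, h, inner_e_left]
  simp only [lp.coeFn_smul, Pi.smul_apply, e_apply, smul_eq_mul]
  by_cases h1 : x = z <;> by_cases h2 : y = z <;> simp [h1, h2, eq_comm]
  exact fun h => absurd h.symm h2

theorem norm_proj_le {X : Type} (z : X) : ‖proj z‖ ≤ 1 := by
  simp [proj, InnerProductSpace.norm_rankOne, norm_e]

section

open scoped Classical

theorem ker_matrixUnit (j k m n : ℕ) :
    ker (Sstar ^ j * proj 0 * S ^ k) m n = if m = j ∧ n = k then 1 else 0 := by
  change ker (push Nat.succ Nat.succ_injective ^ j * proj 0 * S ^ k) m n = _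
  rw [S_eq]
  by_cases hn : k ≤ n
  · obtain ⟨n, rfl⟩ := Nat.exists_eq_add_of_le' hn
    have e1 := ker_mul_adjoint_pow Nat.succ Nat.succ_injective
      (push Nat.succ Nat.succ_injective ^ j * proj 0) k m n
    rw [succ_iterate'] at e1
    rw [e1]
    by_cases hm : j ≤ m
    · obtain ⟨m, rfl⟩ := Nat.exists_eq_add_of_le' hm
      have e2 := ker_push_pow_mul Nat.succ Nat.succ_injective (proj 0) j m n
      rw [succ_iterate'] at e2
      rw [e2, ker_proj]
      simp
    · rw [ker_push_pow_mul_zero _ _ _ _ _ _ (by intro z; rw [succ_iterate']; omega), if_neg]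
      omega
  · rw [ker_mul_adjoint_pow_zero _ _ _ _ _ _ (by intro z; rw [succ_iterate']; omega), if_neg]
    omega

theorem ker_matrixUnit_tensor {X : Type} (a : Op X) (j k : ℕ) (p q : ℕ × X) :
    ker (ContinuousLinearMap.adjoint (alpha X) ^ j * tensor (proj 0) a * alpha X ^ k) p q =
      if p.1 = j ∧ q.1 = k then ker a p.2 q.2 else 0 := by
  rw [adjoint_alpha_eq, alpha_eq]
  obtain ⟨m, x⟩ := p
  obtain ⟨n, y⟩ := q
  by_cases hn : k ≤ n
  · obtain ⟨n, rfl⟩ := Nat.exists_eq_add_of_le' hn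
    have e1 := ker_mul_adjoint_pow (succFst X) (succFst_inj X)
      (push (succFst X) (succFst_inj X) ^ j * tensor (proj 0) a) k (m, x) (n, y)
    rw [succFst_iterate] at e1
    rw [e1]
    by_cases hm : j ≤ m
    · obtain ⟨m, rfl⟩ := Nat.exists_eq_add_of_le' hm
      have e2 := ker_push_pow_mul (succFst X) (succFst_inj X) (tensor (proj 0) a) j (m, x) (n, y)
      rw [succFst_iterate] at e2
      rw [e2, ker_tensor, ker_proj]
      simp
    · rw [ker_push_pow_mul_zero _ _ _ _ _ _ (by
        intro z h
        rw [succFst_iterate] at h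
        have := congrArg Prod.fst h
        simp only at this
        omega), if_neg]
      simp only
      omega
  · rw [ker_mul_adjoint_pow_zero _ _ _ _ _ _ (by
        intro z h
        rw [succFst_iterate] at h
        have := congrArg Prod.fst h
        simp only at this
        omega), if_neg]
    simp only
    omega

theorem ker_twoSided_S (n : ℤ) (j k : ℕ) :
    ker (twoSided S n) j k = if (k : ℤ) - j = n then 1 else 0 := by
  unfold twoSided
  split_ifs with hn h h
  · rw [S_eq, ker_adjoint_pow, succ_iterate', if_pos]; omega
  · rw [S_eq, ker_adjoint_pow, succ_iterate', if_neg]; omega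
  · rw [S_eq, ContinuousLinearMap.adjoint_adjoint, ker_push_pow, succ_iterate', if_pos]; omega
  · rw [S_eq, ContinuousLinearMap.adjoint_adjoint, ker_push_pow, succ_iterate', if_neg]; omega

theorem ker_twoSided_alpha (X : Type) (n : ℤ) (p q : ℕ × X) :
    ker (twoSided (alpha X) n) p q = if (q.1 : ℤ) - p.1 = n ∧ p.2 = q.2 then 1 else 0 := by
  obtain ⟨j, x⟩ := p
  obtain ⟨k, y⟩ := q
  unfold twoSided
  by_cases hn : 0 ≤ n
  · rw [if_pos hn, alpha_eq, ker_adjoint_pow, succFst_iterate]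
    have h : ((j + n.toNat, x) = (k, y)) = ((k : ℤ) - j = n ∧ x = y) := by
      rw [Prod.mk.injEq]
      exact propext (and_congr (by omega) Iff.rfl)
    simp only [h]
  · rw [if_neg hn, adjoint_alpha_eq, ker_push_pow, succFst_iterate]
    have h : ((j, x) = (k + (-n).toNat, y)) = ((k : ℤ) - j = n ∧ x = y) := by
      rw [Prod.mk.injEq]
      exact propext (and_congr (by omega) Iff.rfl)
    simp only [h]

theorem ker_twoSided_bz (n x y : ℤ) : ker (twoSided bz n) x y = if x - y = n then 1 else 0 := by
  have hit : ∀ (k : ℕ) (x : ℤ), (fun k : ℤ => k + 1)^[k] x = x + k := by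
    intro k x
    induction k with
    | zero => simp
    | succ k ih => rw [Function.iterate_succ_apply', ih]; push_cast; ring
  unfold twoSided bz
  by_cases hn : 0 ≤ n
  · rw [if_pos hn, ker_push_pow, hit]
    have h : (x = y + n.toNat) = (x - y = n) := propext (by omega)
    simp only [h]
  · rw [if_neg hn, ker_adjoint_pow, hit]
    have h : (x + (-n).toNat = y) = (x - y = n) := propext (by omega)
    simp only [h]

end

theorem norm_twoSided_le {X : Type} (T : Op X) (h : ∀ k : ℕ, ‖T ^ k‖ ≤ 1)
    (h' : ∀ k : ℕ, ‖ContinuousLinearMap.adjoint T ^ k‖ ≤ 1) (n : ℤ) : ‖twoSided T n‖ ≤ 1 := by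
  unfold twoSided
  split_ifs
  · exact h _
  · exact h' _

theorem norm_twoSided_S_le (n : ℤ) : ‖twoSided S n‖ ≤ 1 := by
  refine norm_twoSided_le S (fun k => ?_) (fun k => ?_) n
  · rw [S_eq]; exact norm_pow_adjoint_le _ _ k
  · rw [S_eq, ContinuousLinearMap.adjoint_adjoint]; exact norm_pow_push_le _ _ k

theorem norm_twoSided_alpha_le (X : Type) (n : ℤ) : ‖twoSided (alpha X) n‖ ≤ 1 := by
  refine norm_twoSided_le _ (fun k => ?_) (fun k => ?_) n
  · rw [alpha_eq]; exact norm_pow_adjoint_le _ _ k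
  · rw [adjoint_alpha_eq]; exact norm_pow_push_le _ _ k

theorem norm_twoSided_bz_le (n : ℤ) : ‖twoSided bz n‖ ≤ 1 :=
  norm_twoSided_le bz (fun k => norm_pow_push_le _ _ k) (fun k => norm_pow_adjoint_le _ _ k) n

theorem enorm_matrixUnit_le (j k : ℕ) : ‖Sstar ^ j * proj 0 * S ^ k‖ₑ ≤ 1 := by
  have h1 : ‖(1 : ℂ)‖ₑ = 1 := by simp
  rw [← h1, enorm_le_iff_norm_le, norm_one]
  refine (norm_mul_le _ _).trans (mul_le_one₀ ((norm_mul_le _ _).trans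
    (mul_le_one₀ (norm_pow_push_le _ _ j) (norm_nonneg _) (norm_proj_le 0))) (norm_nonneg _) ?_)
  exact norm_pow_adjoint_le _ _ k

theorem enorm_matrixUnit_tensor_le {X : Type} (a : Op X) (j k : ℕ) :
    ‖ContinuousLinearMap.adjoint (alpha X) ^ j * tensor (proj 0) a * alpha X ^ k‖ₑ ≤ ‖a‖ₑ := by
  rw [enorm_le_iff_norm_le, adjoint_alpha_eq, alpha_eq]
  have h1 : ‖tensor (proj (0 : ℕ)) a‖ ≤ ‖a‖ := by
    refine (norm_tensor_le _ _).trans ?_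
    exact mul_le_of_le_one_left (norm_nonneg _) (norm_proj_le 0)
  have h2 : ‖push (succFst X) (succFst_inj X) ^ j * tensor (proj 0) a‖ ≤ ‖a‖ :=
    (norm_mul_le _ _).trans ((mul_le_of_le_one_left (norm_nonneg _) (norm_pow_push_le _ _ j)).trans h1)
  exact (norm_mul_le _ _).trans
    ((mul_le_of_le_one_right (norm_nonneg _) (norm_pow_adjoint_le _ _ k)).trans h2)

open scoped Classical in
-- At a given entry each of the two series has at most one nonzero term. The index of `c` is column
-- minus row because `α₁` lowers the first coordinate.
theorem IsToeplitzRep.ker_eq {X : Type} {A : FrechetOps ℕ X} {T : Op (ℕ × X)}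
    {a : ℕ × ℕ → Op X} {c : ℤ → ℂ} (h : IsToeplitzRep A T a c) (p q : ℕ × X) :
    ker T p q = ker (a (p.1, q.1)) p.2 q.2 +
      if p.2 = q.2 then c ((q.1 : ℤ) - p.1) else 0 := by
  obtain ⟨-, -, -, T₁, T₂, h₁, h₂, rfl⟩ := h
  rw [ker_add]
  congr 1
  · refine (hasSum_ker h₁ p q).unique ?_
    simp only [ker_matrixUnit_tensor]
    convert hasSum_single (p.1, q.1) ?_ using 1
    · simp
    · rintro ⟨j, k⟩ hjk
      rw [if_neg]
      rintro ⟨rfl, rfl⟩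
      exact hjk rfl
  · refine (hasSum_ker h₂ p q).unique ?_
    simp only [ker_smul, ker_twoSided_alpha]
    convert hasSum_single ((q.1 : ℤ) - p.1) ?_ using 1
    · by_cases h : p.2 = q.2 <;> simp [h]
    · intro n hn
      rw [if_neg, mul_zero]
      exact fun h => hn h.1.symm

theorem IsTRep.ker_eq {T : Op ℕ} {a : ℕ × ℕ → ℂ} {c : ℤ → ℂ} (h : IsTRep T a c) (j k : ℕ) :
    ker T j k = a (j, k) + c ((k : ℤ) - j) := by
  classical
  obtain ⟨-, -, T₁, T₂, h₁, h₂, rfl⟩ := h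
  rw [ker_add]
  congr 1
  · refine (hasSum_ker h₁ j k).unique ?_
    simp only [ker_smul, ker_matrixUnit]
    convert hasSum_single (j, k) ?_ using 1
    · simp
    · rintro ⟨m, n⟩ hmn
      rw [if_neg, mul_zero]
      rintro ⟨rfl, rfl⟩
      exact hmn rfl
  · refine (hasSum_ker h₂ j k).unique ?_
    simp only [ker_smul, ker_twoSided_S]
    convert hasSum_single ((k : ℤ) - j) ?_ using 1
    · simp
    · intro n hn
      rw [if_neg (Ne.symm hn), mul_zero]

theorem IsCircleRep.ker_eq {T : Op ℤ} {c : ℤ → ℂ} (h : IsCircleRep T c) (x y : ℤ) :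
    ker T x y = c (x - y) := by
  classical
  refine (hasSum_ker h.2 x y).unique ?_
  simp only [ker_smul, ker_twoSided_bz]
  convert hasSum_single (x - y) ?_ using 1
  · simp
  · intro n hn
    rw [if_neg (Ne.symm hn), mul_zero]

end QSphere

end

noncomputable section

namespace QSphere

/-! ### Estimates for the entries of the members of `𝒜_ℓ^∞` -/

theorem rapidZ_mono (c : ℤ → ℂ) {m M : ℕ} (h : m ≤ M) : rapidZ c m ≤ rapidZ c M := by
  refine ENNReal.tsum_le_tsum fun k => ?_
  gcongr
  exact le_self_add

theorem rapidZ_single (c : ℤ → ℂ) (m : ℕ) (k : ℤ) : wt k.natAbs ^ m * ‖c k‖ₑ ≤ rapidZ c m :=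
  ENNReal.le_tsum k

theorem rapidNN_single {X : Type} (A : FrechetOps ℕ X) (a : ℕ × ℕ → Op X) (r s j k : ℕ) :
    wt (j + k) ^ r * A.seminorm s (a (j, k)) ≤ rapidNN A a r s := by
  refine le_trans (le_of_eq ?_) (ENNReal.le_tsum (j, k))
  simp only [wt, Nat.cast_add, add_assoc]

theorem rapidNN_le_sup {X : Type} (A : FrechetOps ℕ X) (a : ℕ × ℕ → Op X) {r s M : ℕ} (hr : r ≤ M)
    (hs : s ≤ M) : rapidNN A a r s ≤
      ⨆ r ∈ Finset.range (M + 1), ⨆ s ∈ Finset.range (M + 1), rapidNN A a r s :=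
  le_iSup₂_of_le r (Finset.mem_range.2 (by omega))
    (le_iSup₂_of_le s (Finset.mem_range.2 (by omega)) le_rfl)

/-- `N` is bounded by a multiple of one of the seminorms. -/
def Ctrl {ι X : Type} (A : FrechetOps ι X) (N : Op X → ℝ≥0∞) : Prop :=
  ∃ (C : NNReal) (M : ι), C ≠ 0 ∧ ∀ T, N T ≤ C * A.seminorm M T

/-- Seminorms here are infima over representations, and a constant can be moved inside an infimum
once it is finite and nonzero; hence the requirement `C ≠ 0` in `Ctrl` and the added `1`. -/
theorem Ctrl.mk' {ι X : Type} {A : FrechetOps ι X} {N : Op X → ℝ≥0∞} (C : NNReal) (M : ι)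
    (h : ∀ T, N T ≤ C * A.seminorm M T) : Ctrl A N :=
  ⟨C + 1, M, by positivity, fun T => (h T).trans (by gcongr; exact le_self_add)⟩

theorem Ctrl.mono {ι X : Type} {A : FrechetOps ι X} {N N' : Op X → ℝ≥0∞} (h : Ctrl A N)
    (h' : ∀ T, N' T ≤ N T) : Ctrl A N' := by
  obtain ⟨C, M, h0, h⟩ := h
  exact ⟨C, M, h0, fun T => (h' T).trans (h T)⟩

theorem Ctrl.const_mul {ι X : Type} {A : FrechetOps ι X} {N : Op X → ℝ≥0∞} (h : Ctrl A N)
    (B : NNReal) : Ctrl A (fun T => B * N T) := by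
  obtain ⟨C, M, h0, h⟩ := h
  refine Ctrl.mk' (B * C) M fun T => ?_
  rw [ENNReal.coe_mul, mul_assoc]
  gcongr
  exact h T

theorem Ctrl.ne_top {ι X : Type} {A : FrechetOps ι X} {N : Op X → ℝ≥0∞} (h : Ctrl A N) {T : Op X}
    (hT : ∀ M, A.seminorm M T ≠ ⊤) : N T ≠ ⊤ := by
  obtain ⟨C, M, -, h⟩ := h
  exact ne_top_of_le_ne_top (ENNReal.mul_ne_top ENNReal.coe_ne_top (hT M)) (h T)

/-- Bounds for representations yield bounds by the seminorms of `smoothToeplitz`. -/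
theorem ctrl_smoothToeplitz {X : Type} {A : FrechetOps ℕ X} {N : Op (ℕ × X) → ℝ≥0∞} (C : NNReal)
    (m s : ℕ) (h : ∀ T a c, IsToeplitzRep A T a c → N T ≤ C * (rapidNN A a m s + rapidZ c m)) :
    Ctrl (smoothToeplitz A) N := by
  refine ⟨C + 1, max m s, by positivity, fun T => ?_⟩
  have h0 : ((C + 1 : NNReal) : ℝ≥0∞) ≠ 0 := by simp
  simp only [smoothToeplitz]
  simp_rw [ENNReal.mul_iInf_of_ne h0 ENNReal.coe_ne_top]
  refine le_iInf fun a => le_iInf fun c => le_iInf fun hr => (h T a c hr).trans ?_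
  gcongr
  · exact le_self_add
  · exact rapidNN_le_sup _ _ (le_max_left _ _) (le_max_right _ _)
  · exact rapidZ_mono _ (le_max_left _ _)

theorem smoothToeplitz_seminorm_ne_top {X : Type} {A : FrechetOps ℕ X} {T : Op (ℕ × X)}
    (hT : T ∈ (smoothToeplitz A).carrier) (M : ℕ) : (smoothToeplitz A).seminorm M T ≠ ⊤ := by
  obtain ⟨a, c, h⟩ := hT
  refine ne_top_of_le_ne_top ?_ (iInf_le_of_le a (iInf_le_of_le c (iInf_le _ h)))
  refine ENNReal.add_ne_top.2 ⟨?_, (h.2.2.1 M).ne⟩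
  rw [← lt_top_iff_ne_top]
  simp only [← Finset.sup_eq_iSup, Finset.sup_lt_iff ENNReal.zero_lt_top]
  exact fun r _ s _ => h.2.1 r s

theorem smoothA_seminorm_ne_top {n : ℕ} {T : Op (Idx n)} (hT : T ∈ (smoothA n).carrier) (M : ℕ) :
    (smoothA n).seminorm M T ≠ ⊤ := by
  cases n with
  | zero =>
    obtain ⟨c, h⟩ := hT
    exact ne_top_of_le_ne_top (h.1 M).ne (iInf_le_of_le c (iInf_le _ h))
  | succ n => exact smoothToeplitz_seminorm_ne_top hT M

section Step

variable {n m s : ℕ} {A : NNReal} {w : Idx n → ℕ} {W : Idx (n + 1) → ℕ}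
  {Φ : Op (Idx n) → Ker (Idx n)}

/-- The contributions `|j - k| + j ≤ 2 (j + k)` of the first coordinate to distance and weight are
paid by the decay of the coefficients in `j + k`, the rest by the estimate for a single coefficient.
The offset `e` is used with the values `0` and `1`, since a difference in the first coordinate also
involves the coefficient at `(j + 1, k + 1)`. -/
theorem toeplitz_entry_le (hW : ∀ p, W p ≤ p.1 + w p.2)
    (h : ∀ T, (gridI n).pn w m (Φ T) ≤ A * (smoothA n).seminorm s T)
    (a : ℕ × ℕ → Op (Idx n)) (e : ℕ) (p q : Idx (n + 1)) :
    wt ((gridI (n + 1)).d p q + W p) ^ m * ‖Φ (a (p.1 + e, q.1 + e)) p.2 q.2‖ₑ ≤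
      wt 2 ^ m * A * rapidNN (smoothA n) a m s := by
  obtain ⟨j, x⟩ := p
  obtain ⟨k, y⟩ := q
  have h1 := hW (j, x)
  simp only at h1 ⊢
  calc wt ((gridI (n + 1)).d (j, x) (k, y) + W (j, x)) ^ m * ‖Φ (a (j + e, k + e)) x y‖ₑ
      ≤ (wt 2 * wt ((j + e) + (k + e)) * wt ((gridI n).d x y + w x)) ^ m *
          ‖Φ (a (j + e, k + e)) x y‖ₑ := by
        gcongr
        refine (wt_mono ?_).trans ((wt_add_le (((j : ℤ) - k).natAbs + j)
          ((gridI n).d x y + w x)).trans (mul_le_mul_left (wt_le_mul ?_) _))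
        · rw [gridI_d_succ]
          simp only
          omega
        · omega
    _ = wt 2 ^ m * (wt ((j + e) + (k + e)) ^ m *
          (wt ((gridI n).d x y + w x) ^ m * ‖Φ (a (j + e, k + e)) x y‖ₑ)) := by ring
    _ ≤ wt 2 ^ m * (wt ((j + e) + (k + e)) ^ m * (A * (smoothA n).seminorm s (a (j + e, k + e)))) := by
        refine mul_le_mul_right (mul_le_mul_right ?_ _) _
        exact le_trans (le_iSup (fun p : Idx n × Idx n =>
          wt ((gridI n).d p.1 p.2 + w p.1) ^ m * ‖Φ (a (j + e, k + e)) p.1 p.2‖ₑ) (x, y)) (h _)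
    _ = wt 2 ^ m * A * (wt ((j + e) + (k + e)) ^ m * (smoothA n).seminorm s (a (j + e, k + e))) := by
        ring
    _ ≤ _ := by
        gcongr
        exact rapidNN_single _ _ _ _ _ _

/-- The common induction step for `off` and `grad`: both remove the scalar Toeplitz part, so that
their entries are bounded through the coefficients `a_{jk}` and `a_{j+1,k+1}` alone. -/
theorem ctrl_toeplitz_step (hW : ∀ p, W p ≤ p.1 + w p.2)
    (h : Ctrl (smoothA n) fun T => (gridI n).pn w m (Φ T))
    {Ψ : Op (Idx (n + 1)) → Ker (Idx (n + 1))}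
    (hΨ : ∀ T a c, IsToeplitzRep (smoothA n) T a c → ∀ p q : Idx (n + 1),
      ‖Ψ T p q‖ₑ ≤ ‖Φ (a (p.1, q.1)) p.2 q.2‖ₑ + ‖Φ (a (p.1 + 1, q.1 + 1)) p.2 q.2‖ₑ) :
    Ctrl (smoothA (n + 1)) fun T => (gridI (n + 1)).pn W m (Ψ T) := by
  obtain ⟨A, s, -, h⟩ := h
  refine ctrl_smoothToeplitz (2 * ((3 : ℕ) ^ m * A)) m s fun T a c hr => iSup_le fun p => ?_
  have h2 : ((2 * ((3 : ℕ) ^ m * A) : NNReal) : ℝ≥0∞) = wt 2 ^ m * A + wt 2 ^ m * A := by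
    rw [wt_eq, ← two_mul]; push_cast; norm_num
  refine le_trans (mul_le_mul_right (hΨ T a c hr p.1 p.2) _) ?_
  rw [mul_add, h2]
  refine le_trans (add_le_add (toeplitz_entry_le hW h a 0 p.1 p.2)
    (toeplitz_entry_le hW h a 1 p.1 p.2)) ?_
  rw [← add_mul]
  gcongr
  exact le_self_add

end Step

theorem smoothA_ctrl (n m : ℕ) : Ctrl (smoothA n) fun T => (gridI n).pn 0 m (ker T) := by
  classical
  induction n with
  | zero =>
    refine ⟨1, m, one_ne_zero, fun T => ?_⟩
    rw [ENNReal.coe_one, one_mul]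
    refine le_iInf fun c => le_iInf fun h => iSup_le fun p => ?_
    rw [h.ker_eq]
    refine le_trans (le_of_eq ?_) (rapidZ_single c m (p.1 - p.2))
    simp [gridI, Grid.d, Grid.intGrid]
  | succ n ih =>
    obtain ⟨A, s, -, h⟩ := ih
    refine ctrl_smoothToeplitz ((3 : ℕ) ^ m * A + 1) m s fun T a c hr => iSup_le fun p => ?_
    have h2 : (((3 : ℕ) ^ m * A + 1 : NNReal) : ℝ≥0∞) = wt 2 ^ m * A + 1 := by
      rw [wt_eq]; push_cast; norm_num
    rw [hr.ker_eq, h2]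
    refine le_trans (mul_le_mul_right (enorm_add_le _ _) _) ?_
    rw [mul_add]
    refine (add_le_add (toeplitz_entry_le (W := 0) (w := 0) (fun _ => Nat.zero_le _) h a 0 p.1 p.2)
      (?_ : _ ≤ rapidZ c m)).trans ?_
    · split_ifs with hxy
      · refine le_trans (le_of_eq ?_) (rapidZ_single c m ((p.2.1 : ℤ) - p.1.1))
        rw [gridI_d_succ, hxy, Grid.d_self, Pi.zero_apply, add_zero, add_zero]
        congr 3
        omega
      · simp
    · rw [add_mul, mul_add]
      refine add_le_add le_self_add ?_
      rw [one_mul]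
      exact le_add_self

/-- The scalar Toeplitz part does not change the later coordinates, so a change of one of them comes
from some `a_{jk}`, with decay in `j + k`. For the first coordinate the weight is zero and the decay
in the distance suffices. -/
theorem smoothA_ctrl_off (n m : ℕ) (i : IdxDir n) :
    Ctrl (smoothA n) fun T => (gridI n).pn (pre n i) m ((gridI n).off i (ker T)) := by
  classical
  have hz : ∀ n i, Ctrl (smoothA n) fun T => (gridI n).pn 0 m ((gridI n).off i (ker T)) := fun n i =>
    (smoothA_ctrl n m).mono fun T => iSup_mono fun p => by gcongr; exact Grid.off_off_le _ _ _ _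
  induction n with
  | zero => exact hz 0 i
  | succ n ih =>
    cases i with
    | inl i => exact hz (n + 1) (Sum.inl i)
    | inr i =>
      refine ctrl_toeplitz_step (w := pre n i) (fun p => le_rfl) (ih i) fun T a c hr p q => ?_
      refine le_trans (le_of_eq ?_) le_self_add
      simp only [Grid.off]
      have hc : ∀ p : Idx (n + 1), (gridI (n + 1)).c p (Sum.inr i) = (gridI n).c p.2 i := fun _ => rfl
      rw [hc, hc, hr.ker_eq]
      by_cases h1 : (gridI n).c p.2 i = (gridI n).c q.2 i
      · simp only [if_pos h1]
      · have h2 : p.2 ≠ q.2 := fun e => h1 (by rw [e])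
        simp only [if_neg h1, if_neg h2, add_zero]

/-- A diagonal difference cancels the scalar Toeplitz part, which depends only on `k - j` and on the
equality of the later coordinates. In the first direction `a_{j+1,k+1} - a_{jk}` remains, with decay
in `j + k`; in a later one the difference acts on `a_{jk}`. -/
theorem smoothA_ctrl_grad (n m : ℕ) (i : IdxDir n) (hi : (gridI n).nat i) :
    Ctrl (smoothA n) fun T => (gridI n).pn (pre n i ⊔ (gridI n).u i) m ((gridI n).grad i (ker T)) := by
  classical
  induction n with
  | zero => exact hi.elim
  | succ n ih =>
    cases i with
    | inl i =>
      refine ctrl_toeplitz_step (w := 0) (fun p => ?_) (smoothA_ctrl n m) fun T a c hr p q => ?_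
      · exact max_le (Nat.zero_le _) le_rfl
      · simp only [Grid.grad]
        have hs : ∀ p : Idx (n + 1), (gridI (n + 1)).s (Sum.inl i) p = (p.1 + 1, p.2) := fun _ => rfl
        rw [hs, hs, hr.ker_eq, hr.ker_eq]
        have h1 : ((q.1 + 1 : ℕ) : ℤ) - ((p.1 + 1 : ℕ) : ℤ) = (q.1 : ℤ) - p.1 := by push_cast; ring
        rw [h1, add_sub_add_right_eq_sub, add_comm ‖ker (a (p.1, q.1)) p.2 q.2‖ₑ]
        exact enorm_sub_le
    | inr i =>
      refine ctrl_toeplitz_step (w := pre n i ⊔ (gridI n).u i) (fun p => ?_) (ih i hi)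
        fun T a c hr p q => ?_
      · have : (gridI (n + 1)).u (Sum.inr i) p = (gridI n).u i p.2 := rfl
        simp only [Pi.sup_apply, this, pre]
        omega
      · refine le_trans (le_of_eq ?_) le_self_add
        simp only [Grid.grad]
        have hs : ∀ p : Idx (n + 1),
          (gridI (n + 1)).s (Sum.inr i) p = (p.1, (gridI n).s i p.2) := fun _ => rfl
        rw [hs, hs, hr.ker_eq, hr.ker_eq]
        simp only [((gridI n).s_inj i).eq_iff, add_sub_add_right_eq_sub]

/-- The last coordinate is acted on only by identities and by convolutions from `C^∞(𝕋)`, which are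
invariant under translation. -/
theorem smoothA_grad_zdir {n : ℕ} {T : Op (Idx n)} (hT : T ∈ (smoothA n).carrier) :
    (gridI n).grad (zdir n) (ker T) = 0 := by
  classical
  induction n with
  | zero =>
    obtain ⟨c, h⟩ := hT
    funext x y
    have hs : ∀ x : Idx 0, (gridI 0).s (zdir 0) x = (x + 1 : ℤ) := fun _ => rfl
    simp only [Grid.grad, hs, h.ker_eq, Pi.zero_apply]
    rw [add_sub_add_right_eq_sub (x : ℤ), sub_self]
  | succ n ih =>
    obtain ⟨a, c, h⟩ := hT
    funext p q
    have hs : ∀ p : Idx (n + 1),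
      (gridI (n + 1)).s (zdir (n + 1)) p = (p.1, (gridI n).s (zdir n) p.2) := fun _ => rfl
    have h1 := congrFun (congrFun (ih (h.1 (p.1, q.1))) p.2) q.2
    simp only [Grid.grad, Pi.zero_apply] at h1
    simp only [Grid.grad, hs, h.ker_eq, ((gridI n).s_inj _).eq_iff, add_sub_add_right_eq_sub,
      Pi.zero_apply]
    exact h1

/-- A single operator with finite norms gives a decaying family. -/
theorem dec_of_pn {X ι : Type} [Fintype ι] {g : Grid X ι} {w : X → ℕ} {t : Ker X}
    (h : ∀ m, g.pn w m t ≠ ⊤) : g.Dec (fun _ : Unit => w) (fun _ => t) := fun m =>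
  ⟨(g.pn w m t).toNNReal, fun p => by
    rw [ENNReal.coe_toNNReal (h m)]
    exact le_iSup (fun q : X × X => wt (g.d q.1 q.2 + w q.1) ^ m * ‖t q.1 q.2‖ₑ) p.2⟩

/-- The operator norm is controlled by `pn`. -/
theorem enorm_le_pn {X ι : Type} [Fintype ι] (g : Grid X ι) :
    ∃ (N : ℕ) (B : NNReal), ∀ T : Op X, ‖T‖ₑ ≤ B * g.pn 0 N (ker T) := by
  obtain ⟨N, B, hB⟩ := g.tsum_wt_d
  refine ⟨N, B, fun T => ?_⟩
  have h0 : ∀ x y, ‖ker T x y‖ₑ ≤ (wt (g.d x y) ^ N)⁻¹ * g.pn 0 N (ker T) := fun x y =>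
    le_inv_wt_mul (le_iSup (fun q : X × X => wt (g.d q.1 q.2 + 0) ^ N * ‖ker T q.1 q.2‖ₑ) (x, y))
  refine enorm_le_of_schur _ _ (fun x => ?_) (fun y => ?_)
  · refine (ENNReal.tsum_le_tsum fun y => h0 x y).trans ?_
    rw [ENNReal.tsum_mul_right]
    gcongr
    exact hB x
  · refine (ENNReal.tsum_le_tsum fun x => h0 x y).trans ?_
    rw [ENNReal.tsum_mul_right]
    gcongr
    simpa only [g.d_comm y] using hB y

theorem smoothA_ctrl_norm (n : ℕ) : Ctrl (smoothA n) fun T => ‖T‖ₑ := by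
  obtain ⟨N, B, h⟩ := enorm_le_pn (gridI n)
  exact ((smoothA_ctrl n N).const_mul B).mono h

end QSphere

end

noncomputable section

namespace QSphere

/-! ### Construction of members of `𝒜_ℓ^∞` from estimates for the entries -/

section Laurent

variable {K : Type} {ω : K → ℕ} {c : K → ℤ → ℂ}

theorem rapid_rapidZ (h : Rapid (fun p : K × ℤ => ω p.1 + p.2.natAbs) (fun p => ‖c p.1 p.2‖ₑ))
    (m : ℕ) : Rapid ω (fun k => rapidZ (c k) m) :=
  (h.mul_wt (σ := fun p => p.2.natAbs) (fun _ => Nat.le_add_left _ _) m).tsum_weight exists_tsum_int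
    fun _ _ => le_rfl

theorem summable_laurent {X : Type} {c : ℤ → ℂ} (hc : rapidZ c 0 < ⊤) {U : ℤ → Op X}
    (hU : ∀ n, ‖U n‖ ≤ 1) : Summable fun n => c n • U n := by
  refine summable_of_tsum_enorm (ne_top_of_le_ne_top hc.ne (ENNReal.tsum_le_tsum fun n => ?_))
  rw [pow_zero, one_mul, enorm_le_iff_norm_le, norm_smul]
  exact mul_le_of_le_one_right (norm_nonneg _) (hU n)

end Laurent

section Matrix

variable {K : Type} {ω : K → ℕ}

theorem rapid_tsum_matrix {f : K × ℕ × ℕ → ℝ≥0∞}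
    (h : Rapid (fun p : K × ℕ × ℕ => ω p.1 + (p.2.1 + p.2.2)) f) (r : ℕ) :
    Rapid ω (fun k => ∑' p : ℕ × ℕ, (1 + (p.1 : ℝ≥0∞) + p.2) ^ r * f (k, p)) := by
  have h1 := (h.mul_wt (σ := fun p => p.2.1 + p.2.2) (fun _ => Nat.le_add_left _ _) r).tsum_weight
    (ρ := ω) (exists_tsum_prod exists_tsum_nat exists_tsum_nat) fun _ _ => le_rfl
  refine h1.mono fun k => le_of_eq (tsum_congr fun p => ?_)
  simp only [wt, Nat.cast_add, add_assoc]

end Matrix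

/-- A function on `ℤ` read off from an invariant kernel on `ℕ`. -/
def symbolOf (t : Ker ℕ) (n : ℤ) : ℂ := t (-n).toNat n.toNat

theorem eq_symbolOf {t : Ker ℕ} (h : Grid.natGrid.grad () t = 0) (j k : ℕ) :
    t j k = symbolOf t ((k : ℤ) - j) := by
  have hs : ∀ N n : ℕ, (Grid.natGrid.s ())^[N] n = n + N := fun N n => Nat.succ_iterate n N
  have h1 := Grid.eq_iterate_of_grad h (min j k) (-((k : ℤ) - j)).toNat ((k : ℤ) - j).toNat
  rw [hs, hs] at h1
  have h2 : (-((k : ℤ) - j)).toNat + min j k = j := by omega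
  have h3 : ((k : ℤ) - j).toNat + min j k = k := by omega
  rw [h2, h3] at h1
  exact h1

theorem circle_reconstruct {K : Type} {ω : K → ℕ} {t : K → Ker (Idx 0)}
    (h1 : (gridI 0).Dec (fun k _ => ω k) t) (h4 : ∀ k, (gridI 0).grad (zdir 0) (t k) = 0) :
    ∃ F : K → Op (Idx 0), (∀ k, F k ∈ (smoothA 0).carrier) ∧ (∀ k, ker (F k) = t k) ∧
      ∀ s, Rapid ω fun k => (smoothA 0).seminorm s (F k) := by
  have hd : ∀ x y : ℤ, (gridI 0).d x y = (x - y).natAbs := fun x y => by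
    simp [gridI, Grid.d, Grid.intGrid]
  set c : K → ℤ → ℂ := fun k n => t k n (0 : ℤ)
  have hc : Rapid (fun p : K × ℤ => ω p.1 + p.2.natAbs) (fun p => ‖c p.1 p.2‖ₑ) := by
    refine Rapid.of_le h1 (fun p => (p.1, p.2, (0 : ℤ))) 1 fun p _ => ⟨le_rfl, ?_⟩
    have := hd p.2 0
    simp only [this]
    omega
  have hf : ∀ k m, rapidZ (c k) m < ⊤ := fun k m => ((rapid_rapidZ hc m).ne_top k).lt_top
  have hs : ∀ k, Summable fun n => c k n • twoSided bz n := fun k =>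
    summable_laurent (hf k 0) norm_twoSided_bz_le
  have hr : ∀ k, IsCircleRep (∑' n, c k n • twoSided bz n) (c k) := fun k => ⟨hf k, (hs k).hasSum⟩
  refine ⟨fun k => ∑' n, c k n • twoSided bz n, fun k => ⟨c k, hr k⟩, fun k => ?_, fun s => ?_⟩
  · funext x y
    rw [(hr k).ker_eq]
    have := (gridI 0).const (fun z : ℤ => t k (((x : ℤ) - y) + z : ℤ) z) (fun i z => by
      have h := congrFun (congrFun (h4 k) (((x : ℤ) - y) + z : ℤ)) z
      refine Eq.trans ?_ (sub_eq_zero.1 h)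
      change t k (((x : ℤ) - y) + (z + 1) : ℤ) (z + 1 : ℤ) = t k (((x : ℤ) - y) + z + 1 : ℤ) (z + 1 : ℤ)
      rw [add_assoc]) (0 : ℤ) y
    simpa [c] using this
  · exact (rapid_rapidZ hc s).mono fun k => iInf_le_of_le (c k) (iInf_le _ (hr k))

/-- The estimates that characterise `𝒜_n^∞`, for families. -/
structure AFamily (n : ℕ) {K : Type} (ω : K → ℕ) (t : K → Ker (Idx n)) : Prop where
  dec : (gridI n).Dec (fun k _ => ω k) t
  off : ∀ i, (gridI n).Dec (fun k => (fun _ => ω k) ⊔ pre n i) (fun k => (gridI n).off i (t k))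
  grad : ∀ i, (gridI n).nat i →
    (gridI n).Dec (fun k => (fun _ => ω k) ⊔ (pre n i ⊔ (gridI n).u i))
      (fun k => (gridI n).grad i (t k))
  inv : ∀ k, (gridI n).grad (zdir n) (t k) = 0

namespace AFamily

variable {n : ℕ} {K : Type} {ω : K → ℕ} {t : K → Ker (Idx (n + 1))}

/-- The compact part in the first variable. -/
def cpt (t : K → Ker (Idx (n + 1))) (k : K) : Ker (Idx (n + 1)) :=
  (gridI (n + 1)).tail (Sum.inl ()) ((gridI (n + 1)).grad (Sum.inl ()) (t k))

theorem u_le_weight (ω : K → ℕ) (k : K) (x : Idx (n + 1)) : (gridI (n + 1)).u (Sum.inl ()) x ≤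
    ((fun _ => ω k) ⊔ (pre (n + 1) (Sum.inl ()) ⊔ (gridI (n + 1)).u (Sum.inl ())) :
      Idx (n + 1) → ℕ) x :=
  le_sup_of_le_right (le_sup_right (a := pre (n + 1) (Sum.inl ()) x))

theorem lip_weight (ω : K → ℕ) (k : K) : (gridI (n + 1)).Lip
    ((fun _ => ω k) ⊔ (pre (n + 1) (Sum.inl ()) ⊔ (gridI (n + 1)).u (Sum.inl ()))) :=
  (Grid.lip_const _ _).sup ((pre_lip _ _).sup (Grid.lip_u _ _))

variable (h : AFamily (n + 1) ω t)

include h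

theorem dec_cpt : (gridI (n + 1)).Dec (fun k => (fun _ => ω k) ⊔
    (pre (n + 1) (Sum.inl ()) ⊔ (gridI (n + 1)).u (Sum.inl ()))) (cpt t) :=
  (h.grad (Sum.inl ()) trivial).tail trivial (lip_weight ω) (u_le_weight ω)

theorem inv_sub (k : K) : (gridI (n + 1)).grad (Sum.inl ()) (t k - cpt t k) = 0 :=
  Grid.grad_sub_tail trivial (u_le_weight ω) (h.grad (Sum.inl ()) trivial) k

theorem dec_u_cpt : (gridI (n + 1)).Dec (fun _ : K => (gridI (n + 1)).u (Sum.inl ())) (cpt t) :=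
  h.dec_cpt.weight 1 fun k x => by have := u_le_weight ω k x; omega

/-- `t - cpt t` is invariant in the first direction. Its entries that change a later coordinate
decay in the first one, because `pre` of a later direction includes it and `cpt t` has this decay
throughout. An invariant kernel with such decay is zero. -/
theorem off_sub (i : IdxDir n) (k : K) :
    (gridI (n + 1)).off (Sum.inr i) (t k - cpt t k) = 0 := by
  refine Grid.Dec.eq_zero (i := Sum.inl ()) (W := fun _ : K => (gridI (n + 1)).u (Sum.inl ()))
    (t := fun k => (gridI (n + 1)).off (Sum.inr i) (t k - cpt t k)) trivial
    (fun _ _ => le_rfl) ?_ (fun k => ?_) k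
  · have h1 : (gridI (n + 1)).Dec (fun _ : K => (gridI (n + 1)).u (Sum.inl ()))
        (fun k => (gridI (n + 1)).off (Sum.inr i) (t k)) := by
      refine (h.off (Sum.inr i)).weight 1 fun k x => ?_
      rw [gridI_u_inl]
      simp only [Pi.sup_apply, pre]
      omega
    refine (h1.sub (h.dec_u_cpt.mono (t₁ := fun k => (gridI (n + 1)).off (Sum.inr i) (cpt t k))
      fun k => Grid.off_off_le (Sum.inr i) _)).mono fun k x y => le_of_eq ?_
    congr 1
    simp only [Grid.off, Pi.sub_apply]
    split_ifs <;> simp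
  · funext x y
    rw [← Grid.off_grad, h.inv_sub]
    simp [Grid.off]

/-- The same argument as for `off_sub`. In the direction of `ℤ` the differences of `t` vanish by
assumption, so the decay is there as well. -/
theorem grad_sub (i : IdxDir n) (k : K) :
    (gridI (n + 1)).grad (Sum.inr i) (t k - cpt t k) = 0 := by
  have h0 : (gridI (n + 1)).Dec (fun _ : K => (gridI (n + 1)).u (Sum.inl ()))
      (fun k => (gridI (n + 1)).grad (Sum.inr i) (t k)) := by
    by_cases hi : (gridI n).nat i
    · refine (h.grad (Sum.inr i) hi).weight 1 fun k x => ?_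
      rw [gridI_u_inl]
      simp only [Pi.sup_apply, pre]
      omega
    · have : i = zdir n := by
        by_contra h
        exact hi (nat_of_ne_zdir n i h)
      subst this
      have h5 : ∀ k, (gridI (n + 1)).grad (Sum.inr (zdir n)) (t k) = 0 := h.inv
      simp only [h5]
      exact Grid.dec_zero
  refine Grid.Dec.eq_zero (i := Sum.inl ()) (W := fun _ : K => (gridI (n + 1)).u (Sum.inl ()))
    (t := fun k => (gridI (n + 1)).grad (Sum.inr i) (t k - cpt t k)) trivial
    (fun _ _ => le_rfl) ?_ (fun k => ?_) k
  · simp only [Grid.grad_sub]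
    refine h0.sub ?_
    exact (h.dec_u_cpt.shift (fun _ => Grid.lip_u _ _) (Sum.inr i)).sub h.dec_u_cpt
  · have h1 := h.inv_sub k
    have h2 : ∀ x y, (t k - cpt t k) ((gridI (n + 1)).s (Sum.inl ()) x)
        ((gridI (n + 1)).s (Sum.inl ()) y) = (t k - cpt t k) x y := fun x y =>
      sub_eq_zero.1 (congrFun (congrFun h1 x) y)
    funext x y
    have hne : (Sum.inr i : IdxDir (n + 1)) ≠ Sum.inl () := Sum.inr_ne_inl
    simp only [Grid.grad]
    rw [(gridI (n + 1)).s_comm hne, (gridI (n + 1)).s_comm hne, h2, h2]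
    simp

theorem off_cpt (i : IdxDir n) (k : K) :
    (gridI (n + 1)).off (Sum.inr i) (cpt t k) = (gridI (n + 1)).off (Sum.inr i) (t k) := by
  funext x y
  have h1 := congrFun (congrFun (h.off_sub i k) x) y
  simp only [Grid.off, Pi.sub_apply, Pi.zero_apply] at h1 ⊢
  split_ifs at h1 ⊢ with h2
  · rfl
  · exact (sub_eq_zero.1 h1).symm

theorem grad_cpt (i : IdxDir n) (k : K) :
    (gridI (n + 1)).grad (Sum.inr i) (cpt t k) = (gridI (n + 1)).grad (Sum.inr i) (t k) := by
  have h1 := h.grad_sub i k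
  rw [Grid.grad_sub, sub_eq_zero] at h1
  exact h1.symm

/-- By `off_cpt` and `grad_cpt` the compact part inherits the weights of `t` in the later
directions. Fixing the first coordinates `j` and `k` moves them into the parameter: `j + k ≤ |j - k|
+ 2 j` turns decay in the distance and in `j` into decay in `j + k`. -/
theorem slices : AFamily n (fun p : K × ℕ × ℕ => ω p.1 + (p.2.1 + p.2.2))
    (fun p x y => cpt t p.1 (p.2.1, x) (p.2.2, y)) where
  dec := by
    refine Rapid.of_le h.dec_cpt (fun p => (p.1.1, (p.1.2.1, p.2.1), (p.1.2.2, p.2.2))) 3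
      fun p _ => ⟨le_rfl, ?_⟩
    simp only [Pi.sup_apply]
    rw [gridI_d_succ, gridI_u_inl]
    simp only
    omega
  off i := by
    refine Rapid.of_le (h.off (Sum.inr i)) (fun p => (p.1.1, (p.1.2.1, p.2.1), (p.1.2.2, p.2.2))) 3
      fun p _ => ⟨?_, ?_⟩
    · dsimp only
      rw [← h.off_cpt]
      exact le_of_eq rfl
    · simp only [Pi.sup_apply, pre]
      rw [gridI_d_succ]
      simp only
      omega
  grad i hi := by
    refine Rapid.of_le (h.grad (Sum.inr i) hi)
      (fun p => (p.1.1, (p.1.2.1, p.2.1), (p.1.2.2, p.2.2))) 3 fun p _ => ⟨?_, ?_⟩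
    · dsimp only
      rw [← h.grad_cpt]
      exact le_of_eq rfl
    · have : ∀ x, (gridI (n + 1)).u (Sum.inr i) x = (gridI n).u i x.2 := fun _ => rfl
      simp only [Pi.sup_apply, pre, this]
      rw [gridI_d_succ]
      simp only
      omega
  inv p := by
    have h1 : ∀ k, (gridI (n + 1)).grad (Sum.inr (zdir n)) (t k) = 0 := h.inv
    have h2 := h.grad_cpt (zdir n) p.1
    rw [h1] at h2
    funext x y
    exact congrFun (congrFun h2 (p.2.1, x)) (p.2.2, y)

open scoped Classical in
-- What is left after the compact part is removed neither changes the later coordinates nor depends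
-- on them, so it is a scalar Toeplitz matrix in the first coordinate, read off at the origin of the
-- others.
theorem sub_cpt_eq (k : K) (p q : Idx (n + 1)) : (t k - cpt t k) p q =
    if p.2 = q.2 then
      symbolOf (fun i j => (t k - cpt t k) (i, izero n) (j, izero n)) ((q.1 : ℤ) - p.1) else 0 := by
  obtain ⟨j, x⟩ := p
  obtain ⟨j', y⟩ := q
  split_ifs with hxy
  · simp only at hxy
    subst hxy
    rw [← eq_symbolOf]
    · exact (gridI n).const (fun x => (t k - cpt t k) (j, x) (j', x)) (fun i x =>
        sub_eq_zero.1 (congrFun (congrFun (h.grad_sub i k) (j, x)) (j', x))) x (izero n)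
    · funext i j
      exact congrFun (congrFun (h.inv_sub k) (i, izero n)) (j, izero n)
  · have : ∃ i, (gridI n).c x i ≠ (gridI n).c y i := by
      by_contra hc
      push Not at hc
      exact hxy ((gridI n).c_inj (funext hc))
    obtain ⟨i, hi⟩ := this
    have h1 := congrFun (congrFun (h.off_sub i k) (j, x)) (j', y)
    have h2 : (gridI (n + 1)).c (j, x) (Sum.inr i) ≠ (gridI (n + 1)).c (j', y) (Sum.inr i) := hi
    rw [Grid.off, if_neg h2] at h1
    exact h1

theorem rapid_symbol : Rapid (fun p : K × ℤ => ω p.1 + p.2.natAbs)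
    (fun p => ‖symbolOf (fun i j => (t p.1 - cpt t p.1) (i, izero n) (j, izero n)) p.2‖ₑ) := by
  have h1 : (gridI (n + 1)).Dec (fun k _ => ω k) (fun k => t k - cpt t k) :=
    h.dec.sub (h.dec_cpt.weight 1 fun k x => by simp only [Pi.sup_apply]; omega)
  refine Rapid.of_le h1 (fun p => (p.1, ((-p.2).toNat, izero n), (p.2.toNat, izero n))) 1
    fun p _ => ⟨le_rfl, ?_⟩
  rw [gridI_d_succ, Grid.d_self]
  simp only
  omega

end AFamily

/-- The induction must be over families: all the slices of the compact part are reconstructed at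
once with the weight `ω + j + k`, and the resulting decay of the seminorms is exactly the rapid
decay required of the coefficients `a_{jk}`. -/
theorem AFamily.reconstruct {n : ℕ} {K : Type} {ω : K → ℕ} {t : K → Ker (Idx n)}
    (h : AFamily n ω t) :
    ∃ F : K → Op (Idx n), (∀ k, F k ∈ (smoothA n).carrier) ∧ (∀ k, ker (F k) = t k) ∧
      ∀ s, Rapid ω fun k => (smoothA n).seminorm s (F k) := by
  classical
  induction n generalizing K with
  | zero => exact circle_reconstruct h.dec h.inv
  | succ n ih =>
    obtain ⟨F, hF, hFt, hFs⟩ := ih h.slices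
    set c : K → ℤ → ℂ := fun k =>
      symbolOf fun i j => (t k - AFamily.cpt t k) (i, izero n) (j, izero n)
    have hc : Rapid (fun p : K × ℤ => ω p.1 + p.2.natAbs) (fun p => ‖c p.1 p.2‖ₑ) := h.rapid_symbol
    have hcf : ∀ k m, rapidZ (c k) m < ⊤ := fun k m => ((rapid_rapidZ hc m).ne_top k).lt_top
    have hNN : ∀ r s, Rapid ω fun k => rapidNN (smoothA n) (fun p => F (k, p)) r s := fun r s =>
      rapid_tsum_matrix (hFs s) r
    have hnorm : Rapid (fun p : K × ℕ × ℕ => ω p.1 + (p.2.1 + p.2.2)) (fun p => ‖F p‖ₑ) := by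
      refine Grid.Dec.rapid_norm (g := gridI n) ?_
      simp only [hFt]
      exact h.slices.dec
    have hs₁ : ∀ k, Summable fun p : ℕ × ℕ => ContinuousLinearMap.adjoint (alpha (Idx n)) ^ p.1 *
        tensor (proj 0) (F (k, p)) * alpha (Idx n) ^ p.2 := fun k => by
      refine summable_of_tsum_enorm (ne_top_of_le_ne_top ((rapid_tsum_matrix hnorm 0).ne_top k)
        (ENNReal.tsum_le_tsum fun p => ?_))
      rw [pow_zero, one_mul]
      exact enorm_matrixUnit_tensor_le _ _ _
    have hs₂ : ∀ k, Summable fun m => c k m • twoSided (alpha (Idx n)) m := fun k =>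
      summable_laurent (hcf k 0) (norm_twoSided_alpha_le _)
    have hr : ∀ k, IsToeplitzRep (smoothA n)
        ((∑' p : ℕ × ℕ, ContinuousLinearMap.adjoint (alpha (Idx n)) ^ p.1 *
          tensor (proj 0) (F (k, p)) * alpha (Idx n) ^ p.2) +
          ∑' m, c k m • twoSided (alpha (Idx n)) m) (fun p => F (k, p)) (c k) := fun k =>
      ⟨fun p => hF _, fun r s => ((hNN r s).ne_top k).lt_top, hcf k, _, _, (hs₁ k).hasSum,
        (hs₂ k).hasSum, rfl⟩
    refine ⟨_, fun k => ⟨_, _, hr k⟩, fun k => ?_, fun M => ?_⟩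
    · funext p q
      rw [(hr k).ker_eq, hFt, ← h.sub_cpt_eq]
      simp
    · refine Rapid.mono ((Rapid.finset_sum (Finset.range (M + 1)) fun r _ =>
        Rapid.finset_sum (Finset.range (M + 1)) fun s _ => hNN r s).add (rapid_rapidZ hc M))
        fun k => ?_
      refine le_trans (b := (⨆ r ∈ Finset.range (M + 1), ⨆ s ∈ Finset.range (M + 1),
        rapidNN (smoothA n) (fun p => F (k, p)) r s) + rapidZ (c k) M)
        (iInf_le_of_le (fun p => F (k, p)) (iInf_le_of_le (c k) (iInf_le _ (hr k)))) ?_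
      gcongr
      refine iSup₂_le fun r hr => iSup₂_le fun s hs => ?_
      refine le_trans ?_ (Finset.single_le_sum
        (f := fun r => ∑ s ∈ Finset.range (M + 1), rapidNN (smoothA n) (fun p => F (k, p)) r s)
        (fun _ _ => zero_le) hr)
      exact Finset.single_le_sum
        (f := fun s => rapidNN (smoothA n) (fun p => F (k, p)) r s) (fun _ _ => zero_le) hs

/-- The entries of the members of `𝒜_n^∞` satisfy the estimates. -/
theorem aFamily_of_mem {n : ℕ} {T : Op (Idx n)} (hT : T ∈ (smoothA n).carrier) :
    AFamily n (fun _ : Unit => 0) (fun _ => ker T) := by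
  have h0 : ∀ w : Idx n → ℕ, (fun _ => 0) ⊔ w = w := fun w => by funext x; simp
  refine ⟨?_, fun i => ?_, fun i hi => ?_, fun _ => smoothA_grad_zdir hT⟩
  · exact dec_of_pn fun m => (smoothA_ctrl n m).ne_top (smoothA_seminorm_ne_top hT)
  · simp only [h0]
    exact dec_of_pn fun m => (smoothA_ctrl_off n m i).ne_top (smoothA_seminorm_ne_top hT)
  · simp only [h0]
    exact dec_of_pn fun m => (smoothA_ctrl_grad n m i hi).ne_top (smoothA_seminorm_ne_top hT)

theorem mem_smoothA_of_aFamily {n : ℕ} {t : Ker (Idx n)}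
    (h : AFamily n (fun _ : Unit => 0) (fun _ => t)) :
    ∃ T ∈ (smoothA n).carrier, ker T = t := by
  obtain ⟨F, hF, hFt, -⟩ := h.reconstruct
  exact ⟨F (), hF (), hFt ()⟩

end QSphere

end

noncomputable section

namespace QSphere

/-! ### Estimates for projective tensor products -/

namespace Grid

variable {X Y ι κ : Type} [Fintype ι] [Fintype κ] {g : Grid X ι} {h : Grid Y κ}

theorem pn_hasSum {I : Type} {w : X → ℕ} {m : ℕ} {f : I → Ker X} {t : Ker X}
    (ht : ∀ x y, HasSum (fun i => f i x y) (t x y)) : g.pn w m t ≤ ∑' i, g.pn w m (f i) := by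
  refine iSup_le fun p => ?_
  refine (mul_le_mul_right (enorm_le_of_hasSum (ht p.1 p.2)) _).trans ?_
  rw [← ENNReal.tsum_mul_left]
  refine ENNReal.tsum_le_tsum fun i => ?_
  exact le_iSup (fun p : X × X => wt (g.d p.1 p.2 + w p.1) ^ m * ‖f i p.1 p.2‖ₑ) p

theorem qn_hasSum {I : Type} {v : ι → X → ℕ} {L : List ι} {w : X → ℕ} {m : ℕ} {f : I → Ker X}
    {t : Ker X} (ht : ∀ x y, HasSum (fun i => f i x y) (t x y)) :
    g.qn v L w m t ≤ ∑' i, g.qn v L w m (f i) := by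
  induction L generalizing w f t with
  | nil => exact pn_hasSum ht
  | cons i L ih =>
    simp only [qn]
    rw [ENNReal.tsum_add]
    exact add_le_add (ih ht) (ih fun x y => (ht _ _).sub (ht _ _))

/-- The tensor product of two kernels. -/
def tmul (s : Ker X) (t : Ker Y) : Ker (X × Y) := fun p q => s p.1 q.1 * t p.2 q.2

theorem pn_tmul_le (w₁ : X → ℕ) (w₂ : Y → ℕ) {w : X × Y → ℕ} (hw : ∀ p, w p ≤ w₁ p.1 + w₂ p.2)
    (m : ℕ) (s : Ker X) (t : Ker Y) :
    (g.prod h).pn w m (tmul s t) ≤ g.pn w₁ m s * h.pn w₂ m t := by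
  refine iSup_le fun p => ?_
  calc wt ((g.prod h).d p.1 p.2 + w p.1) ^ m * ‖tmul s t p.1 p.2‖ₑ
      ≤ (wt (g.d p.1.1 p.2.1 + w₁ p.1.1) * wt (h.d p.1.2 p.2.2 + w₂ p.1.2)) ^ m *
          (‖s p.1.1 p.2.1‖ₑ * ‖t p.1.2 p.2.2‖ₑ) := by
        rw [tmul, enorm_mul]
        gcongr
        refine (wt_mono ?_).trans (wt_add_le _ _)
        have := hw p.1
        rw [prod_d]
        omega
    _ = (wt (g.d p.1.1 p.2.1 + w₁ p.1.1) ^ m * ‖s p.1.1 p.2.1‖ₑ) *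
          (wt (h.d p.1.2 p.2.2 + w₂ p.1.2) ^ m * ‖t p.1.2 p.2.2‖ₑ) := by ring
    _ ≤ _ := mul_le_mul'
      (le_iSup (fun p : X × X => wt (g.d p.1 p.2 + w₁ p.1) ^ m * ‖s p.1 p.2‖ₑ) (p.1.1, p.2.1))
      (le_iSup (fun p : Y × Y => wt (h.d p.1 p.2 + w₂ p.1) ^ m * ‖t p.1 p.2‖ₑ) (p.1.2, p.2.2))

theorem grad_inr_tmul (j : κ) (s : Ker X) (t : Ker Y) :
    (g.prod h).grad (Sum.inr j) (tmul s t) = tmul s (h.grad j t) := by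
  funext p q
  simp only [grad, prod_s_inr, tmul]
  ring

theorem grad_inl_tmul (i : ι) (s : Ker X) (t : Ker Y) :
    (g.prod h).grad (Sum.inl i) (tmul s t) = tmul (g.grad i s) t := by
  funext p q
  simp only [grad, prod_s_inl, tmul]
  ring

/-- Differences in the second factor pass through the first one. A weight `v` that depends on both
factors is allowed as long as its dependence on the first is absorbed by `w₁`, as happens for `|D|`.
-/
theorem qn_tmul_le {v : ι ⊕ κ → X × Y → ℕ} {v₂ : κ → Y → ℕ} (L : List κ) (w₁ : X → ℕ) (w₂ : Y → ℕ)
    (hv : ∀ j p, max (w₁ p.1) (v (Sum.inr j) p) = max (w₁ p.1) (v₂ j p.2)) {w : X × Y → ℕ}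
    (hw : ∀ p, w p = max (w₁ p.1) (w₂ p.2)) (m : ℕ) (s : Ker X) (t : Ker Y) :
    (g.prod h).qn v (L.map Sum.inr) w m (tmul s t) ≤ g.pn w₁ m s * h.qn v₂ L w₂ m t := by
  induction L generalizing w₂ w t with
  | nil => exact pn_tmul_le w₁ w₂ (fun p => by rw [hw]; omega) m s t
  | cons j L ih =>
    simp only [qn, List.map_cons]
    rw [mul_add, grad_inr_tmul]
    refine add_le_add (ih w₂ hw t) (ih _ (fun p => ?_) _)
    have := hv j p
    have := hw p
    simp only [Pi.sup_apply, prod_u_inr]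
    omega

theorem pn_le_qn (v : ι → X → ℕ) (L : List ι) (w : X → ℕ) (m : ℕ) (t : Ker X) :
    g.pn w m t ≤ g.qn v L w m t := by
  induction L with
  | nil => exact le_rfl
  | cons i L ih => exact ih.trans le_self_add

end Grid

theorem ker_tensor_eq {X Y : Type} (T : Op X) (R : Op Y) :
    ker (tensor T R) = Grid.tmul (ker T) (ker R) := by
  funext p q
  exact ker_tensor T R p q

/-- Countable subadditivity. -/
def CSub {X : Type} (N : Op X → ℝ≥0∞) : Prop :=
  ∀ (f : ℕ → Op X) (R : Op X), HasSum f R → N R ≤ ∑' i, N (f i)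

theorem csub_qn {X ι : Type} [Fintype ι] (g : Grid X ι) (v : ι → X → ℕ) (L : List ι) (w : X → ℕ)
    (m : ℕ) : CSub fun T => g.qn v L w m (ker T) :=
  fun _ _ h => Grid.qn_hasSum fun x y => hasSum_ker h x y

theorem csub_enorm {X : Type} : CSub fun T : Op X => ‖T‖ₑ := fun _ _ h => enorm_le_of_hasSum h

/-- The projective seminorm is an infimum over series of elementary tensors, so it dominates every
countably subadditive functional that it dominates on elementary tensors. -/
theorem Ctrl.projTensor {ι κ X Y : Type} {A : FrechetOps ι X} {B : FrechetOps κ Y}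
    {N₁ : Op X → ℝ≥0∞} {N₂ : Op Y → ℝ≥0∞} {N : Op (X × Y) → ℝ≥0∞} (h₁ : Ctrl A N₁) (h₂ : Ctrl B N₂)
    (hN : CSub N) (h : ∀ x y, N (tensor x y) ≤ N₁ x * N₂ y) : Ctrl (projTensor A B) N := by
  obtain ⟨C, M, hC, h₁⟩ := h₁
  obtain ⟨D, M', hD, h₂⟩ := h₂
  refine ⟨C * D, (M, M'), mul_ne_zero hC hD, fun T => ?_⟩
  have h0 : ((C * D : NNReal) : ℝ≥0∞) ≠ 0 := by exact_mod_cast mul_ne_zero hC hD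
  simp only [QSphere.projTensor]
  simp_rw [ENNReal.mul_iInf_of_ne h0 ENNReal.coe_ne_top]
  refine le_iInf fun x => le_iInf fun y => le_iInf fun hr => ?_
  refine (hN _ _ hr.2.2.2).trans ?_
  rw [← ENNReal.tsum_mul_left]
  refine ENNReal.tsum_le_tsum fun i => (h _ _).trans ((mul_le_mul' (h₁ _) (h₂ _)).trans
    (le_of_eq ?_))
  push_cast
  ring

/-! ### Estimates for the smooth Toeplitz algebra -/

theorem rapidMat_single (a : ℕ × ℕ → ℂ) (m j k : ℕ) : wt (j + k) ^ m * ‖a (j, k)‖ₑ ≤ rapidMat a m := by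
  refine le_trans (le_of_eq ?_) (ENNReal.le_tsum (j, k))
  simp only [wt, Nat.cast_add, add_assoc]

theorem natGrid_d (j k : ℕ) : Grid.natGrid.d j k = ((j : ℤ) - k).natAbs := by
  simp [Grid.d, Grid.natGrid]

theorem toeplitzInf_ctrl (m : ℕ) : Ctrl toeplitzInf fun T => Grid.natGrid.pn 0 m (ker T) := by
  refine ⟨1, m, one_ne_zero, fun T => ?_⟩
  rw [ENNReal.coe_one, one_mul]
  refine le_iInf fun a => le_iInf fun c => le_iInf fun h => iSup_le fun p => ?_
  rw [h.ker_eq]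
  refine (mul_le_mul_right (enorm_add_le _ _) _).trans ?_
  rw [mul_add]
  refine add_le_add ((mul_le_mul_left ?_ _).trans (rapidMat_single a m p.1 p.2))
    ((mul_le_mul_left ?_ _).trans (rapidZ_single c m _))
  · gcongr
    refine wt_mono ?_
    rw [natGrid_d, Pi.zero_apply]
    omega
  · gcongr
    refine wt_mono ?_
    rw [natGrid_d, Pi.zero_apply]
    omega

/-- The symbol depends on `k - j` only and cancels, which leaves differences of the matrix
coefficients; these decay in both indices. -/
theorem toeplitzInf_ctrl_grad (m : ℕ) :
    Ctrl toeplitzInf fun T => Grid.natGrid.pn (Grid.natGrid.u ()) m (Grid.natGrid.grad () (ker T)) := by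
  refine ⟨2 * (3 : ℕ) ^ m, m, by positivity, fun T => ?_⟩
  have h0 : ((2 * (3 : ℕ) ^ m : NNReal) : ℝ≥0∞) ≠ 0 := by
    rw [ENNReal.coe_ne_zero]; positivity
  have h2 : ((2 * (3 : ℕ) ^ m : NNReal) : ℝ≥0∞) = 2 * wt 2 ^ m := by
    rw [wt_eq]; push_cast; norm_num
  simp only [toeplitzInf]
  simp_rw [ENNReal.mul_iInf_of_ne h0 ENNReal.coe_ne_top]
  refine le_iInf fun a => le_iInf fun c => le_iInf fun h => iSup_le fun p => ?_
  obtain ⟨j, k⟩ := p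
  have hs : ∀ n, Grid.natGrid.s () n = n + 1 := fun _ => rfl
  have hu : ∀ n, Grid.natGrid.u () n = n := fun _ => rfl
  have h1 : ((k + 1 : ℕ) : ℤ) - ((j + 1 : ℕ) : ℤ) = (k : ℤ) - j := by push_cast; ring
  simp only [Grid.grad, hs, h.ker_eq, h1, add_sub_add_right_eq_sub, hu, natGrid_d]
  have hw : wt (((j : ℤ) - k).natAbs + j) ≤ wt 2 * wt (j + k) := wt_le_mul (by omega)
  calc wt (((j : ℤ) - k).natAbs + j) ^ m * ‖a (j + 1, k + 1) - a (j, k)‖ₑ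
      ≤ (wt 2 * wt (j + k)) ^ m * (‖a (j + 1, k + 1)‖ₑ + ‖a (j, k)‖ₑ) := by
        gcongr
        exact enorm_sub_le
    _ = wt 2 ^ m * (wt (j + k) ^ m * ‖a (j + 1, k + 1)‖ₑ + wt (j + k) ^ m * ‖a (j, k)‖ₑ) := by ring
    _ ≤ wt 2 ^ m * (rapidMat a m + rapidMat a m) := by
        gcongr
        · refine le_trans ?_ (rapidMat_single a m (j + 1) (k + 1))
          gcongr
          exact wt_mono (by omega)
        · exact rapidMat_single a m j k
    _ = 2 * wt 2 ^ m * rapidMat a m := by ring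
    _ ≤ _ := by
        rw [h2]
        gcongr
        exact le_self_add

theorem toeplitzPow_ctrl (l m : ℕ) :
    Ctrl (toeplitzPow l) fun T => (gridN l).qn 0 (listN l) 0 m (ker T) := by

  induction l with
  | zero =>
    refine ⟨1, (), one_ne_zero, fun T => iSup_le fun p => ?_⟩
    have : (gridN 0).d p.1 p.2 = 0 := by simp [Grid.d]
    rw [this, Pi.zero_apply, wt, add_zero, Nat.cast_zero, add_zero, one_pow, one_mul, ENNReal.coe_one,
      one_mul]
    exact enorm_ker_le T _ _
  | succ l ih =>
    have h1 : Ctrl toeplitzInf fun T => Grid.natGrid.pn 0 m (ker T) +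
        Grid.natGrid.pn (Grid.natGrid.u ()) m (Grid.natGrid.grad () (ker T)) := by
      obtain ⟨C, M, -, hC⟩ := toeplitzInf_ctrl m
      obtain ⟨D, M', -, hD⟩ := toeplitzInf_ctrl_grad m
      have hmono : ∀ {a b : ℕ} (T), a ≤ b → toeplitzInf.seminorm a T ≤ toeplitzInf.seminorm b T := by
        intro a b T hab
        refine iInf_mono fun x => iInf_mono fun c => iInf_mono fun _ => ?_
        refine add_le_add ?_ (rapidZ_mono c hab)
        refine ENNReal.tsum_le_tsum fun p => ?_
        gcongr
        rw [add_assoc]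
        exact le_self_add
      refine Ctrl.mk' (C + D) (max M M') fun T => ?_
      rw [ENNReal.coe_add, add_mul]
      refine add_le_add ((hC T).trans ?_) ((hD T).trans ?_)
      · gcongr
        exact hmono T (le_max_left _ _)
      · gcongr
        exact hmono T (le_max_right _ _)
    refine h1.projTensor ih (csub_qn _ _ _ _ _) fun x y => ?_
    rw [ker_tensor_eq]
    change Grid.qn _ 0 ((listN l).map Sum.inr) 0 m _ + Grid.qn _ 0 ((listN l).map Sum.inr) _ m _ ≤ _
    rw [add_mul]
    refine add_le_add ?_ ?_
    · exact Grid.qn_tmul_le (listN l) 0 0 (fun _ _ => rfl) (fun _ => rfl) m _ _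
    · have h2 : (gridN (l + 1)).grad (Sum.inl ()) (Grid.tmul (ker x) (ker y)) =
          Grid.tmul (Grid.natGrid.grad () (ker x)) (ker y) := Grid.grad_inl_tmul _ _ _
      rw [h2]
      refine Grid.qn_tmul_le (listN l) (Grid.natGrid.u ()) 0 (fun _ _ => rfl) (fun p => ?_) m _ _
      have : (gridN (l + 1)).u (Sum.inl ()) p = Grid.natGrid.u () p.1 := rfl
      simp only [Pi.sup_apply, Pi.zero_apply, this]
      omega

theorem toeplitzPow_ctrl_norm (l : ℕ) : Ctrl (toeplitzPow l) fun T => ‖T‖ₑ := by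
  obtain ⟨N, B, h⟩ := enorm_le_pn (gridN l)
  refine ((toeplitzPow_ctrl l N).const_mul B).mono fun T => (h T).trans ?_
  gcongr
  exact Grid.pn_le_qn _ _ _ _ _

/-! ### Estimates for smoothing operators -/

theorem smoothing_entry_le (l : ℕ) (p : ℕ × ℕ) (T : Op (Idx l)) (x y : Idx l) :
    (absD l x : ℝ≥0∞) ^ p.1 * (absD l y : ℝ≥0∞) ^ p.2 * ‖ker T x y‖ₑ ≤ (smoothing l).seminorm p T := by
  refine le_iInf fun B => le_iInf fun hB => ?_
  refine le_trans (le_of_eq ?_) (enorm_ker_le B x y)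
  have hB' : ker B x y = (absD l x : ℂ) ^ p.1 * (absD l y : ℂ) ^ p.2 * ker T x y := hB x y
  rw [hB', enorm_mul, enorm_mul, enorm_pow, enorm_pow]
  have : ∀ n : ℕ, ‖(n : ℂ)‖ₑ = n := fun n => by
    have := Grid.enorm_intCast (n : ℤ)
    simpa using this
  rw [this, this]

theorem smoothing_ctrl_norm (l : ℕ) : Ctrl (smoothing l) fun T => ‖T‖ₑ := by
  refine ⟨1, (0, 0), one_ne_zero, fun T => ?_⟩
  rw [ENNReal.coe_one, one_mul]
  refine le_iInf fun B => le_iInf fun hB => ?_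
  have : B = T := ker_ext fun x y => by
    have := hB x y
    simpa [ker] using this
  rw [this]

/-- Both the distance and the weight are bounded by `|D|` at the row and at the column. Expanding
`(1 + |D_x|^m)(1 + |D_y|^m)` gives the four seminorms. -/
theorem smoothing_pn_le (l m : ℕ) : ∃ C : NNReal, ∀ T : Op (Idx l),
    (gridI l).pn (absD l) m (ker T) ≤
      C * ((smoothing l).seminorm (0, 0) T + (smoothing l).seminorm (0, m) T +
        ((smoothing l).seminorm (m, 0) T + (smoothing l).seminorm (m, m) T)) := by
  refine ⟨(3 : ℕ) ^ m * (2 ^ m * 2 ^ m), fun T => iSup_le fun p => ?_⟩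
  obtain ⟨x, y⟩ := p
  have h2 : (((3 : ℕ) ^ m * (2 ^ m * 2 ^ m) : NNReal) : ℝ≥0∞) = wt 2 ^ m * (2 ^ m * 2 ^ m) := by
    rw [wt_eq]; push_cast; norm_num
  have hd := d_le_absD l x y
  have hw : wt ((gridI l).d x y + absD l x) ≤ wt 2 * (wt (absD l x) * wt (absD l y)) :=
    (wt_le_mul (A := 2) (b := absD l x + absD l y) (by omega)).trans
      (mul_le_mul_right (wt_add_le _ _) _)
  have e := fun p => smoothing_entry_le l p T x y
  have e0 := e (0, 0)
  have e1 := e (0, m)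
  have e2 := e (m, 0)
  have e3 := e (m, m)
  simp only [pow_zero, one_mul, mul_one] at e0 e1 e2 e3
  calc wt ((gridI l).d x y + absD l x) ^ m * ‖ker T x y‖ₑ
      ≤ (wt 2 * (wt (absD l x) * wt (absD l y))) ^ m * ‖ker T x y‖ₑ := by gcongr
    _ = wt 2 ^ m * (wt (absD l x) ^ m * wt (absD l y) ^ m) * ‖ker T x y‖ₑ := by ring
    _ ≤ wt 2 ^ m * ((2 ^ m * (1 + (absD l x : ℝ≥0∞) ^ m)) * (2 ^ m * (1 + (absD l y : ℝ≥0∞) ^ m))) *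
          ‖ker T x y‖ₑ := by gcongr <;> exact Grid.wt_pow_le _ _
    _ = wt 2 ^ m * (2 ^ m * 2 ^ m) * (‖ker T x y‖ₑ + (absD l y : ℝ≥0∞) ^ m * ‖ker T x y‖ₑ +
          ((absD l x : ℝ≥0∞) ^ m * ‖ker T x y‖ₑ +
            (absD l x : ℝ≥0∞) ^ m * (absD l y : ℝ≥0∞) ^ m * ‖ker T x y‖ₑ)) := by ring
    _ ≤ _ := by
        rw [h2]
        gcongr

/-! ### Estimates for `𝒥` -/

theorem smoothJ_ctrl_norm (l : ℕ) : Ctrl (smoothJ l) fun T => ‖T‖ₑ :=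
  (smoothing_ctrl_norm l).projTensor (toeplitzPow_ctrl_norm l) csub_enorm enorm_tensor_le

/-- Termwise, decay in `|D|` comes from the first tensor factor and all the differences fall on the
second. The weight of each direction of the second `ℕ^l` is `|D|`, already supplied by the first
factor. -/
theorem smoothJ_qn_ne_top {l : ℕ} {R : Op (Idx l × NIdx l)} (hR : R ∈ (smoothJ l).carrier) (m : ℕ) :
    (gridB l l).qn (vB l l) ((listN l).map Sum.inr) (fun p => absD l p.1) m (ker R) ≠ ⊤ := by
  obtain ⟨x, y, hx, hy, hs, hR⟩ := hR
  obtain ⟨C, hC⟩ := smoothing_pn_le l m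
  obtain ⟨D, r, -, hD⟩ := toeplitzPow_ctrl l m
  refine ne_top_of_le_ne_top ?_ (csub_qn (gridB l l) (vB l l) ((listN l).map Sum.inr)
    (fun p => absD l p.1) m _ _ hR)
  have h1 : ∀ i, (gridB l l).qn (vB l l) ((listN l).map Sum.inr) (fun p => absD l p.1) m
      (ker (tensor (x i) (y i))) ≤ (C * D : NNReal) *
      ((smoothing l).seminorm (0, 0) (x i) * (toeplitzPow l).seminorm r (y i) +
        (smoothing l).seminorm (0, m) (x i) * (toeplitzPow l).seminorm r (y i) +
        ((smoothing l).seminorm (m, 0) (x i) * (toeplitzPow l).seminorm r (y i) +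
        (smoothing l).seminorm (m, m) (x i) * (toeplitzPow l).seminorm r (y i))) := by
    intro i
    rw [ker_tensor_eq]
    refine (Grid.qn_tmul_le (v₂ := 0) (listN l) (absD l) 0 (fun j p => ?_) (fun p => ?_) m _ _).trans
      ((mul_le_mul' (hC _) (hD _)).trans (le_of_eq ?_))
    · simp [vB]
    · simp
    · push_cast
      ring
  refine ne_top_of_le_ne_top ?_ (ENNReal.tsum_le_tsum h1)
  rw [ENNReal.tsum_mul_left, ENNReal.tsum_add, ENNReal.tsum_add, ENNReal.tsum_add]
  refine ENNReal.mul_ne_top ENNReal.coe_ne_top (ENNReal.add_ne_top.2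
    ⟨ENNReal.add_ne_top.2 ⟨?_, ?_⟩, ENNReal.add_ne_top.2 ⟨?_, ?_⟩⟩) <;> exact (hs _ _).ne

/-- The entries of the members of `𝒥` and their differences decay rapidly. -/
theorem smoothJ_cls {l : ℕ} {R : Op (Idx l × NIdx l)} (hR : R ∈ (smoothJ l).carrier) :
    (gridB l l).Cls (vB l l) ((listN l).map Sum.inr) (fun (_ : Unit) p => absD l p.1)
      (fun _ => ker R) := fun m =>
  ⟨_, fun _ => (ENNReal.coe_toNNReal (smoothJ_qn_ne_top hR m)).ge⟩

end QSphere

end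

noncomputable section

namespace QSphere

/-! ### Construction of members of projective tensor products -/

/-- An enumeration of the index set turns the given expansion into an admissible representation,
which bounds the infimum. -/
theorem projTensor_of_hasSum {ι κ X Y E : Type} [Countable E] [Infinite E] {A : FrechetOps ι X}
    {B : FrechetOps κ Y} {x : E → Op X} {y : E → Op Y} {R : Op (X × Y)} (hx : ∀ i, x i ∈ A.carrier)
    (hy : ∀ i, y i ∈ B.carrier) (hs : ∀ p r, ∑' i, A.seminorm p (x i) * B.seminorm r (y i) ≠ ⊤)
    (hR : HasSum (fun i => tensor (x i) (y i)) R) :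
    R ∈ (projTensor A B).carrier ∧ ∀ p, (projTensor A B).seminorm p R ≤
      ∑' i, A.seminorm p.1 (x i) * B.seminorm p.2 (y i) := by
  obtain ⟨_⟩ := nonempty_denumerable E
  have φ : ℕ ≃ E := (Denumerable.eqv E).symm
  have hr : IsTensorRep A B R (x ∘ φ) (y ∘ φ) :=
    ⟨fun _ => hx _, fun _ => hy _, fun p r => by
      have := φ.tsum_eq fun i => A.seminorm p (x i) * B.seminorm r (y i)
      simp only [Function.comp_apply]
      rw [this]
      exact (hs p r).lt_top, (φ.hasSum_iff (f := fun i => tensor (x i) (y i))).2 hR⟩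
  refine ⟨⟨_, _, hr⟩, fun p => le_trans
    (b := ∑' i, A.seminorm p.1 ((x ∘ φ) i) * B.seminorm p.2 ((y ∘ φ) i))
    (iInf_le_of_le (x ∘ φ) (iInf_le_of_le (y ∘ φ) (iInf_le _ hr))) (le_of_eq ?_)⟩
  exact φ.tsum_eq fun i => A.seminorm p.1 (x i) * B.seminorm p.2 (y i)

namespace Grid

variable {X Y ι κ : Type} [Fintype ι] [Fintype κ] {g : Grid X ι} {h : Grid Y κ} {K K' : Type}

/-- The slices of a family of kernels on a product. -/
theorem Cls.slice {v : ι ⊕ κ → X × Y → ℕ} {L : List κ} {W : K → X × Y → ℕ} {t : K → Ker (X × Y)}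
    (ht : (g.prod h).Cls v (L.map Sum.inr) W t) (φ : K' → K) (a b : K' → X) {w : K' → Y → ℕ} {A : ℕ}
    (hA : 1 ≤ A) (hw : ∀ k y, w k y ≤ A * (1 + g.d (a k) (b k) + W (φ k) (a k, y))) :
    h.Cls 0 L w (fun k x y => t (φ k) (a k, x) (b k, y)) := by
  induction L generalizing W w t with
  | nil =>
    refine cls_nil.2 (Rapid.of_le (cls_nil.1 ht) (fun p => (φ p.1, (a p.1, p.2.1), (b p.1, p.2.2)))
      A fun p _ => ⟨le_rfl, ?_⟩)
    have := hw p.1 p.2.1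
    simp only [prod_d]
    nlinarith
  | cons j L ih =>
    rw [List.map_cons, cls_cons] at ht
    rw [cls_cons]
    refine ⟨ih ht.1 hw, ih ht.2 fun k y => ?_⟩
    have := hw k y
    have h1 : (g.prod h).u (Sum.inr j) (a k, y) = h.u j y := rfl
    simp only [Pi.sup_apply, Pi.zero_apply, h1]
    have h2 : W (φ k) (a k, y) ≤ max (W (φ k) (a k, y)) (max (v (Sum.inr j) (a k, y)) (h.u j y)) :=
      le_max_left _ _
    have h3 : h.u j y ≤ max (W (φ k) (a k, y)) (max (v (Sum.inr j) (a k, y)) (h.u j y)) :=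
      (le_max_right _ _).trans (le_max_right _ _)
    refine max_le (this.trans ?_) (max_le (Nat.zero_le _) ?_)
    · gcongr
    · nlinarith

end Grid

/-! ### Construction of members of `𝒯_ℓ^∞` -/

theorem isTRep_twoSided (n : ℤ) : IsTRep (twoSided S n) 0 (Pi.single n 1) := by
  refine ⟨fun m => by simp [rapidMat], fun m => ?_, 0, twoSided S n, ?_, ?_, (zero_add _).symm⟩
  · rw [rapidZ, tsum_eq_single n fun k hk => by simp [hk]]
    simp
  · simp
  · convert hasSum_single n fun k hk => ?_ using 1
    · simp
    · simp [hk]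

theorem twoSided_seminorm_le (m : ℕ) (n : ℤ) :
    toeplitzInf.seminorm m (twoSided S n) ≤ wt n.natAbs ^ m := by
  refine iInf_le_of_le 0 (iInf_le_of_le (Pi.single n 1) (iInf_le_of_le (isTRep_twoSided n) ?_))
  rw [rapidZ, tsum_eq_single n fun k hk => by simp [hk]]
  simp [rapidMat, wt]

theorem isTRep_matrixUnit (p : ℕ × ℕ) :
    IsTRep (Sstar ^ p.1 * proj 0 * S ^ p.2) (Pi.single p 1) 0 := by
  refine ⟨fun m => ?_, fun m => by simp [rapidZ], Sstar ^ p.1 * proj 0 * S ^ p.2, 0, ?_, ?_,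
    (add_zero _).symm⟩
  · rw [rapidMat, tsum_eq_single p fun k hk => by simp [hk]]
    simp
  · convert hasSum_single p fun k hk => ?_ using 1
    · simp
    · simp [hk]
  · simp

theorem matrixUnit_seminorm_le (m : ℕ) (p : ℕ × ℕ) :
    toeplitzInf.seminorm m (Sstar ^ p.1 * proj 0 * S ^ p.2) ≤ wt (p.1 + p.2) ^ m := by
  refine iInf_le_of_le (Pi.single p 1) (iInf_le_of_le 0 (iInf_le_of_le (isTRep_matrixUnit p) ?_))
  rw [rapidMat, tsum_eq_single p fun k hk => by simp [hk]]
  simp [rapidZ, wt, add_assoc]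

/-- The basic elements of `𝒯^∞`. -/
def toeplitzBasis : ℤ ⊕ ℕ × ℕ → Op ℕ :=
  Sum.elim (twoSided S) fun p => Sstar ^ p.1 * proj 0 * S ^ p.2

/-- The order of the basic elements of `𝒯^∞`. -/
def toeplitzOrder : ℤ ⊕ ℕ × ℕ → ℕ := Sum.elim Int.natAbs fun p => p.1 + p.2

theorem toeplitzBasis_mem (i : ℤ ⊕ ℕ × ℕ) : toeplitzBasis i ∈ toeplitzInf.carrier := by
  rcases i with n | p
  · exact ⟨_, _, isTRep_twoSided n⟩
  · exact ⟨_, _, isTRep_matrixUnit p⟩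

theorem toeplitzBasis_seminorm_le (m : ℕ) (i : ℤ ⊕ ℕ × ℕ) :
    toeplitzInf.seminorm m (toeplitzBasis i) ≤ wt (toeplitzOrder i) ^ m := by
  rcases i with n | p
  · exact twoSided_seminorm_le m n
  · exact matrixUnit_seminorm_le m p

theorem toeplitzBasis_enorm_le (i : ℤ ⊕ ℕ × ℕ) : ‖toeplitzBasis i‖ₑ ≤ 1 := by
  rcases i with n | p
  · have h1 : ‖(1 : ℂ)‖ₑ = 1 := by simp
    rw [← h1, enorm_le_iff_norm_le, norm_one]
    exact norm_twoSided_S_le n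
  · exact enorm_matrixUnit_le _ _

theorem toeplitzOrder_tsum :
    ∃ (N : ℕ) (B : NNReal), ∑' i, (wt (toeplitzOrder i) ^ N)⁻¹ ≤ B :=
  exists_tsum_sum (σ := Int.natAbs) (τ := fun p : ℕ × ℕ => p.1 + p.2) exists_tsum_int
    (exists_tsum_prod (σ := fun n : ℕ => n) (τ := fun n : ℕ => n) exists_tsum_nat exists_tsum_nat)

/-! ### Expansion of a kernel in the first Toeplitz variable -/

section Slices

variable {l : ℕ} {K : Type} {ω : K → ℕ} {t : K → Ker (NIdx (l + 1))}

/-- The compact part in the first variable. -/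
def cptN (t : K → Ker (NIdx (l + 1))) (k : K) : Ker (NIdx (l + 1)) :=
  (gridN (l + 1)).tail (Sum.inl ()) ((gridN (l + 1)).grad (Sum.inl ()) (t k))

/-- The coefficients of a family of kernels with respect to the basic elements of `𝒯^∞`. -/
def coeffN (t : K → Ker (NIdx (l + 1))) : K × (ℤ ⊕ ℕ × ℕ) → Ker (NIdx l)
  | (k, Sum.inl n) => fun x y => (t k - cptN t k) ((-n).toNat, x) (n.toNat, y)
  | (k, Sum.inr r) => fun x y => cptN t k (r.1, x) (r.2, y)

variable (h : (gridN (l + 1)).Cls 0 (listN (l + 1)) (fun k _ => ω k) t)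

include h

theorem cls_grad_inl : (gridN (l + 1)).Cls 0 ((listN l).map Sum.inr)
    (fun k => (fun _ => ω k) ⊔ (0 ⊔ (gridN (l + 1)).u (Sum.inl ())))
    (fun k => (gridN (l + 1)).grad (Sum.inl ()) (t k)) := (Grid.cls_cons.1 h).2

theorem cls_cptN : (gridN (l + 1)).Cls 0 ((listN l).map Sum.inr)
    (fun k => (fun _ => ω k) ⊔ (0 ⊔ (gridN (l + 1)).u (Sum.inl ()))) (cptN t) :=
  (cls_grad_inl h).tail (fun _ => Grid.lip_zero _) trivial
    (fun _ => (Grid.lip_const _ _).sup ((Grid.lip_zero _).sup (Grid.lip_u _ _)))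
    (fun _ _ => le_sup_of_le_right (le_sup_right (a := 0)))

theorem cls_sub_cptN : (gridN (l + 1)).Cls 0 ((listN l).map Sum.inr) (fun k _ => ω k)
    (fun k => t k - cptN t k) := by
  have h1 := (cls_cptN h).weight (w₁ := fun k _ => ω k) (v₁ := 0) 1
    (fun k x => by simp only [Pi.sup_apply]; omega) (fun i _ k x => Nat.zero_le _)
  simpa only [sub_eq_add_neg] using (Grid.cls_cons.1 h).1.add h1.neg

theorem symbolOf_sub_cptN (k : K) (p q : NIdx (l + 1)) :
    symbolOf (fun i j => (t k - cptN t k) (i, p.2) (j, q.2)) ((q.1 : ℤ) - p.1) =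
      (t k - cptN t k) p q := by
  have h1 : (gridN (l + 1)).grad (Sum.inl ()) (t k - cptN t k) = 0 :=
    Grid.grad_sub_tail trivial (fun _ _ => le_sup_of_le_right (le_sup_right (a := 0)))
      (cls_grad_inl h).dec k
  rw [← eq_symbolOf]
  funext i j
  exact congrFun (congrFun h1 (i, p.2)) (j, q.2)

/-- The index `n` of a two-sided shift is paid by the distance between the rows and columns `(-n)⁺`
and `n⁺`, and the indices of a matrix unit by that distance together with the decay of the compact
part in the first coordinate. -/
theorem cls_coeffN : (gridN l).Cls 0 (listN l)
    (fun (p : K × (ℤ ⊕ ℕ × ℕ)) _ => ω p.1 + toeplitzOrder p.2) (coeffN t) := by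
  have h1 : (gridN l).Cls 0 (listN l) (fun (p : K × ℤ) _ => ω p.1 + p.2.natAbs)
      (fun p => coeffN t (p.1, Sum.inl p.2)) := by
    refine Grid.Cls.slice (g := Grid.natGrid) (h := gridN l) (v := 0) (L := listN l)
      (W := fun k _ => ω k) (t := fun k => t k - cptN t k) (w := fun p _ => ω p.1 + p.2.natAbs)
      (cls_sub_cptN h) Prod.fst (fun p => (-p.2).toNat) (fun p => p.2.toNat) le_rfl fun p y => ?_
    rw [natGrid_d]
    omega
  have h2 : (gridN l).Cls 0 (listN l) (fun (p : K × ℕ × ℕ) _ => ω p.1 + (p.2.1 + p.2.2))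
      (fun p => coeffN t (p.1, Sum.inr p.2)) := by
    refine Grid.Cls.slice (g := Grid.natGrid) (h := gridN l) (v := 0) (L := listN l)
      (W := fun k => (fun _ => ω k) ⊔ (0 ⊔ (gridN (l + 1)).u (Sum.inl ()))) (t := cptN t)
      (K' := K × ℕ × ℕ) (w := fun p _ => ω p.1 + (p.2.1 + p.2.2))
      (A := 3) (cls_cptN h) Prod.fst (fun p => p.2.1) (fun p => p.2.2) (by norm_num) fun p y => ?_
    have : (gridN (l + 1)).u (Sum.inl ()) (p.2.1, y) = p.2.1 := rfl
    rw [natGrid_d]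
    simp only [Pi.sup_apply, Pi.zero_apply, this]
    omega
  intro m
  obtain ⟨C, hC⟩ := h1 m
  obtain ⟨D, hD⟩ := h2 m
  refine ⟨max C D, fun p => ?_⟩
  obtain ⟨k, n | r⟩ := p
  · exact (hC (k, n)).trans (by exact_mod_cast le_max_left C D)
  · exact (hD (k, r)).trans (by exact_mod_cast le_max_right C D)

theorem hasSum_coeffN (k : K) (p q : NIdx (l + 1)) :
    HasSum (fun i => ker (toeplitzBasis i) p.1 q.1 * coeffN t (k, i) p.2 q.2) (t k p q) := by
  classical
  have h1 : HasSum (fun n : ℤ => ker (toeplitzBasis (Sum.inl n)) p.1 q.1 *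
      coeffN t (k, Sum.inl n) p.2 q.2) ((t k - cptN t k) p q) := by
    rw [← symbolOf_sub_cptN h]
    convert hasSum_single ((q.1 : ℤ) - p.1) fun n hn => ?_ using 1
    · change _ = ker (twoSided S _) p.1 q.1 * _
      rw [ker_twoSided_S, if_pos rfl, one_mul]
      rfl
    · change ker (twoSided S _) p.1 q.1 * _ = 0
      rw [ker_twoSided_S, if_neg (Ne.symm hn), zero_mul]
  have h2 : HasSum (fun r : ℕ × ℕ => ker (toeplitzBasis (Sum.inr r)) p.1 q.1 *
      coeffN t (k, Sum.inr r) p.2 q.2) (cptN t k p q) := by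
    convert hasSum_single (p.1, q.1) fun r hr => ?_ using 1
    · change _ = ker (Sstar ^ p.1 * proj 0 * S ^ q.1) p.1 q.1 * _
      rw [ker_matrixUnit, if_pos ⟨rfl, rfl⟩, one_mul]
      rfl
    · change ker (Sstar ^ r.1 * proj 0 * S ^ r.2) p.1 q.1 * _ = 0
      rw [ker_matrixUnit, if_neg, zero_mul]
      exact fun e => hr (Prod.ext e.1.symm e.2.symm)
  have h3 := HasSum.sum (f := fun i => ker (toeplitzBasis i) p.1 q.1 * coeffN t (k, i) p.2 q.2) h1 h2
  simpa using h3

end Slices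

/-- The kernel is expanded in the basic elements of `𝒯^∞` in the first variable. Their seminorms
grow only polynomially in the order, while the coefficients, reconstructed by induction as one
family, decay rapidly in it. -/
theorem toeplitzPow_reconstruct {l : ℕ} {K : Type} {ω : K → ℕ} {t : K → Ker (NIdx l)}
    (h : (gridN l).Cls 0 (listN l) (fun k _ => ω k) t) :
    ∃ F : K → Op (NIdx l), (∀ k, F k ∈ (toeplitzPow l).carrier) ∧ (∀ k, ker (F k) = t k) ∧
      ∀ r, Rapid ω fun k => (toeplitzPow l).seminorm r (F k) := by
  induction l generalizing K with
  | zero =>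
    have hk : ∀ k, ker (t k () () • (1 : Op (NIdx 0))) = t k := fun k => by
      funext x y
      rw [ker_smul, ker_one]
      simp
    refine ⟨fun k => t k () () • 1, fun k => Set.mem_univ _, hk, fun r => ?_⟩
    refine Grid.Dec.rapid_norm (g := gridN 0) ?_
    simp only [hk]
    exact h.dec
  | succ l ih =>
    obtain ⟨F, hF, hFt, hFs⟩ := ih (cls_coeffN h)
    have hnorm : Rapid (fun p : K × (ℤ ⊕ ℕ × ℕ) => ω p.1 + toeplitzOrder p.2) (fun p => ‖F p‖ₑ) := by
      refine Grid.Dec.rapid_norm (g := gridN l) ?_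
      simp only [hFt]
      exact (cls_coeffN h).dec
    have hsum : ∀ (m : ℕ) (f : K × (ℤ ⊕ ℕ × ℕ) → ℝ≥0∞), Rapid (fun p : K × (ℤ ⊕ ℕ × ℕ) =>
        ω p.1 + toeplitzOrder p.2) f → Rapid ω fun k => ∑' i, wt (toeplitzOrder i) ^ m * f (k, i) :=
      fun m f hf => (hf.mul_wt (σ := fun p => toeplitzOrder p.2) (fun _ => Nat.le_add_left _ _)
        m).tsum_weight (ρ := ω) toeplitzOrder_tsum fun _ _ => le_rfl
    have hs : ∀ k, Summable fun i => tensor (toeplitzBasis i) (F (k, i)) := fun k => by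
      refine summable_of_tsum_enorm (ne_top_of_le_ne_top ((hsum 0 _ hnorm).ne_top k)
        (ENNReal.tsum_le_tsum fun i => (enorm_tensor_le _ _).trans ?_))
      rw [pow_zero]
      gcongr
      exact toeplitzBasis_enorm_le i
    have hle : ∀ k m r, ∑' i, toeplitzInf.seminorm m (toeplitzBasis i) *
        (toeplitzPow l).seminorm r (F (k, i)) ≤
        ∑' i, wt (toeplitzOrder i) ^ m * (toeplitzPow l).seminorm r (F (k, i)) := fun k m r => by
      gcongr
      exact toeplitzBasis_seminorm_le m _
    have hr := fun k => projTensor_of_hasSum toeplitzBasis_mem (fun i => hF (k, i))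
      (fun m r => ne_top_of_le_ne_top ((hsum m _ (hFs r)).ne_top k) (hle k m r)) (hs k).hasSum
    refine ⟨fun k => ∑' i, tensor (toeplitzBasis i) (F (k, i)), fun k => (hr k).1, fun k => ?_,
      fun r => ?_⟩
    · funext p q
      refine (hasSum_ker (hs k).hasSum p q).unique ?_
      simp only [ker_tensor, hFt]
      exact hasSum_coeffN h k p q
    · exact (hsum r.1 _ (hFs r.2)).mono fun k => ((hr k).2 r).trans (hle k r.1 r.2)

/-! ### Construction of members of `𝒥` -/

theorem idx_countable (l : ℕ) : Countable (Idx l) := by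
  induction l with
  | zero => exact inferInstanceAs (Countable ℤ)
  | succ l ih => exact inferInstanceAs (Countable (ℕ × Idx l))

theorem idx_infinite (l : ℕ) : Infinite (Idx l) := by
  induction l with
  | zero => exact inferInstanceAs (Infinite ℤ)
  | succ l ih => exact inferInstanceAs (Infinite (ℕ × Idx l))

/-- The matrix unit `|e_p⟩⟨e_q|`. -/
def unitOp {X : Type} (p : X × X) : Op X := InnerProductSpace.rankOne ℂ (e p.1) (e p.2)

open scoped Classical in
theorem ker_unitOp {X : Type} (p : X × X) (x y : X) :
    ker (unitOp p) x y = if x = p.1 ∧ y = p.2 then 1 else 0 := by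
  have h : unitOp p (e y) = (inner ℂ (e p.2 : L2 X) (e y)) • (e p.1 : L2 X) := by
    simp [unitOp, InnerProductSpace.rankOne_apply]
  rw [ker, h, inner_e_left]
  simp only [lp.coeFn_smul, Pi.smul_apply, e_apply, smul_eq_mul]
  by_cases h1 : x = p.1 <;> by_cases h2 : y = p.2 <;> simp [h1, h2, eq_comm]

theorem enorm_unitOp {X : Type} (p : X × X) : ‖unitOp p‖ₑ = 1 := by
  rw [unitOp, InnerProductSpace.enorm_rankOne, enorm_eq_nnnorm, enorm_eq_nnnorm]
  have : ∀ x : X, ‖(e x : L2 X)‖₊ = 1 := fun x => NNReal.eq (norm_e x)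
  rw [this, this]
  simp

theorem isDTD_unitOp {l : ℕ} (p : Idx l × Idx l) (m n : ℕ) :
    IsDTD l (unitOp p) m n (((absD l p.1 : ℂ) ^ m * (absD l p.2 : ℂ) ^ n) • unitOp p) := by
  classical
  intro x y
  change ker (_ • unitOp p) x y = _ * ker (unitOp p) x y
  rw [ker_smul, ker_unitOp]
  split_ifs with h
  · rw [h.1, h.2]
  · simp

theorem unitOp_seminorm_le {l : ℕ} (p : Idx l × Idx l) (r : ℕ × ℕ) :
    (smoothing l).seminorm r (unitOp p) ≤ wt (absD l p.1 + absD l p.2) ^ (r.1 + r.2) := by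
  refine iInf_le_of_le _ (iInf_le_of_le (isDTD_unitOp p r.1 r.2) ?_)
  rw [enorm_smul, enorm_unitOp, mul_one, enorm_mul, enorm_pow, enorm_pow, pow_add]
  have : ∀ n : ℕ, ‖(n : ℂ)‖ₑ = n := fun n => by
    have := Grid.enorm_intCast (n : ℤ)
    simpa using this
  rw [this, this]
  have h2 : ∀ a b : ℕ, a ≤ b → (a : ℝ≥0∞) ≤ wt b := fun a b hab => by
    rw [wt_eq]; exact_mod_cast hab.trans (Nat.le_succ b)
  gcongr <;> exact h2 _ _ (by omega)

/-- The expansion `R = ∑ E_{pq} ⊗ F_{pq}` over matrix units of `ℕ^l × ℤ`: the seminorms of `E_{pq}`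
grow polynomially in `|D_p| + |D_q|`, those of the slices `F_{pq}` decay faster than any power, and
inverse powers of `|D_p| + |D_q|` are summable. -/
theorem smoothJ_reconstruct {l : ℕ} {t : Ker (Idx l × NIdx l)}
    (h : (gridB l l).Cls (vB l l) ((listN l).map Sum.inr) (fun (_ : Unit) p => absD l p.1)
      (fun _ => t)) : ∃ R ∈ (smoothJ l).carrier, ker R = t := by
  classical
  have := idx_countable l
  have := idx_infinite l
  have h1 : (gridN l).Cls 0 (listN l) (fun (p : Idx l × Idx l) _ => absD l p.1 + absD l p.2)
      (fun p x y => t (p.1, x) (p.2, y)) := by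
    refine h.slice (K' := Idx l × Idx l) (A := 2) (fun _ => ()) (fun p => p.1) (fun p => p.2)
      (by norm_num) fun p y => ?_
    have := absD_lip l p.2 p.1
    rw [Grid.d_comm] at this
    dsimp only
    omega
  obtain ⟨F, hF, hFt, hFs⟩ := toeplitzPow_reconstruct h1
  have hnorm : Rapid (fun p : Idx l × Idx l => absD l p.1 + absD l p.2) (fun p => ‖F p‖ₑ) := by
    refine Grid.Dec.rapid_norm (g := gridN l) ?_
    simp only [hFt]
    exact h1.dec
  have hsum : ∀ (m : ℕ) (f : Idx l × Idx l → ℝ≥0∞), Rapid (fun p : Idx l × Idx l =>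
      absD l p.1 + absD l p.2) f → ∑' p, wt (absD l p.1 + absD l p.2) ^ m * f p ≠ ⊤ := by
    intro m f hf
    have h2 := (hf.mul_wt (σ := fun p => absD l p.1 + absD l p.2) (fun _ => le_rfl) m)
    have h3 := (Rapid.of_le h2 (ρ' := fun p : Unit × (Idx l × Idx l) => absD l p.2.1 + absD l p.2.2)
      (f' := fun p => wt (absD l p.2.1 + absD l p.2.2) ^ m * f p.2)
      Prod.snd 1 fun p _ => ⟨le_rfl, by simp⟩).tsum_weight (ρ := fun _ => 0)
      (exists_tsum_prod (absD_pow_tsum l) (absD_pow_tsum l)) fun _ _ => (zero_add _).le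
    exact h3.ne_top ()
  have hs : Summable fun p : Idx l × Idx l => tensor (unitOp p) (F p) := by
    refine summable_of_tsum_enorm (ne_top_of_le_ne_top (hsum 0 _ hnorm)
      (ENNReal.tsum_le_tsum fun p => (enorm_tensor_le _ _).trans ?_))
    rw [pow_zero, enorm_unitOp]
  have hr := projTensor_of_hasSum (A := smoothing l) (B := toeplitzPow l)
    (x := unitOp) (fun p m n => ⟨_, isDTD_unitOp p m n⟩) hF
    (fun m r => ne_top_of_le_ne_top (hsum (m.1 + m.2) _ (hFs r))
      (ENNReal.tsum_le_tsum fun p => mul_le_mul_left (unitOp_seminorm_le p m) _)) hs.hasSum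
  refine ⟨_, hr.1, ?_⟩
  funext p q
  refine (hasSum_ker hs.hasSum p q).unique ?_
  simp only [ker_tensor, hFt, ker_unitOp]
  convert hasSum_single (p.1, q.1) fun r hr => ?_ using 1
  · simp
  · rw [if_neg, zero_mul]
    exact fun e => hr (Prod.ext e.1.symm e.2.symm)

end QSphere

end

noncomputable section

namespace QSphere

/-! ### The characterisation of `{a ⊗ 1 + R}` by estimates -/

namespace Grid

variable {X ι : Type} [Fintype ι] {g : Grid X ι} {K : Type}
variable {v : ι → X → ℕ} {w W : K → X → ℕ} {t : K → Ker X}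

theorem Dec.grad (hw : ∀ k, g.Lip (w k)) (i : ι) (h : g.Dec w t) :
    g.Dec w (fun k => g.grad i (t k)) :=
  (h.shift hw i).sub h

theorem Dec.off (i : ι) (h : g.Dec w t) : g.Dec w (fun k => g.off i (t k)) :=
  h.mono fun k => off_off_le i (t k)

theorem off_sub (i : ι) (s t : Ker X) : g.off i (s - t) = g.off i s - g.off i t := by
  funext x y
  simp only [off, Pi.sub_apply]
  split_ifs <;> simp

theorem Cls.dec_grad {L : List ι} (h : g.Cls v L w t) {i : ι} (hi : i ∈ L) :
    g.Dec (fun k => w k ⊔ (v i ⊔ g.u i)) (fun k => g.grad i (t k)) := by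
  induction L with
  | nil => simp at hi
  | cons j L ih =>
    rw [cls_cons] at h
    rcases List.mem_cons.1 hi with rfl | hi
    · exact h.2.dec
    · exact ih h.1 hi

theorem Dec.cls_of_grad_eq_zero {L : List ι} (h : g.Dec w t) (h0 : ∀ i ∈ L, ∀ k, g.grad i (t k) = 0) :
    g.Cls v L w t := by
  induction L with
  | nil => exact cls_nil.2 h
  | cons i L ih =>
    rw [cls_cons]
    refine ⟨ih fun j hj => h0 j (List.mem_cons_of_mem _ hj), ?_⟩
    simp only [h0 i List.mem_cons_self]
    exact cls_zero

/-- Two kernels with the same differences share every estimate that involves at least one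
difference, provided that the weights agree after the first gain. Only the undifferentiated estimate
has to be supplied. -/
theorem Cls.transfer {L : List ι} {w₁ : K → X → ℕ} {t₁ : K → Ker X} (h : g.Cls v L w t)
    (h₁ : g.Dec w₁ t₁) (hw : ∀ i ∈ L, ∀ k, w k ⊔ (v i ⊔ g.u i) = w₁ k ⊔ (v i ⊔ g.u i))
    (h0 : ∀ i ∈ L, ∀ k, g.grad i (t₁ k) = g.grad i (t k)) : g.Cls v L w₁ t₁ := by
  induction L with
  | nil => exact cls_nil.2 h₁
  | cons i L ih =>
    rw [cls_cons] at h ⊢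
    refine ⟨ih h.1 (fun j hj => hw j (List.mem_cons_of_mem _ hj))
      fun j hj => h0 j (List.mem_cons_of_mem _ hj), ?_⟩
    simp only [h0 i List.mem_cons_self, ← hw i List.mem_cons_self]
    exact h.2

theorem grad_eq_zero_of_ne {i j : ι} (hij : i ≠ j) {t : Ker X} (h : g.grad i t = 0) :
    g.grad i (g.grad j t) = 0 := by
  have h2 : ∀ x y, t (g.s i x) (g.s i y) = t x y := fun x y =>
    sub_eq_zero.1 (congrFun (congrFun h x) y)
  funext x y
  simp only [Grid.grad]
  rw [← g.s_comm hij, ← g.s_comm hij, h2, h2]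
  simp

theorem off_eq_zero_of_grad {i j : ι} {t : Ker X} (h : g.grad i t = 0) :
    g.grad i (g.off j t) = 0 := by
  funext x y
  rw [← Grid.off_grad, h]
  simp [Grid.off]

/-- An invariant kernel that decays in the direction of its invariance vanishes. -/
theorem Dec.eq_zero_of_unbounded {i : ι} (hW : ∀ k x, ∃ B, ∀ N, N ≤ B + W k ((g.s i)^[N] x))
    (h : g.Dec W t) (ht : ∀ k, g.grad i (t k) = 0) (k : K) : t k = 0 := by
  obtain ⟨C, hC⟩ := h 1
  funext x y
  obtain ⟨B, hB⟩ := hW k x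
  rw [Pi.zero_apply, Pi.zero_apply, ← enorm_eq_zero]
  refine eq_zero_of_bound (C := (B + 1 : ℕ) * C) fun N => ?_
  have h1 := hC (k, (g.s i)^[N] x, (g.s i)^[N] y)
  simp only [pow_one, eq_iterate_of_grad (ht k)] at h1
  calc wt N * ‖t k x y‖ₑ ≤ (wt B * wt (g.d ((g.s i)^[N] x) ((g.s i)^[N] y) + W k ((g.s i)^[N] x))) *
        ‖t k x y‖ₑ := by
        gcongr
        refine (wt_mono ?_).trans (wt_add_le _ _)
        have := hB N
        omega
    _ = wt B * (wt (g.d ((g.s i)^[N] x) ((g.s i)^[N] y) + W k ((g.s i)^[N] x)) * ‖t k x y‖ₑ) := by ring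
    _ ≤ wt B * C := by gcongr
    _ = _ := by rw [wt_eq]; push_cast; rfl

/-- The translates of a kernel converge if the differences are summable. -/
theorem tendsto_translate {i : ι} {t : Ker X} {x y : X}
    (h : Summable fun N : ℕ => g.grad i t ((g.s i)^[N] x) ((g.s i)^[N] y)) :
    Filter.Tendsto (fun N : ℕ => t ((g.s i)^[N] x) ((g.s i)^[N] y)) Filter.atTop
      (nhds ((t - g.tail i (g.grad i t)) x y)) := by
  have h1 := h.hasSum.tendsto_sum_nat
  have h2 : ∀ M : ℕ, ∑ N ∈ Finset.range M, g.grad i t ((g.s i)^[N] x) ((g.s i)^[N] y) =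
      t ((g.s i)^[M] x) ((g.s i)^[M] y) - t x y := fun M => by
    have := Finset.sum_range_sub (fun N => t ((g.s i)^[N] x) ((g.s i)^[N] y)) M
    simp only [Function.iterate_succ_apply'] at this
    exact this
  simp only [h2] at h1
  have h3 := h1.const_add (t x y)
  simp only [add_sub_cancel] at h3
  convert h3 using 2
  simp [Grid.tail]

end Grid

theorem mem_listN (n : ℕ) (j : NIdxDir n) : j ∈ listN n := by
  induction n with
  | zero => exact j.elim
  | succ n ih =>
    rcases j with j | j
    · exact List.mem_cons_self
    · exact List.mem_cons_of_mem _ (List.mem_map_of_mem (ih j))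

/-! ### Operators of the form `a ⊗ 1` and smoothing operators are good -/

section

variable {n m : ℕ}

/-- The direction of `ℤ` in `(ℕ^n × ℤ) × ℕ^m`. -/
abbrev zB (n m : ℕ) : IdxDir n ⊕ NIdxDir m := Sum.inl (zdir n)

theorem lip_absD_fst (n m : ℕ) : (gridB n m).Lip fun p => absD n p.1 := Grid.Lip.fst _ _ (absD_lip n)

theorem c_iterate_zB (N : ℕ) (p : Idx n × NIdx m) :
    (gridB n m).c (((gridB n m).s (zB n m))^[N] p) (zB n m) = (gridB n m).c p (zB n m) + N :=
  Grid.c_iterate _ _ _ _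

theorem pre_s_zdir (x : Idx n) : pre n (zdir n) ((gridI n).s (zdir n) x) = pre n (zdir n) x := by
  induction n with
  | zero => rfl
  | succ n ih =>
    have h1 : (gridI (n + 1)).s (zdir (n + 1)) x = (x.1, (gridI n).s (zdir n) x.2) := rfl
    rw [h1]
    simp only [zdir, pre]
    rw [ih]

theorem pre_iterate_zB (N : ℕ) (p : Idx n × NIdx m) :
    pre n (zdir n) (((gridB n m).s (zB n m))^[N] p).1 = pre n (zdir n) p.1 := by
  induction N with
  | zero => rfl
  | succ N ih =>
    rw [Function.iterate_succ_apply', ← ih]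
    exact pre_s_zdir _

theorem absD_eq (p : Idx n × NIdx m) :
    absD n p.1 = pre n (zdir n) p.1 + (gridB n m).u (zB n m) p := (pre_zdir n p.1).symm

theorem le_absD_iterate (N : ℕ) (p : Idx n × NIdx m) :
    N ≤ (gridB n m).u (zB n m) p + absD n (((gridB n m).s (zB n m))^[N] p).1 := by
  rw [absD_eq]
  have := c_iterate_zB N p
  simp only [Grid.u]
  omega

theorem wzB_eq (N : ℕ) (p : Idx n × NIdx m) : wzB n m N p = max (pre n (zdir n) p.1)
    (min ((gridB n m).u (zB n m) p) ((gridB n m).u (zB n m) (((gridB n m).s (zB n m))^[N] p))) := rfl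

theorem wzB_le_absD (N : ℕ) (p : Idx n × NIdx m) : wzB n m N p ≤ absD n p.1 := by
  rw [absD_eq, wzB_eq]
  omega

theorem wzB_le_absD_iterate (N : ℕ) (p : Idx n × NIdx m) :
    wzB n m N p ≤ absD n (((gridB n m).s (zB n m))^[N] p).1 := by
  rw [absD_eq, pre_iterate_zB, wzB_eq]
  omega

theorem vB_le_absD (i : IdxDir n ⊕ NIdxDir m) (p : Idx n × NIdx m) : vB n m i p ≤ absD n p.1 := by
  rcases i with i | j
  · have := pre_add_u_le n i p.1
    simp only [vB]
    omega
  · exact le_rfl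

/-- Kernels with decay in `|D|` are good. -/
theorem good_of_cls {t : Ker (Idx n × NIdx m)}
    (h : (gridB n m).Cls (vB n m) ((listN m).map Sum.inr) (fun (_ : Unit) p => absD n p.1)
      (fun _ => t)) : (frameB n m).Good (fun _ : Unit => t) where
  dec := h.dec.weight 1 fun _ _ => Nat.zero_le _
  off i := (h.dec.off i).weight 1 fun _ p => by
    have := vB_le_absD i p
    change vB n m i p ≤ _
    omega
  cls L hL := by
    rcases hL with ⟨i, -, rfl⟩ | rfl
    · rw [Grid.cls_cons, Grid.cls_nil, Grid.cls_nil]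
      refine ⟨h.dec.weight 1 fun _ _ => Nat.zero_le _,
        (h.dec.grad (fun _ => lip_absD_fst n m) (Sum.inl i)).weight 1 fun _ p => ?_⟩
      have := pre_add_u_le n i p.1
      change max 0 (max (pre n i p.1) ((gridI n).u i p.1)) ≤ _
      omega
    · exact h.weight 1 (fun _ _ => Nat.zero_le _) fun i _ _ p => by
        change vB n m i p ≤ _
        omega
  transl := by
    -- The kernel and its translate are estimated separately: `|D|`, both at the point and at its
    -- translate, dominates the weight.
    have h1 : (gridB n m).Dec (fun k : Unit × ℕ => wzB n m k.2) (fun _ => t) :=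
      (h.dec.comp fun _ : Unit × ℕ => ()).weight 1 fun k p => by
        have := wzB_le_absD k.2 p
        omega
    have h2 : (gridB n m).Dec (fun k : Unit × ℕ => wzB n m k.2) (fun k x y =>
        t (((gridB n m).s (zB n m))^[k.2] x) (((gridB n m).s (zB n m))^[k.2] y)) := by
      refine Rapid.of_le h.dec (fun p => ((), ((gridB n m).s (zB n m))^[p.1.2] p.2.1,
        ((gridB n m).s (zB n m))^[p.1.2] p.2.2)) 1 fun p _ => ⟨le_rfl, ?_⟩
      have := wzB_le_absD_iterate p.1.2 p.2.1
      simp only [Grid.d_iterate]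
      omega
    exact h2.sub h1

/-- Kernels of the form `a ⊗ 1` are good. -/
theorem good_of_aFamily {t : Ker (Idx n)} (h : AFamily n (fun _ : Unit => 0) (fun _ => t)) :
    (frameB n m).Good (fun _ : Unit => Grid.tmul t (ker (1 : Op (NIdx m)))) := by
  classical
  have key : ∀ (w : Idx n → ℕ) (s : Ker (Idx n)), (gridI n).Dec (fun _ : Unit => w) (fun _ => s) →
      (gridB n m).Dec (fun (_ : Unit) p => w p.1)
        (fun _ => Grid.tmul s (ker (1 : Op (NIdx m)))) := by
    intro w s hs
    refine Rapid.of_le hs (fun p => ((), p.2.1.1, p.2.2.1)) 1 fun p hp => ?_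
    simp only [Grid.tmul, ker_one] at hp ⊢
    by_cases h1 : p.2.1.2 = p.2.2.2
    · refine ⟨by simp [h1], ?_⟩
      rw [gridB, Grid.prod_d, h1, Grid.d_self]
      omega
    · simp [h1] at hp
  have hz : ∀ w : Idx n → ℕ, (fun _ => 0) ⊔ w = w := fun w => by funext x; simp
  have hgr : ∀ j, (gridB n m).grad (Sum.inr j) (Grid.tmul t (ker (1 : Op (NIdx m)))) = 0 := by
    intro j
    rw [gridB, Grid.grad_inr_tmul]
    have : (gridN m).grad j (ker (1 : Op (NIdx m))) = 0 := by
      funext x y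
      simp [Grid.grad, ker_one, ((gridN m).s_inj j).eq_iff]
    rw [this]
    funext p q
    simp [Grid.tmul]
  have hgl : ∀ i, (gridB n m).grad (Sum.inl i) (Grid.tmul t (ker (1 : Op (NIdx m)))) =
      Grid.tmul ((gridI n).grad i t) (ker (1 : Op (NIdx m))) := fun i => Grid.grad_inl_tmul _ _ _
  have hdec := key (fun _ => 0) t h.dec
  refine ⟨hdec, fun i => ?_, fun L hL => ?_, ?_⟩
  · rcases i with i | j
    · have h1 := h.off i
      simp only [hz] at h1
      refine (key _ _ h1).mono fun _ p q => le_of_eq ?_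
      have hc : ∀ p : Idx n × NIdx m, (gridB n m).c p (Sum.inl i) = (gridI n).c p.1 i := fun _ => rfl
      change ‖(gridB n m).off _ _ p q‖ₑ = _
      simp only [Grid.off, Grid.tmul, hc]
      split_ifs <;> simp
    · refine Grid.dec_zero.mono fun _ p q => ?_
      have hc : ∀ p : Idx n × NIdx m, (gridB n m).c p (Sum.inr j) = (gridN m).c p.2 j := fun _ => rfl
      change ‖(gridB n m).off _ _ p q‖ₑ ≤ _
      simp only [Grid.off, Grid.tmul, hc, ker_one]
      split_ifs with h1 h2
      · simp
      · exact absurd (by rw [h2]) h1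
      · simp
  · rcases hL with ⟨i, hi, rfl⟩ | rfl
    · have h1 := h.grad i hi
      simp only [hz] at h1
      rw [Grid.cls_cons, Grid.cls_nil, Grid.cls_nil]
      refine ⟨hdec, ?_⟩
      change (gridB n m).Dec _ (fun _ => (gridB n m).grad _ _)
      rw [hgl]
      exact (key _ _ h1).weight 1 fun _ p => by
        change max 0 (max (pre n i p.1) ((gridI n).u i p.1)) ≤ _
        simp only [Pi.sup_apply]
        omega
    · refine hdec.cls_of_grad_eq_zero fun i hi _ => ?_
      obtain ⟨j, -, rfl⟩ := List.mem_map.1 hi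
      exact hgr j
  · refine Grid.dec_zero.mono fun k p q => ?_
    have h1 : (gridB n m).grad (zB n m) (Grid.tmul t (ker (1 : Op (NIdx m)))) = 0 := by
      rw [hgl, h.inv ()]
      funext p q
      simp [Grid.tmul]
    have h2 := Grid.eq_iterate_of_grad h1 k.2 p q
    change ‖Grid.transl (gridB n m) (zB n m) k.2 _ p q‖ₑ ≤ _
    rw [Grid.transl, h2]
    simp

theorem eq_zero_of_dec_absD {s : Ker (Idx n × NIdx m)}
    (hs : (gridB n m).Dec (fun (_ : Unit) p => absD n p.1) (fun _ => s))
    (h0 : (gridB n m).grad (zB n m) s = 0) : s = 0 :=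
  Grid.Dec.eq_zero_of_unbounded (i := zB n m)
    (fun _ p => ⟨(gridB n m).u (zB n m) p, fun N => le_absD_iterate N p⟩) hs (fun _ => h0) ()

end

/-! ### A good kernel is the sum of an invariant and a smoothing part -/

section Decompose

variable {n m : ℕ} {t : Ker (Idx n × NIdx m)}

/-- The part of a good kernel that decays in `|D|`. -/
def smoothPart (t : Ker (Idx n × NIdx m)) : Ker (Idx n × NIdx m) :=
  (gridB n m).tail (zB n m) ((gridB n m).grad (zB n m) t)

variable (h : (frameB n m).Good (fun _ : Unit => t))

include h

/-- The translation estimate with `N = 1`, at a point moved `r` steps along `ℤ`, has a weight of at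
least `r - |z|`, where `z` is the original last coordinate. -/
theorem summable_grad_z (p q : Idx n × NIdx m) : Summable fun N : ℕ =>
    (gridB n m).grad (zB n m) t (((gridB n m).s (zB n m))^[N] p) (((gridB n m).s (zB n m))^[N] q) := by
  refine summable_of_tsum_enorm ?_
  have h1 : Rapid (fun p : Unit × ℕ => p.2) (fun r => ‖(gridB n m).grad (zB n m) t
      (((gridB n m).s (zB n m))^[r.2] p) (((gridB n m).s (zB n m))^[r.2] q)‖ₑ) := by
    refine Rapid.of_le h.transl (fun r => (((), 1), ((gridB n m).s (zB n m))^[r.2] p,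
      ((gridB n m).s (zB n m))^[r.2] q)) (1 + (gridB n m).u (zB n m) p) fun r _ => ⟨le_rfl, ?_⟩
    have e1 := c_iterate_zB r.2 p
    have e2 := c_iterate_zB 1 (((gridB n m).s (zB n m))^[r.2] p)
    have e3 : r.2 ≤ (gridB n m).u (zB n m) p + wzB n m 1 (((gridB n m).s (zB n m))^[r.2] p) := by
      rw [wzB_eq]
      simp only [Grid.u]
      omega
    refine e3.trans ?_
    change _ ≤ (1 + (gridB n m).u (zB n m) p) * (1 + ((gridB n m).d _ _ + wzB n m 1 _))
    nlinarith [Nat.zero_le ((gridB n m).d (((gridB n m).s (zB n m))^[r.2] p)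
      (((gridB n m).s (zB n m))^[r.2] q)), Nat.zero_le ((gridB n m).u (zB n m) p),
      Nat.zero_le (wzB n m 1 (((gridB n m).s (zB n m))^[r.2] p))]
  exact (h1.tsum_weight (ρ := fun _ => 0) exists_tsum_nat fun _ _ => (zero_add _).le).ne_top ()

theorem tendsto_invPart (p q : Idx n × NIdx m) : Filter.Tendsto (fun N : ℕ =>
    t (((gridB n m).s (zB n m))^[N] p) (((gridB n m).s (zB n m))^[N] q)) Filter.atTop
      (nhds ((t - smoothPart t) p q)) :=
  Grid.tendsto_translate (summable_grad_z h p q)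

/-- The limit of the translates does not notice one more translation. -/
theorem inv_invPart : (gridB n m).grad (zB n m) (t - smoothPart t) = 0 := by
  funext p q
  have h1 := tendsto_invPart h ((gridB n m).s (zB n m) p) ((gridB n m).s (zB n m) q)
  have h2 := (Filter.tendsto_add_atTop_iff_nat 1).2 (tendsto_invPart h p q)
  simp only [Function.iterate_succ_apply] at h2
  exact sub_eq_zero.2 (tendsto_nhds_unique h1 h2)

/-- `-smoothPart t` is the limit of the translation differences of `t`, whose estimates are uniform
in `N`; in the limit their weight becomes comparable to `|D|`. -/
theorem dec_smoothPart : (gridB n m).Dec (fun (_ : Unit) p => absD n p.1)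
    (fun _ => smoothPart t) := by
  intro r
  obtain ⟨C, hC⟩ := h.transl r
  refine ⟨((3 : ℕ) : NNReal) ^ r * C, fun k => ?_⟩
  obtain ⟨_, p, q⟩ := k
  have h1 := (tendsto_invPart h p q).sub_const (t p q)
  have h2 : (t - smoothPart t) p q - t p q = -smoothPart t p q := by
    simp only [Pi.sub_apply]; ring
  rw [h2] at h1
  have h3 := ENNReal.Tendsto.const_mul (a := wt ((gridB n m).d p q + absD n p.1) ^ r) h1.enorm
    (Or.inr (wt_pow_ne_top _ _))
  rw [enorm_neg] at h3
  -- `N ≥ 2|z|` gives `|z + N| ≥ |z|`, so the minimum in the weight is `|z|`, and the maximum of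
  -- `|z|` and the preceding sum is at least half of `|D|`.
  refine le_of_tendsto h3 (Filter.eventually_atTop.2 ⟨2 * (gridB n m).u (zB n m) p, fun N hN => ?_⟩)
  have h4 : wt ((gridB n m).d p q + absD n p.1) ≤ wt 2 * wt ((gridB n m).d p q + wzB n m N p) := by
    refine wt_le_mul ?_
    have e1 := c_iterate_zB N p
    have e2 := absD_eq p
    rw [e2, wzB_eq]
    simp only [Grid.u] at hN ⊢
    omega
  have h5 : wt ((gridB n m).d p q + wzB n m N p) ^ r *
      ‖t (((gridB n m).s (zB n m))^[N] p) (((gridB n m).s (zB n m))^[N] q) - t p q‖ₑ ≤ C :=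
    hC (((), N), p, q)
  calc wt ((gridB n m).d p q + absD n p.1) ^ r *
        ‖t (((gridB n m).s (zB n m))^[N] p) (((gridB n m).s (zB n m))^[N] q) - t p q‖ₑ
      ≤ (wt 2 * wt ((gridB n m).d p q + wzB n m N p)) ^ r *
        ‖t (((gridB n m).s (zB n m))^[N] p) (((gridB n m).s (zB n m))^[N] q) - t p q‖ₑ := by gcongr
    _ = wt 2 ^ r * (wt ((gridB n m).d p q + wzB n m N p) ^ r *
        ‖t (((gridB n m).s (zB n m))^[N] p) (((gridB n m).s (zB n m))^[N] q) - t p q‖ₑ) := by ring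
    _ ≤ wt 2 ^ r * C := by gcongr
    _ = _ := by rw [wt_eq]; push_cast; norm_num

/-- Entries that change a coordinate of the second factor decay in `|D|`, for `t` as well as for its
smoothing part. Being also invariant along `ℤ`, those of the invariant part vanish. -/
theorem off_inr_invPart (j : NIdxDir m) : (gridB n m).off (Sum.inr j) (t - smoothPart t) = 0 := by
  refine eq_zero_of_dec_absD ?_ (Grid.off_eq_zero_of_grad (inv_invPart h))
  rw [Grid.off_sub]
  exact (h.off (Sum.inr j)).sub ((dec_smoothPart h).off (Sum.inr j))

theorem grad_inr_invPart (j : NIdxDir m) : (gridB n m).grad (Sum.inr j) (t - smoothPart t) = 0 := by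
  refine eq_zero_of_dec_absD ?_ (Grid.grad_eq_zero_of_ne Sum.inl_ne_inr (inv_invPart h))
  rw [Grid.grad_sub]
  refine Grid.Dec.sub ?_ ((dec_smoothPart h).grad (fun _ => lip_absD_fst n m) (Sum.inr j))
  refine ((h.cls _ (Or.inr rfl)).dec_grad (List.mem_map_of_mem (mem_listN m j))).weight 1
    fun _ p => ?_
  change _ ≤ 1 * (1 + max 0 (max (absD n p.1) _))
  omega

theorem aFamily_invPart (y : NIdx m) : AFamily n (fun _ : Unit => 0)
    (fun _ x x' => (t - smoothPart t) (x, y) (x', y)) := by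
  have hz : ∀ w : Idx n → ℕ, (fun _ => 0) ⊔ w = w := fun w => by funext x; simp
  have key : ∀ (w : Idx n → ℕ) (s : Ker (Idx n × NIdx m)),
      (gridB n m).Dec (fun (_ : Unit) p => w p.1) (fun _ => s) →
      (gridI n).Dec (fun _ : Unit => w) (fun _ x x' => s (x, y) (x', y)) := by
    intro w s hs
    refine Rapid.of_le hs (fun p => ((), (p.2.1, y), (p.2.2, y))) 1 fun p _ => ⟨le_rfl, ?_⟩
    rw [gridB, Grid.prod_d]
    dsimp only
    omega
  have hR := dec_smoothPart h
  refine ⟨?_, fun i => ?_, fun i hi => ?_, fun _ => ?_⟩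
  · exact key (fun _ => 0) _ (h.dec.sub (hR.weight 1 fun _ _ => Nat.zero_le _))
  · simp only [hz]
    refine key (pre n i) ((gridB n m).off (Sum.inl i) (t - smoothPart t)) ?_
    rw [Grid.off_sub]
    refine (h.off (Sum.inl i)).sub ((hR.off (Sum.inl i)).weight 1 fun _ p => ?_)
    have := vB_le_absD (m := m) (Sum.inl i) p
    change pre n i p.1 ≤ _ at this
    change pre n i p.1 ≤ _
    omega
  · simp only [hz]
    refine key (pre n i ⊔ (gridI n).u i) ((gridB n m).grad (Sum.inl i) (t - smoothPart t)) ?_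
    rw [Grid.grad_sub]
    refine Grid.Dec.sub ?_ ?_
    · refine ((h.cls _ (Or.inl ⟨i, hi, rfl⟩)).dec_grad List.mem_cons_self).weight 1 fun _ p => ?_
      change max (pre n i p.1) ((gridI n).u i p.1) ≤
        1 * (1 + max 0 (max (pre n i p.1) ((gridI n).u i p.1)))
      omega
    · refine (hR.grad (fun _ => lip_absD_fst n m) (Sum.inl i)).weight 1 fun _ p => ?_
      have := pre_add_u_le n i p.1
      simp only [Pi.sup_apply]
      omega
  · funext x x'
    exact congrFun (congrFun (inv_invPart h) (x, y)) (x', y)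

/-- The invariant part neither changes the coordinates of `ℕ^m` nor depends on them. -/
theorem invPart_eq (y : NIdx m) : t - smoothPart t =
    Grid.tmul (fun x x' => (t - smoothPart t) (x, y) (x', y)) (ker (1 : Op (NIdx m))) := by
  classical
  funext p q
  rw [Grid.tmul, ker_one]
  split_ifs with h1
  · rw [mul_one]
    obtain ⟨x, z⟩ := p
    obtain ⟨x', z'⟩ := q
    simp only at h1
    subst h1
    exact (gridN m).const (fun z => (t - smoothPart t) (x, z) (x', z)) (fun j z =>
      sub_eq_zero.1 (congrFun (congrFun (grad_inr_invPart h j) (x, z)) (x', z))) z y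
  · have : ∃ j, (gridN m).c p.2 j ≠ (gridN m).c q.2 j := by
      by_contra hc
      push Not at hc
      exact h1 ((gridN m).c_inj (funext hc))
    obtain ⟨j, hj⟩ := this
    have h2 := congrFun (congrFun (off_inr_invPart h j) p) q
    have h3 : (gridB n m).c p (Sum.inr j) ≠ (gridB n m).c q (Sum.inr j) := hj
    rw [Grid.off, if_neg h3] at h2
    rw [mul_zero]
    exact h2

/-- In the directions of `ℕ^m` the smoothing part has the same differences as `t`. Since their
weight is `|D|`, the estimates of `t` carry over once one difference has been taken. -/
theorem cls_smoothPart : (gridB n m).Cls (vB n m) ((listN m).map Sum.inr)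
    (fun (_ : Unit) p => absD n p.1) (fun _ => smoothPart t) := by
  refine (h.cls _ (Or.inr rfl)).transfer (dec_smoothPart h) (fun i hi _ => ?_) fun i hi _ => ?_
  · obtain ⟨j, -, rfl⟩ := List.mem_map.1 hi
    funext p
    change max 0 (max (absD n p.1) _) = max (absD n p.1) (max (absD n p.1) _)
    omega
  · obtain ⟨j, -, rfl⟩ := List.mem_map.1 hi
    have h1 := grad_inr_invPart h j
    rw [Grid.grad_sub, sub_eq_zero] at h1
    exact h1.symm

end Decompose

/-- The operators `a ⊗ 1 + R` are characterised by estimates for their entries. -/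
theorem good_iff {l : ℕ} {T : Op (Idx l × NIdx l)} :
    (frameB l l).Good (fun _ : Unit => ker T) ↔
      ∃ a ∈ (smoothA l).carrier, ∃ R ∈ (smoothJ l).carrier, T = tensor a 1 + R := by
  constructor
  · intro h
    obtain ⟨a, ha, hat⟩ := mem_smoothA_of_aFamily (aFamily_invPart h (nzero l))
    obtain ⟨R, hR, hRt⟩ := smoothJ_reconstruct (cls_smoothPart h)
    refine ⟨a, ha, R, hR, ker_ext fun p q => ?_⟩
    rw [ker_add, ker_tensor_eq, hRt, hat, ← invPart_eq h]
    simp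
  · rintro ⟨a, ha, R, hR, rfl⟩
    have h1 := (good_of_aFamily (m := l) (aFamily_of_mem ha)).add (good_of_cls (smoothJ_cls hR))
    rw [← ker_tensor_eq] at h1
    exact h1

end QSphere

end

noncomputable section

namespace QSphere

/-! ### The symbol map -/

/-- The last coordinate. -/
def zcoord : (l : ℕ) → Idx l → ℤ
  | 0, x => x
  | n + 1, x => zcoord n x.2

/-- The translation of the last coordinate. -/
def zshift : (l : ℕ) → ℤ → Idx l → Idx l
  | 0, k, x => (x + k : ℤ)
  | n + 1, k, x => (x.1, zshift n k x.2)

theorem zcoord_zshift (l : ℕ) (k : ℤ) (x : Idx l) : zcoord l (zshift l k x) = zcoord l x + k := by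
  induction l with
  | zero => rfl
  | succ l ih => exact ih x.2

theorem zshift_inj (l : ℕ) (k : ℤ) {x y : Idx l} : zshift l k x = zshift l k y ↔ x = y := by
  refine ⟨fun h => ?_, fun h => by rw [h]⟩
  induction l with
  | zero => exact add_right_cancel (b := k) h
  | succ l ih =>
    have h1 := congrArg (Prod.fst : ℕ × Idx l → ℕ) h
    have h2 := congrArg (Prod.snd : ℕ × Idx l → Idx l) h
    exact Prod.ext h1 (ih h2)

theorem zcoord_le_absD (l : ℕ) (x : Idx l) : (zcoord l x).natAbs ≤ absD l x := by
  induction l with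
  | zero => exact le_rfl
  | succ l ih => exact (ih x.2).trans (Nat.le_add_left _ _)

theorem ker_zshift {l : ℕ} {a : Op (Idx l)} (ha : a ∈ (smoothA l).carrier) (k : ℤ) (x y : Idx l) :
    ker a (zshift l k x) (zshift l k y) = ker a x y := by
  classical
  induction l with
  | zero =>
    obtain ⟨c, h⟩ := ha
    rw [h.ker_eq, h.ker_eq]
    exact congrArg c (add_sub_add_right_eq_sub (x : ℤ) y k)
  | succ l ih =>
    obtain ⟨b, c, h⟩ := ha
    rw [h.ker_eq, h.ker_eq]
    change ker (b (x.1, y.1)) (zshift l k x.2) (zshift l k y.2) +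
      (if zshift l k x.2 = zshift l k y.2 then c ((y.1 : ℤ) - x.1) else 0) = _
    rw [ih (h.1 _)]
    simp only [zshift_inj]

open scoped Classical in
theorem ker_F (l : ℕ) (x y : Idx l) :
    ker (F l) x y = if x = y then (if 0 ≤ zcoord l y then 1 else -1) else 0 := by
  induction l with
  | zero =>
    have h : F 0 (e y) = (if 0 ≤ zcoord 0 y then (1 : ℂ) else -1) • (e y : L2 ℤ) := isom_e _ orthonormal_sign y
    rw [ker, h]
    simp only [lp.coeFn_smul, Pi.smul_apply, e_apply, smul_eq_mul]
    split_ifs <;> simp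
  | succ l ih =>
    rw [F, ker_tensor, ih, ker_one]
    have : x = y ↔ x.1 = y.1 ∧ x.2 = y.2 := Prod.ext_iff
    have h2 : zcoord (l + 1) y = zcoord l y.2 := rfl
    rw [h2]
    by_cases h3 : x.1 = y.1 <;> by_cases h4 : x.2 = y.2 <;> simp [this, h3, h4]

theorem PF_e (l : ℕ) (y : Idx l) : PF l (e y) = (if 0 ≤ zcoord l y then (1 : ℂ) else 0) • e y := by
  classical
  ext x
  have h1 : (PF l (e y)) x = (1 / 2 : ℂ) * (ker (1 : Op (Idx l)) x y + ker (F l) x y) := rfl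
  rw [h1, ker_F, ker_one]
  simp only [lp.coeFn_smul, Pi.smul_apply, e_apply, smul_eq_mul]
  split_ifs <;> norm_num

theorem ker_mul_PF {l : ℕ} (a : Op (Idx l)) (x y : Idx l) :
    ker (a * PF l) x y = if 0 ≤ zcoord l y then ker a x y else 0 := by
  change (a (PF l (e y))) x = _
  rw [PF_e, map_smul]
  simp only [lp.coeFn_smul, Pi.smul_apply, smul_eq_mul]
  split_ifs
  · rw [one_mul]; rfl
  · rw [zero_mul]

open scoped Classical in
theorem ker_symbolLift {l : ℕ} (a : Fin 4 → Op (Idx l)) (p q : Idx l) (y : NIdx l) :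
    ker (symbolLift l a) (p, y) (q, y) =
      if y = nzero l then (if 0 ≤ zcoord l q then ker (a 0) p q else ker (a 2) p q)
      else (if 0 ≤ zcoord l q then ker (a 1) p q else ker (a 3) p q) := by
  simp only [symbolLift, ker_add, ker_tensor, mul_sub, mul_one, ker_sub, ker_mul_PF, ker_one, P0,
    ker_proj, and_self, if_true]
  split_ifs <;> simp

theorem symbolLift_diag {l : ℕ} (a : Op (Idx l)) : symbolLift l (diag l a) = tensor a 1 := by
  refine ker_ext fun p q => ?_
  simp only [symbolLift, diag, ker_add, ker_tensor, mul_sub, mul_one, ker_sub]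
  ring

/-- A multi-index different from zero if `ℓ ≥ 1`. -/
def nunit : (l : ℕ) → NIdx l
  | 0 => ()
  | n + 1 => (1, nzero n)

theorem nunit_ne {l : ℕ} (hl : 1 ≤ l) : nunit l ≠ nzero l := by
  cases l with
  | zero => omega
  | succ l => exact fun h => one_ne_zero (congrArg Prod.fst h)

/-- `|D|` is at least the absolute value of the last coordinate, so the entries of `R` fall off
along both half-lines of `ℤ`. -/
theorem tendsto_ker_smoothJ {l : ℕ} {R : Op (Idx l × NIdx l)} (hR : R ∈ (smoothJ l).carrier) {σ : ℤ}
    (hσ : σ.natAbs = 1) (p q : Idx l) (y : NIdx l) : Filter.Tendsto (fun N : ℕ =>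
      ker R (zshift l (σ * N) p, y) (zshift l (σ * N) q, y)) Filter.atTop (nhds 0) := by
  obtain ⟨C, hC⟩ := (smoothJ_cls hR).dec 1
  set B : ℝ := ((zcoord l p).natAbs + 1 : ℕ) * C
  have hB : ∀ N : ℕ, ‖ker R (zshift l (σ * N) p, y) (zshift l (σ * N) q, y)‖ ≤
      B * (1 / ((N : ℝ) + 1)) := by
    intro N
    have h1 := hC ((), (zshift l (σ * N) p, y), (zshift l (σ * N) q, y))
    simp only [pow_one] at h1
    have h2 : N ≤ (zcoord l p).natAbs + ((gridB l l).d (zshift l (σ * N) p, y)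
        (zshift l (σ * N) q, y) + absD l (zshift l (σ * N) p)) := by
      have h3 := zcoord_le_absD l (zshift l (σ * N) p)
      rw [zcoord_zshift] at h3
      have h4 : (σ * N).natAbs = N := by rw [Int.natAbs_mul, hσ, one_mul, Int.natAbs_natCast]
      omega
    have h5 : wt N * ‖ker R (zshift l (σ * N) p, y) (zshift l (σ * N) q, y)‖ₑ ≤
        wt (zcoord l p).natAbs * C := by
      refine (mul_le_mul_left ((wt_mono h2).trans (wt_add_le _ _)) _).trans ?_
      rw [mul_assoc]
      gcongr
    rw [wt_eq, wt_eq, enorm_eq_nnnorm] at h5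
    have h6 : ((N + 1 : ℕ) : NNReal) *
        ‖ker R (zshift l (σ * N) p, y) (zshift l (σ * N) q, y)‖₊ ≤
        (((zcoord l p).natAbs + 1 : ℕ) : NNReal) * C := by exact_mod_cast h5
    have h7 : ((N + 1 : ℕ) : ℝ) * ‖ker R (zshift l (σ * N) p, y) (zshift l (σ * N) q, y)‖ ≤ B := by
      exact_mod_cast h6
    rw [mul_one_div, le_div_iff₀ (by positivity), mul_comm]
    push_cast at h7
    exact h7
  refine squeeze_zero_norm hB ?_
  simpa using tendsto_one_div_add_atTop_nhds_zero_nat.const_mul B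

/-- The half-lines along which the four components of the symbol are read off. -/
def probe (l : ℕ) : Fin 4 → ℤ × NIdx l :=
  ![(1, nzero l), (1, nunit l), (-1, nzero l), (-1, nunit l)]

/-- The matrix entries along a half-line. -/
def probeKer (l : ℕ) (i : Fin 4) (p q : Idx l) (N : ℕ) (T : Op (Idx l × NIdx l)) : ℂ :=
  ker T (zshift l ((probe l i).1 * N) p, (probe l i).2) (zshift l ((probe l i).1 * N) q, (probe l i).2)

/-- This determines the symbol from the operator. The sign of the last coordinate selects `P_ℓ` or
`1 - P_ℓ`; the zero and a nonzero multi-index of `ℕ^ℓ` select `P` and `1 - P`. A nonzero one exists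
because `ℓ ≥ 1`. -/
theorem IsDecomp.tendsto {l : ℕ} (hl : 1 ≤ l) {x R : Op (Idx l × NIdx l)} {a : Fin 4 → Op (Idx l)}
    (h : IsDecomp l x a R) (i : Fin 4) (p q : Idx l) :
    Filter.Tendsto (fun N => probeKer l i p q N x) Filter.atTop (nhds (ker (a i) p q)) := by
  classical
  obtain ⟨ha, hR, rfl⟩ := h
  have hσ : ((probe l i).1).natAbs = 1 := by fin_cases i <;> rfl
  have h1 := tendsto_ker_smoothJ hR hσ p q (probe l i).2
  have h2 : Filter.Tendsto (fun N : ℕ => ker (symbolLift l a)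
      (zshift l ((probe l i).1 * N) p, (probe l i).2) (zshift l ((probe l i).1 * N) q, (probe l i).2))
      Filter.atTop (nhds (ker (a i) p q)) := by
    -- For `N > |z_q|` the column lies on the chosen side of `ℤ`, and from there on the entries are
    -- constant by translation invariance.
    refine tendsto_const_nhds.congr' (Filter.eventually_atTop.2 ⟨(zcoord l q).natAbs + 1,
      fun N hN => ?_⟩)
    dsimp only
    rw [ker_symbolLift, zcoord_zshift]
    simp only [ker_zshift (ha _)]
    have hu := nunit_ne hl
    fin_cases i
    · have h3 : 0 ≤ zcoord l q + 1 * N := by omega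
      simp [probe]
      intro h4
      omega
    · simp [probe, hu]
      intro h4
      omega
    · simp [probe]
      intro h4
      omega
    · simp [probe, hu]
      intro h4
      omega
  have h3 := h2.add h1
  rw [add_zero] at h3
  exact h3

theorem IsDecomp.unique {l : ℕ} (hl : 1 ≤ l) {x R R' : Op (Idx l × NIdx l)}
    {a a' : Fin 4 → Op (Idx l)} (h : IsDecomp l x a R) (h' : IsDecomp l x a' R') : a = a' :=
  funext fun i => ker_ext fun p q => tendsto_nhds_unique (h.tendsto hl i p q) (h'.tendsto hl i p q)

theorem IsDecomp.theta_eq {l : ℕ} (hl : 1 ≤ l) {x R : Op (Idx l × NIdx l)} {a : Fin 4 → Op (Idx l)}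
    (h : IsDecomp l x a R) : theta l x = a := by
  have hx : ∃ a R, IsDecomp l x a R := ⟨a, R, h⟩
  obtain ⟨R', hR'⟩ := hx.choose_spec
  have : theta l x = hx.choose := by rw [theta, dif_pos hx]
  rw [this]
  exact hR'.unique hl h

/-- The smooth functions are the members of `C_ℓ` whose entries satisfy the estimates. -/
theorem mem_smoothSphere_iff {l : ℕ} (hl : 1 ≤ l) {q : ℝ} {x : Op (Idx l × NIdx l)} :
    x ∈ smoothSphere l q ↔ x ∈ sphereAlg l q ∧ (frameB l l).Good (fun _ : Unit => ker x) := by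
  rw [good_iff]
  constructor
  · rintro ⟨⟨a, R, h⟩, hx, b, hb, hθ⟩
    rw [h.theta_eq hl] at hθ
    subst hθ
    refine ⟨hx, b, hb, R, h.2.1, ?_⟩
    rw [← symbolLift_diag]
    exact h.2.2
  · rintro ⟨hx, a, ha, R, hR, h⟩
    have hd : IsDecomp l x (diag l a) R := ⟨fun _ => ha, hR, by rw [symbolLift_diag]; exact h⟩
    exact ⟨⟨_, _, hd⟩, hx, a, ha, (hd.theta_eq hl).symm⟩

/-- The `*`-algebra of smooth functions. -/
def smoothSphereAlg {l : ℕ} (hl : 1 ≤ l) (q : ℝ) : StarSubalgebra ℂ (Op (Idx l × NIdx l)) where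
  carrier := smoothSphere l q
  mul_mem' {a b} ha hb := by
    rw [mem_smoothSphere_iff hl] at ha hb ⊢
    exact ⟨mul_mem ha.1 hb.1, ha.2.mul hb.2⟩
  add_mem' {a b} ha hb := by
    rw [mem_smoothSphere_iff hl] at ha hb ⊢
    exact ⟨add_mem ha.1 hb.1, ha.2.add hb.2⟩
  algebraMap_mem' c := by
    rw [mem_smoothSphere_iff hl]
    refine ⟨algebraMap_mem _ c, ?_⟩
    rw [Algebra.algebraMap_eq_smul_one]
    exact Frame.Good.one.smul (c := fun _ => c) ‖c‖₊ fun _ => le_rfl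
  star_mem' {a} ha := by
    rw [mem_smoothSphere_iff hl] at ha ⊢
    exact ⟨star_mem ha.1, ha.2.adjoint⟩

/-! ### Closedness -/

/-- A seminorm ball whose radius is divided by the constant lies in a norm ball. Vanishing of the
seminorms at zero puts the centre into its own ball; no triangle inequality for the seminorms is
needed. -/
theorem FrechetOps.continuous_val {ι X : Type} {A : FrechetOps ι X} (h : Ctrl A fun T => ‖T‖ₑ)
    (h0 : ∀ i, A.seminorm i 0 = 0) :
    @Continuous A.carrier (Op X) A.topology _ Subtype.val := by
  let _ := A.topology
  obtain ⟨C, M, hC, h⟩ := h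
  refine continuous_iff_continuousAt.2 fun x => Metric.tendsto_nhds.2 fun ε hε => ?_
  have hr : (0 : ℝ≥0∞) < ENNReal.ofReal ε / C :=
    ENNReal.div_pos (ENNReal.ofReal_pos.2 hε).ne' ENNReal.coe_ne_top
  have hopen : IsOpen {y : A.carrier | A.seminorm M ((y : Op X) - (x : Op X)) <
      ENNReal.ofReal ε / C} := TopologicalSpace.isOpen_generateFrom_of_mem ⟨M, x, _, hr, rfl⟩
  refine Filter.eventually_of_mem (hopen.mem_nhds ?_) fun y hy => ?_
  · change A.seminorm M ((x : Op X) - (x : Op X)) < _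
    rw [sub_self, h0]
    exact hr
  · have h1 : ‖(y : Op X) - (x : Op X)‖ₑ < ENNReal.ofReal ε := by
      refine (h _).trans_lt ?_
      rw [mul_comm]
      exact (ENNReal.lt_div_iff_mul_lt (Or.inl (by exact_mod_cast hC))
        (Or.inl ENNReal.coe_ne_top)).1 hy
    rw [dist_eq_norm]
    rw [← ofReal_norm] at h1
    exact (ENNReal.ofReal_lt_ofReal_iff hε).1 h1

theorem smoothA_zero (n : ℕ) :
    (0 : Op (Idx n)) ∈ (smoothA n).carrier ∧ ∀ m, (smoothA n).seminorm m 0 = 0 := by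
  induction n with
  | zero =>
    have hr : IsCircleRep 0 0 := ⟨fun m => by simp [rapidZ], by simp⟩
    refine ⟨⟨0, hr⟩, fun m => le_antisymm (iInf_le_of_le 0 (iInf_le_of_le hr ?_)) zero_le⟩
    simp [rapidZ]
  | succ n ih =>
    have hN : ∀ r s, rapidNN (smoothA n) (fun _ => 0) r s = 0 := fun r s => by simp [rapidNN, ih.2]
    have ht : tensor (proj (0 : ℕ)) (0 : Op (Idx n)) = 0 := ker_ext fun p q => by
      rw [ker_tensor, ker_zero, ker_zero, mul_zero]
    have hr : IsToeplitzRep (smoothA n) 0 (fun _ => 0) 0 :=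
      ⟨fun _ => ih.1, fun r s => by rw [hN]; exact ENNReal.zero_lt_top, fun m => by simp [rapidZ],
        0, 0, by simp [ht], by simp, by simp⟩
    refine ⟨⟨_, _, hr⟩, fun m => le_antisymm
      (iInf_le_of_le (fun _ => 0) (iInf_le_of_le 0 (iInf_le_of_le hr ?_))) zero_le⟩
    simp [hN, rapidZ]

theorem projTensor_zero {ι κ X Y : Type} {A : FrechetOps ι X} {B : FrechetOps κ Y}
    (hA : (0 : Op X) ∈ A.carrier ∧ ∀ m, A.seminorm m 0 = 0) (hB : (0 : Op Y) ∈ B.carrier) :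
    (0 : Op (X × Y)) ∈ (projTensor A B).carrier ∧ ∀ p, (projTensor A B).seminorm p 0 = 0 := by
  have ht : tensor (0 : Op X) (0 : Op Y) = 0 := ker_ext fun p q => by
    rw [ker_tensor, ker_zero, ker_zero, ker_zero, mul_zero]
  have hr : IsTensorRep A B 0 (fun _ => 0) (fun _ => 0) :=
    ⟨fun _ => hA.1, fun _ => hB, fun p r => by simp [hA.2], by simp [ht]⟩
  refine ⟨⟨_, _, hr⟩, fun p => le_antisymm
    (iInf_le_of_le (fun _ => 0) (iInf_le_of_le (fun _ => 0) (iInf_le_of_le hr ?_))) zero_le⟩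
  simp [hA.2]

theorem toeplitzInf_zero : (0 : Op ℕ) ∈ toeplitzInf.carrier ∧ ∀ m, toeplitzInf.seminorm m 0 = 0 := by
  have hr : IsTRep 0 0 0 :=
    ⟨fun m => by simp [rapidMat], fun m => by simp [rapidZ], 0, 0, by simp, by simp, by simp⟩
  refine ⟨⟨_, _, hr⟩, fun m => le_antisymm
    (iInf_le_of_le 0 (iInf_le_of_le 0 (iInf_le_of_le hr ?_))) zero_le⟩
  simp [rapidMat, rapidZ]

theorem toeplitzPow_zero_mem (l : ℕ) : (0 : Op (NIdx l)) ∈ (toeplitzPow l).carrier := by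
  induction l with
  | zero => exact Set.mem_univ _
  | succ l ih => exact (projTensor_zero toeplitzInf_zero ih).1

theorem smoothJ_zero (l : ℕ) :
    (0 : Op (Idx l × NIdx l)) ∈ (smoothJ l).carrier ∧ ∀ p, (smoothJ l).seminorm p 0 = 0 := by
  have hd : ∀ m n, IsDTD l 0 m n 0 := fun m n x y => by simp
  refine projTensor_zero ⟨fun m n => ⟨0, hd m n⟩, fun p => le_antisymm
    (iInf_le_of_le 0 (iInf_le_of_le (hd p.1 p.2) ?_)) zero_le⟩ (toeplitzPow_zero_mem l)
  rw [enorm_eq_nnnorm, nnnorm_zero, ENNReal.coe_zero]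

theorem scrB_seminorm_zero (l : ℕ) (p : ℕ × (ℕ × ℕ) × NIdx l) : (scrB l).seminorm p 0 = 0 := by
  have hs : symbolLift l (fun _ => 0) = 0 := by
    change symbolLift l (diag l 0) = 0
    rw [symbolLift_diag]
    exact ker_ext fun p q => by rw [ker_tensor, ker_zero, ker_zero, zero_mul]
  have hd : IsDecomp l 0 (fun _ => 0) 0 :=
    ⟨fun _ => (smoothA_zero l).1, (smoothJ_zero l).1, by rw [hs, add_zero]⟩
  refine le_antisymm
    (iInf_le_of_le (fun _ => 0) (iInf_le_of_le 0 (iInf_le_of_le hd ?_))) zero_le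
  simp [(smoothA_zero l).2, (smoothJ_zero l).2]

theorem enorm_tensor_mul_le {X Y : Type} (a P : Op X) (Q : Op Y) :
    ‖tensor (a * P) Q‖ₑ ≤ (‖P‖ₑ * ‖Q‖ₑ) * ‖a‖ₑ := by
  have h1 : ‖a * P‖ₑ ≤ ‖a‖ₑ * ‖P‖ₑ := by
    simp only [enorm_eq_nnnorm]
    exact_mod_cast norm_mul_le a P
  refine (enorm_tensor_le _ _).trans ((mul_le_mul_left h1 _).trans (le_of_eq ?_))
  ring

theorem enorm_op_add_le {X : Type} (T U : Op X) : ‖T + U‖ₑ ≤ ‖T‖ₑ + ‖U‖ₑ := by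
  simp only [enorm_eq_nnnorm]
  exact_mod_cast nnnorm_add_le T U

theorem scrB_ctrl_norm (l : ℕ) : Ctrl (scrB l) fun T => ‖T‖ₑ := by
  obtain ⟨C, M, hC, h⟩ := smoothA_ctrl_norm l
  obtain ⟨C', M', hC', h'⟩ := smoothJ_ctrl_norm l
  set E : NNReal := ‖PF l‖₊ * ‖P0 l‖₊ + ‖PF l‖₊ * ‖1 - P0 l‖₊ + ‖1 - PF l‖₊ * ‖P0 l‖₊ +
    ‖1 - PF l‖₊ * ‖1 - P0 l‖₊
  have hne : E * C + C' ≠ 0 := by positivity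
  refine ⟨E * C + C', (M, M'), hne, fun T => ?_⟩
  have h0 : ((E * C + C' : NNReal) : ℝ≥0∞) ≠ 0 := by exact_mod_cast hne
  simp only [scrB]
  simp_rw [ENNReal.mul_iInf_of_ne h0 ENNReal.coe_ne_top]
  refine le_iInf fun a => le_iInf fun R => le_iInf fun hd => ?_
  have e1 : ‖PF l‖ₑ * ‖P0 l‖ₑ ≤ E := by
    simp only [enorm_eq_nnnorm]
    exact_mod_cast (le_self_add.trans le_self_add).trans le_self_add
  have e2 : ‖PF l‖ₑ * ‖1 - P0 l‖ₑ ≤ E := by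
    simp only [enorm_eq_nnnorm]
    exact_mod_cast (le_add_self.trans le_self_add).trans le_self_add
  have e3 : ‖1 - PF l‖ₑ * ‖P0 l‖ₑ ≤ E := by
    simp only [enorm_eq_nnnorm]
    exact_mod_cast le_add_self.trans le_self_add
  have e4 : ‖1 - PF l‖ₑ * ‖1 - P0 l‖ₑ ≤ E := by
    simp only [enorm_eq_nnnorm]
    exact_mod_cast le_add_self
  have key : ∀ (i : Fin 4) (P : Op (Idx l)) (Q : Op (NIdx l)), ‖P‖ₑ * ‖Q‖ₑ ≤ E →
      ‖tensor (a i * P) Q‖ₑ ≤ (E * C : NNReal) * (smoothA l).seminorm M (a i) := fun i P Q hE => by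
    refine (enorm_tensor_mul_le _ _ _).trans ((mul_le_mul' hE (h _)).trans (le_of_eq ?_))
    push_cast
    ring
  calc ‖T‖ₑ = ‖symbolLift l a + R‖ₑ := by rw [← hd.2.2]
    _ ≤ ‖symbolLift l a‖ₑ + ‖R‖ₑ := enorm_op_add_le _ _
    _ ≤ (E * C : NNReal) * (∑ i, (smoothA l).seminorm M (a i)) + C' * (smoothJ l).seminorm M' R := by
        refine add_le_add ?_ (h' R)
        rw [Fin.sum_univ_four, mul_add, mul_add, mul_add]
        refine (enorm_op_add_le _ _).trans (add_le_add ((enorm_op_add_le _ _).trans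
          (add_le_add ((enorm_op_add_le _ _).trans (add_le_add ?_ ?_)) ?_)) ?_)
        · exact key 0 _ _ e1
        · exact key 1 _ _ e2
        · exact key 2 _ _ e3
        · exact key 3 _ _ e4
    _ ≤ _ := by
        rw [mul_add]
        gcongr
        · exact le_self_add
        · exact le_add_self

/-- The operators whose entries along the half-lines are asymptotically equal. -/
def equalLimits (l : ℕ) : Set (Op (Idx l × NIdx l)) :=
  {T | ∀ i p q, Filter.Tendsto (fun N => probeKer l i p q N T - probeKer l 0 p q N T) Filter.atTop
    (nhds 0)}

/-- Every probed entry is `1`-Lipschitz in the operator norm, uniformly in `N`, so an `ε/3` argument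
applies. -/
theorem isClosed_equalLimits (l : ℕ) : IsClosed (equalLimits l) := by
  refine isClosed_of_closure_subset fun T hT i p q => Metric.tendsto_atTop.2 fun ε hε => ?_
  obtain ⟨U, hU, hTU⟩ := Metric.mem_closure_iff.1 hT (ε / 3) (by positivity)
  obtain ⟨N₀, hN⟩ := Metric.tendsto_atTop.1 (hU i p q) (ε / 3) (by positivity)
  refine ⟨N₀, fun N h => ?_⟩
  have h1 := hN N h
  rw [dist_zero_right] at h1 ⊢
  rw [dist_eq_norm] at hTU
  have h2 : ∀ i, ‖probeKer l i p q N T - probeKer l i p q N U‖ ≤ ‖T - U‖ := fun i =>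
    norm_ker_le (T - U) _ _
  have h3 : probeKer l i p q N T - probeKer l 0 p q N T =
      (probeKer l i p q N U - probeKer l 0 p q N U) +
      ((probeKer l i p q N T - probeKer l i p q N U) -
        (probeKer l 0 p q N T - probeKer l 0 p q N U)) := by ring
  rw [h3]
  have h4 := norm_add_le (probeKer l i p q N U - probeKer l 0 p q N U)
    ((probeKer l i p q N T - probeKer l i p q N U) - (probeKer l 0 p q N T - probeKer l 0 p q N U))
  have h5 := norm_sub_le (probeKer l i p q N T - probeKer l i p q N U)
    (probeKer l 0 p q N T - probeKer l 0 p q N U)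
  have h6 := h2 i
  have h7 := h2 0
  linarith

theorem IsDecomp.mem_equalLimits_iff {l : ℕ} (hl : 1 ≤ l) {x R : Op (Idx l × NIdx l)}
    {a : Fin 4 → Op (Idx l)} (h : IsDecomp l x a R) : x ∈ equalLimits l ↔ ∀ i, a i = a 0 := by
  have ht : ∀ i p q, Filter.Tendsto (fun N => probeKer l i p q N x - probeKer l 0 p q N x)
      Filter.atTop (nhds (ker (a i) p q - ker (a 0) p q)) := fun i p q =>
    (h.tendsto hl i p q).sub (h.tendsto hl 0 p q)
  constructor
  · exact fun hx i => ker_ext fun p q => sub_eq_zero.1 (tendsto_nhds_unique (ht i p q) (hx i p q))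
  · intro ha i p q
    have := ht i p q
    rwa [ha i, sub_self] at this

/-- On `ℬ` membership amounts to lying in `C_ℓ` and having equal limits along the four half-lines.
Both conditions are norm-closed, and the inclusion of `ℬ` into the bounded operators is continuous.
-/
theorem smoothSphere_isClosedIn {l : ℕ} (hl : 1 ≤ l) (q : ℝ) :
    (scrB l).IsClosedIn (smoothSphere l q) := by
  let _ := (scrB l).topology
  have hc := FrechetOps.continuous_val (scrB_ctrl_norm l) (scrB_seminorm_zero l)
  have h1 : IsClosed ((sphereAlg l q : Set (Op (Idx l × NIdx l))) ∩ equalLimits l) :=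
    (StarSubalgebra.isClosed_topologicalClosure _).inter (isClosed_equalLimits l)
  have h2 := h1.preimage hc
  change IsClosed {x : (scrB l).carrier | (x : Op (Idx l × NIdx l)) ∈ smoothSphere l q}
  convert h2 using 1
  ext x
  obtain ⟨x, a, R, h⟩ := x
  change x ∈ smoothSphere l q ↔ x ∈ sphereAlg l q ∧ x ∈ equalLimits l
  rw [h.mem_equalLimits_iff hl]
  constructor
  · rintro ⟨-, hx, b, -, hb⟩
    rw [h.theta_eq hl] at hb
    subst hb
    exact ⟨hx, fun _ => rfl⟩
  · rintro ⟨hx, ha⟩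
    exact ⟨⟨a, R, h⟩, hx, a 0, h.1 0, by rw [h.theta_eq hl]; exact (funext ha).symm⟩

theorem smoothSphere_closedUnderHFC {l : ℕ} (hl : 1 ≤ l) (q : ℝ) :
    ClosedUnderHFC {a : sphereAlg l q | (a : Op (Idx l × NIdx l)) ∈ smoothSphere l q} := by
  intro a ha f b hb
  rw [Set.mem_ofPred_eq, mem_smoothSphere_iff hl] at ha ⊢
  exact ⟨b.2, ha.2.holomorphic hb⟩

end QSphere

end

/-! ### The theorem -/

theorem mainTheorem5 (l : ℕ) (hl : 1 ≤ l) (q : ℝ) (hq0 : 0 < q) (hq1 : q < 1) :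
    (∃ s : StarSubalgebra ℂ (QSphere.Op (QSphere.Idx l × QSphere.NIdx l)),
      (s : Set (QSphere.Op (QSphere.Idx l × QSphere.NIdx l))) = QSphere.smoothSphere l q) ∧
    (QSphere.scrB l).IsClosedIn (QSphere.smoothSphere l q) ∧
    QSphere.ClosedUnderHFC
      {a : QSphere.sphereAlg l q |
        (a : QSphere.Op (QSphere.Idx l × QSphere.NIdx l)) ∈ QSphere.smoothSphere l q} :=
  ⟨⟨QSphere.smoothSphereAlg hl q, rfl⟩, QSphere.smoothSphere_isClosedIn hl q,
    QSphere.smoothSphere_closedUnderHFC hl q⟩
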